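/- For $\lambda\in\mathbb{C}\setminus\{0,1\}$ let $E_\lambda\colon y^2=x(x-1)(x-\lambda)$. For $\alpha\in\mathbb{C}$ let $T(\alpha)$ be the set of all $\lambda\in\mathbb{C}\setminus\{0,1\}$ such that the points with $x$-coordinate $\alpha$ on $E_\lambda$ are torsion (such points exist and differ by sign), and put $T(\alpha,\beta)=T(\alpha)\cap T(\beta)$. Let $\bar{\mathbb{Q}}\subseteq\mathbb{C}$ be the field of algebraic numbers, and fix an embedding $i\colon\bar{\mathbb{Q}}\hookrightarrow\bar{\mathbb{Q}}_2$. Let $Z=\{\alpha\in\bar{\mathbb{Q}} : i(\alpha)\text{ is integral}\}$, let $\rho\colon\bar{\mathbb{Q}}\to\mathbb{P}^1(\bar{\mathbb{F}}_2)$ be the reduction map (so $\rho(\alpha)=\infty$ if and only if $\alpha\notin Z$), and let $v\colon\bar{\mathbb{Q}}\to\mathbb{Q}\cup\{\infty\}$ be the valuation induced by $i$, normalized by $v(2)=1$. For $\alpha\in\bar{\mathbb{Q}}\setminus\{0,1\}$ put \[ S(\alpha)=\Bigl\{\alpha,\ \alpha^2,\ \alpha(2-\alpha),\ \frac{\alpha^2}{2\alpha-1}\Bigr\},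 \] \[ R(\alpha)=\begin{cases}\{\alpha^2+2u\alpha(1-\alpha) : u\in Z,\ \rho(u^2)=\rho(\alpha)\} & \text{if }\alpha\in Z,\\ \Bigl\{\dfrac{\alpha^2}{1+2(\alpha-1)u} : u\in Z,\ \rho(u)=0\Bigr\} & \text{otherwise,}\end{cases} \] where fractions with vanishing denominator are left out. Let $\alpha,\beta\in\bar{\mathbb{Q}}\setminus\{0,1\}$. If $R(\alpha)\cap R(\beta)=\emptyset$, then \[ T(\alpha,\beta)\subseteq\bigl(S(\alpha)\cap S(\beta)\bigr)\cup\bigl(S(\alpha)\cap R(\beta)\bigr)\cup\bigl(R(\alpha)\cap S(\beta)\bigr)\subseteq S(\alpha)\cup S(\beta), \] and $T(\alpha,\beta)$ is finite. It is moreover effectively computable: there is a single algorithm (a partial recursive function) that, given an irreducible polynomial $f\in\mathbb{Q}[X]$ and polynomials $a,b\in\mathbb{Q}[X]$, has the following property. For every root $\theta\in\bar{\mathbb{Q}}$ of $f$ such that $\alpha=a(\theta)$ and $\beta=b(\theta)$ are different from $0$ and $1$ and satisfy $R(\alpha)\cap R(\beta)=\emptyset$ for some embedding $i$, it terminates and returns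 a finite list of polynomials $c_1,\dots,c_m\in\mathbb{Q}[X]$ with $T(\alpha,\beta)=\{c_1(\theta),\dots,c_m(\theta)\}$. The condition $R(\alpha)\cap R(\beta)=\emptyset$ holds in each of the following situations: (1) $\rho(\alpha)\neq\rho(\beta)$; (2) $\rho(\alpha)=\rho(\beta)\notin\{0,1,\infty\}$ and $v(\alpha-\beta)\le 1/2$; (3) $\rho(\alpha)=\rho(\beta)=1$, $0<v(\alpha-1)\le 1$ and $v(\alpha-\beta)=v(\alpha-1)$; (4) $\rho(\alpha)=\rho(\beta)=0$, $v(\alpha)\le 1$ and $v(\alpha-\beta)=v(\alpha)$; (5) $\rho(\alpha)=\rho(\beta)=\infty$, $v(\alpha)\ge -1$ and $v(\alpha-\beta)=v(\beta)$. -/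

import Mathlib

noncomputable section

namespace SimTorsion

/-! ### Torsion in the Legendre family -/

/-- The Legendre curve `E_l : y² = x (x - 1) (x - l) = x³ - (1 + l) x² + l x` over `ℂ`. -/
def legendre (l : ℂ) : WeierstrassCurve.Affine ℂ where
  a₁ := 0
  a₂ := -(1 + l)
  a₃ := 0
  a₄ := l
  a₆ := 0

/-- The set `T(a)` of all `l ∈ ℂ \ {0, 1}` such that a point with `x`-coordinate `a` is torsion
on `E_l`. (There is always a point with `x`-coordinate `a`, and it is unique up to sign.) -/
def T (a : ℂ) : Set ℂ :=
  {l | l ≠ 0 ∧ l ≠ 1 ∧ ∃ (y : ℂ) (h : (legendre l).Nonsingular a y),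
    IsOfFinAddOrder (WeierstrassCurve.Affine.Point.some a y h)}

/-- `T(a, b) = T(a) ∩ T(b)`. -/
def T₂ (a b : ℂ) : Set ℂ := T a ∩ T b

/-! ### Algebraic numbers and their 2-adic reduction -/

/-- The field of algebraic numbers, as a subfield of `ℂ`. -/
abbrev Qbar : Type := algebraicClosure ℚ ℂ

/-- The valuation ring of the algebraic closure of `ℚ_2`: the elements of norm at most `1`. -/
abbrev integers₂ : ValuationSubring (PadicAlgCl 2) :=
  (Valued.v (R := PadicAlgCl 2)).valuationSubring

/-- The residue field of the algebraic closure of `ℚ_2`, an algebraic closure of `𝔽_2`. -/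
abbrev residueField₂ : Type := IsLocalRing.ResidueField integers₂

/-- The ring `Z` of algebraic numbers that are 2-adically integral with respect to `i`. -/
def Z (i : Qbar →+* PadicAlgCl 2) : ValuationSubring Qbar := integers₂.comap i

open Classical in
/-- The reduction map `ρ` to the projective line over the residue field, which is regarded as the
residue field together with the point `∞`. -/
def rho (i : Qbar →+* PadicAlgCl 2) (a : Qbar) : OnePoint residueField₂ :=
  if h : i a ∈ integers₂ then
    ((IsLocalRing.residue integers₂ ⟨i a, h⟩ : residueField₂) : OnePoint residueField₂)
  else OnePoint.infty

open Classical in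
/-- The additive valuation induced by `i`, with `v 0 = ⊤` and `v 2 = 1`. -/
def v (i : Qbar →+* PadicAlgCl 2) (a : Qbar) : WithTop ℝ :=
  if a = 0 then ⊤ else ((-Real.logb 2 ‖i a‖ : ℝ) : WithTop ℝ)

/-- The set `S(a) = {a, a², a (2 - a), a² / (2 a - 1)}`, where the last element is left out if
its denominator vanishes. -/
def S (a : Qbar) : Set Qbar :=
  {l | l = a ∨ l = a ^ 2 ∨ l = a * (2 - a) ∨ (2 * a - 1 ≠ 0 ∧ l = a ^ 2 / (2 * a - 1))}

open Classical in
/-- The set `R(a)`. -/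
def R (i : Qbar →+* PadicAlgCl 2) (a : Qbar) : Set Qbar :=
  if a ∈ Z i then
    {l | ∃ u ∈ Z i, rho i (u ^ 2) = rho i a ∧ l = a ^ 2 + 2 * u * a * (1 - a)}
  else
    {l | ∃ u ∈ Z i, rho i u = ((0 : residueField₂) : OnePoint residueField₂) ∧
      1 + 2 * (a - 1) * u ≠ 0 ∧ l = a ^ 2 / (1 + 2 * (a - 1) * u)}

/-! ### Codes for exact computation -/

/-- The rational number `m / (n + 1)` with code `(m, n)`. -/
def ratOfCode (c : ℤ × ℕ) : ℚ := (c.1 : ℚ) / ((c.2 : ℚ) + 1)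

/-- Codes for polynomials with rational coefficients: lists of coefficients, starting with the
constant one. -/
abbrev PolyCode : Type := List (ℤ × ℕ)

/-- The polynomial with a given code. -/
def polyOfCode : PolyCode → Polynomial ℚ
  | [] => 0
  | c :: cs => Polynomial.C (ratOfCode c) + Polynomial.X * polyOfCode cs

/-- The value at `θ` of the polynomial with code `c`. -/
def evalCode (θ : Qbar) (c : PolyCode) : Qbar := Polynomial.aeval θ (polyOfCode c)

end SimTorsion

end

/-! A point is torsion exactly when its x-coordinate is preperiodic under duplication
(`isOfFinAddOrder_iff_prep`). This condition is invariant under field embeddings. Since the elements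
of T(α) are algebraic, everything can be studied 2-adically.

There infinity is attracting: if |x| > max(1,|λ|), duplication multiplies |x| by 1/|4|. So torsion
points satisfy |x| ≤ max(1,|λ|) (`Prep.norm_le`), and applying this to the doubles of P and of 2P
constrains P and 2P further. Suppose that P does not have order dividing four, that is λ ∉ S(α). For
integral α write λ = α² + 2uα(1-α); with y = x(2P) the duplication formula becomes u² = y(2u-1), and
the constraints force u to be integral with u² ≡ α. For non-integral α the substitution λ =
α²/(1+2(α-1)u) gives λu² = y(2u-1) and |u| < 1. In both cases λ ∈ R(α), so T(α) ⊆ S(α) ∪ R(α)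
(`mem_S_or_mem_R`). If R(α) and R(β) are disjoint, only the finitely many elements of S(α) ∪ S(β)
remain. The sufficient conditions are ultrametric estimates for (α-β)² when R(α) and R(β) share an
element.

For effectivity the candidates are explicit, so it is enough to decide torsion for a given λ.
Torsion can be found by search; infinite order needs a finite certificate. The product formula
x(P+Q)x(P-Q) = ((xx'-λ)/(x-x'))² bounds `pairNum`/`cross` by max(1,|λ|) for multiples of a torsion
point (`Prep.norm_pairNum_le`), while compactness makes this quotient unbounded along the doubles of
a point of infinite order (`exists_lt_norm_pairNum`). A violation of the bound is recorded by
polynomials over ℤ and ℚ that refer neither to θ nor to i (`InfiniteOrderCert`). Torsion and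
infinite order are then both enumerable, and an unbounded search decides between them. -/

namespace SimTorsion

open WeierstrassCurve.Affine

/-! ### The doubling map on homogeneous `x`-coordinates -/

section Dynamics

/-- The duplication map of the Legendre curve with parameter `l`, on homogeneous
`x`-coordinates. -/
def dbl {R : Type*} [CommRing R] (l : R) (v : R × R) : R × R :=
  ((v.1 ^ 2 - l * v.2 ^ 2) ^ 2, 4 * v.1 * v.2 * (v.1 - v.2) * (v.1 - l * v.2))

/-- The `m`-th iterate of the duplication map. -/
def orb {R : Type*} [CommRing R] (l : R) (v : R × R) (m : ℕ) : R × R := (dbl l)^[m] v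

/-- The determinant of two pairs. -/
def cross {R : Type*} [CommRing R] (v w : R × R) : R := v.1 * w.2 - w.1 * v.2

/-- The bilinear form whose quotient by `cross` gives the geometric mean of `x (P + Q)` and
`x (P - Q)`. -/
def pairNum {R : Type*} [CommRing R] (l : R) (v w : R × R) : R := v.1 * w.1 - l * v.2 * w.2

/-- `v` represents a point of the projective line that is preperiodic under duplication. -/
def Prep {R : Type*} [CommRing R] (l : R) (v : R × R) : Prop :=
  ∃ m n, m < n ∧ cross (orb l v m) (orb l v n) = 0

section Ring

variable {R S : Type*} [CommRing R] [CommRing S]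

@[simp] lemma orb_zero (l : R) (v : R × R) : orb l v 0 = v := rfl

lemma orb_succ (l : R) (v : R × R) (m : ℕ) : orb l v (m + 1) = dbl l (orb l v m) :=
  Function.iterate_succ_apply' _ _ _

lemma orb_dbl (l : R) (v : R × R) (m : ℕ) : orb l (dbl l v) m = orb l v (m + 1) :=
  (Function.iterate_succ_apply _ _ _).symm

lemma dbl_smul (l c : R) (v : R × R) : dbl l (c • v) = c ^ 4 • dbl l v := by
  ext <;> simp [dbl] <;> ring

lemma cross_smul_smul (c d : R) (v w : R × R) : cross (c • v) (d • w) = c * d * cross v w := by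
  simp [cross]; ring

lemma cross_comm (v w : R × R) : cross v w = -cross w v := by
  simp [cross]

lemma pairNum_smul_smul (l c d : R) (v w : R × R) :
    pairNum l (c • v) (d • w) = c * d * pairNum l v w := by
  simp [pairNum]; ring

lemma orb_smul (l c : R) (v : R × R) (m : ℕ) : ∃ k, orb l (c • v) m = c ^ k • orb l v m := by
  induction m with
  | zero => exact ⟨1, by simp⟩
  | succ m ih =>
    obtain ⟨k, hk⟩ := ih
    exact ⟨k * 4, by rw [orb_succ, hk, dbl_smul, orb_succ, pow_mul]⟩

lemma map_dbl (f : R →+* S) (l : R) (v : R × R) :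
    Prod.map f f (dbl l v) = dbl (f l) (Prod.map f f v) := by
  ext
  · simp [dbl]
  · simp only [dbl, Prod.map_snd, Prod.map_fst, map_mul, map_sub, map_ofNat]

lemma map_orb (f : R →+* S) (l : R) (v : R × R) (m : ℕ) :
    Prod.map f f (orb l v m) = orb (f l) (Prod.map f f v) m := by
  induction m with
  | zero => rfl
  | succ m ih => rw [orb_succ, map_dbl, ih, orb_succ]

lemma map_cross (f : R →+* S) (v w : R × R) :
    f (cross v w) = cross (Prod.map f f v) (Prod.map f f w) := by
  simp [cross]

lemma map_pairNum (f : R →+* S) (l : R) (v w : R × R) :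
    f (pairNum l v w) = pairNum (f l) (Prod.map f f v) (Prod.map f f w) := by
  simp [pairNum]

lemma map_cross_orb (f : R →+* S) (l : R) (v : R × R) (m n : ℕ) :
    f (cross (orb l v m) (orb l v n)) =
      cross (orb (f l) (Prod.map f f v) m) (orb (f l) (Prod.map f f v) n) := by
  rw [map_cross, map_orb, map_orb]

lemma prep_map_iff {f : R →+* S} (hf : Function.Injective f) (l : R) (v : R × R) :
    Prep (f l) (Prod.map f f v) ↔ Prep l v := by
  simp only [Prep, ← map_cross_orb, map_eq_zero_iff f hf]

end Ring

section Field

variable {K : Type*} [Field K] {l : K}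

lemma exists_smul_of_cross_eq_zero {v w : K × K} (hv : v ≠ 0) (h : cross v w = 0) :
    ∃ c : K, w = c • v := by
  obtain ⟨a, b⟩ := v
  obtain ⟨c, d⟩ := w
  simp only [cross] at h
  by_cases ha : a = 0
  · have hb : b ≠ 0 := by rintro rfl; exact hv (by simp [ha])
    refine ⟨d / b, ?_⟩
    subst ha
    have : c = 0 := by simpa [hb] using h
    ext <;> simp [this, hb]
  · refine ⟨c / a, ?_⟩
    ext
    · simp [ha]
    · simp only [Prod.smul_mk, smul_eq_mul]
      field_simp
      linear_combination h

/-- Duplication is homogeneous of degree four, hence respects proportionality. -/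
lemma cross_dbl_eq_zero {v w : K × K} (h : cross v w = 0) : cross (dbl l v) (dbl l w) = 0 := by
  by_cases hv : v = 0
  · simp [hv, dbl, cross]
  · obtain ⟨c, rfl⟩ := exists_smul_of_cross_eq_zero hv h
    rw [dbl_smul]
    simp [cross]
    ring

lemma Prep.dbl {v : K × K} (h : Prep l v) : Prep l (dbl l v) := by
  obtain ⟨m, n, hmn, h⟩ := h
  refine ⟨m, n, hmn, ?_⟩
  rw [orb_dbl, orb_dbl, orb_succ, orb_succ]
  exact cross_dbl_eq_zero h

lemma Prep.smul {v : K × K} (h : Prep l v) (c : K) : Prep l (c • v) := by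
  obtain ⟨m, n, hmn, h⟩ := h
  refine ⟨m, n, hmn, ?_⟩
  obtain ⟨i, hi⟩ := orb_smul l c v m
  obtain ⟨j, hj⟩ := orb_smul l c v n
  rw [hi, hj, cross_smul_smul, h, mul_zero]

lemma Prep.div {a b : K} (hb : b ≠ 0) (h : Prep l (a, b)) : Prep l (a / b, 1) := by
  have := h.smul b⁻¹
  rwa [Prod.smul_mk, smul_eq_mul, smul_eq_mul, inv_mul_cancel₀ hb, inv_mul_eq_div] at this

/-- The two duplication forms have no common zero, so duplication is defined on the whole projective
line. -/
lemma dbl_ne_zero (h2 : (2 : K) ≠ 0) (h0 : l ≠ 0) (h1 : l ≠ 1) {v : K × K} (hv : v ≠ 0) :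
    dbl l v ≠ 0 := by
  obtain ⟨a, b⟩ := v
  intro h
  have h4 : (4 : K) ≠ 0 := by
    have : (4 : K) = 2 * 2 := by norm_num
    rw [this]; exact mul_ne_zero h2 h2
  simp only [SimTorsion.dbl, Prod.mk_eq_zero, mul_eq_zero, h4, false_or, pow_eq_zero_iff,
    ne_eq, OfNat.ofNat_ne_zero, not_false_eq_true] at h
  obtain ⟨ha, hb⟩ := h
  have hb0 : b ≠ 0 := by
    rintro rfl
    have : a = 0 := by simpa using ha
    exact hv (by simp [this])
  rcases hb with ((rfl | rfl) | hb) | hb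
  · have : l * b ^ 2 = 0 := by linear_combination -ha
    simp [h0, hb0] at this
  · exact hb0 rfl
  · obtain rfl := sub_eq_zero.1 hb
    have : (1 - l) * a ^ 2 = 0 := by linear_combination ha
    simp [hb0, sub_eq_zero, h1.symm] at this
  · have : a = l * b := by linear_combination hb
    subst this
    have : l * (l - 1) * b ^ 2 = 0 := by linear_combination ha
    simp [hb0, sub_eq_zero, h1, h0] at this

/-- If the orbit of `v` meets the point at infinity, then `v` is preperiodic. -/
lemma prep_of_orb_snd_eq_zero {v : K × K} {m : ℕ} (h : (orb l v m).2 = 0) : Prep l v := by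
  -- Infinity is fixed: `dbl` sends (c, 0) to (c⁴, 0).
  refine ⟨m, m + 1, m.lt_succ_self, ?_⟩
  rw [orb_succ]
  simp [cross, SimTorsion.dbl, h]

end Field

end Dynamics

/-! ### The duplication map and the group law -/

section Curve

variable {K : Type*} [Field K]

/-- The Legendre curve over an arbitrary field. -/
def legendreCurve (l : K) : WeierstrassCurve.Affine K where
  a₁ := 0
  a₂ := -(1 + l)
  a₃ := 0
  a₄ := l
  a₆ := 0

lemma equation_iff_legendre {l x y : K} :
    (legendreCurve l).Equation x y ↔ y ^ 2 = x * (x - 1) * (x - l) := by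
  rw [equation_iff]
  simp only [legendreCurve]
  constructor <;> intro h <;> linear_combination h

lemma nonsingular_legendre (h2 : (2 : K) ≠ 0) {l x y : K} (h0 : l ≠ 0) (h1 : l ≠ 1)
    (h : y ^ 2 = x * (x - 1) * (x - l)) : (legendreCurve l).Nonsingular x y := by
  rw [nonsingular_iff', equation_iff_legendre]
  refine ⟨h, ?_⟩
  simp only [legendreCurve]
  by_cases hy : y = 0
  · left
    subst hy
    have h' : x = 0 ∨ x = 1 ∨ x = l := by
      simpa [sub_eq_zero, or_assoc] using h.symm
    rcases h' with rfl | rfl | rfl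
    · simpa using h0
    · intro h'
      exact h1 (by linear_combination h')
    · intro h'
      have : x * (x - 1) = 0 := by linear_combination -h'
      simp [h0, sub_eq_zero, h1] at this
  · right
    intro h'
    exact (mul_ne_zero h2 hy) (by linear_combination h')

/-- Homogeneous coordinates of the image of a point on the projective line. -/
def xpt {l : K} : (legendreCurve l).Point → K × K
  | .zero => (1, 0)
  | .some x _ _ => (x, 1)

/-- `v` represents the image of the point `P` on the projective line. -/
def IsXRep {l : K} (P : (legendreCurve l).Point) (v : K × K) : Prop :=
  ∃ c : K, c ≠ 0 ∧ v = c • xpt P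

/-- The x-coordinate determines a point up to sign. -/
lemma cross_eq_zero_iff [DecidableEq K] {l : K} {P Q : (legendreCurve l).Point} {v w : K × K} (hv : IsXRep P v)
    (hw : IsXRep Q w) : cross v w = 0 ↔ P = Q ∨ P = -Q := by
  obtain ⟨c, hc, rfl⟩ := hv
  obtain ⟨d, hd, rfl⟩ := hw
  rw [cross_smul_smul, mul_eq_zero_iff_left (mul_ne_zero hc hd)]
  cases P with
  | zero =>
    cases Q with
    | zero => simp [cross, xpt]
    | some x y h => simp [cross, xpt, ← Point.zero_def]
  | some x y h =>
    cases Q with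
    | zero => simp [cross, xpt, ← Point.zero_def]
    | some x' y' h' => rw [← Point.X_eq_iff]; simp [cross, xpt, sub_eq_zero]

variable {l : K}

lemma negY_legendre (x y : K) : (legendreCurve l).negY x y = -y := by
  simp [negY, legendreCurve]

lemma IsXRep.add_self [DecidableEq K] (h2 : (2 : K) ≠ 0) (h0 : l ≠ 0) (h1 : l ≠ 1)
    {P : (legendreCurve l).Point} {v : K × K} (hv : IsXRep P v) : IsXRep (P + P) (dbl l v) := by
  obtain ⟨c, hc, rfl⟩ := hv
  have key : IsXRep (P + P) (dbl l (xpt P)) := by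
    cases P with
    | zero => exact ⟨1, one_ne_zero, by rw [← Point.zero_def, add_zero]; ext <;>
        simp [dbl, xpt]⟩
    | some x y h =>
      have heq := equation_iff_legendre.1 h.1
      by_cases hy : y = 0
      · have hz : (Point.some x y h : (legendreCurve l).Point) + .some x y h = 0 :=
          Point.add_self_of_Y_eq (by rw [negY_legendre, hy, neg_zero])
        have hd : (dbl l (x, 1)).2 = 0 := by
          simp only [dbl]
          rw [hy] at heq
          linear_combination -4 * heq
        have hne : dbl l (x, (1 : K)) ≠ 0 := dbl_ne_zero h2 h0 h1 (by simp)
        refine ⟨(dbl l (x, 1)).1, fun h => hne (Prod.ext h hd), ?_⟩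
        rw [hz, Point.zero_def]
        simp only [xpt]
        ext <;> simp [hd]
      · have hne : y ≠ (legendreCurve l).negY x y := by
          rw [negY_legendre]
          intro h
          exact mul_ne_zero h2 hy (by linear_combination h)
        rw [Point.add_self_of_Y_ne hne]
        -- By the equation of the curve, 4y² is the second coordinate of `dbl l (x, 1)`.
        refine ⟨4 * y ^ 2, mul_ne_zero ?_ (pow_ne_zero 2 hy), ?_⟩
        · have : (4 : K) = 2 * 2 := by norm_num
          rw [this]; exact mul_ne_zero h2 h2
        have hs := slope_of_Y_ne rfl hne
        rw [negY_legendre, show y - -y = 2 * y by ring] at hs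
        simp only [xpt, dbl, addX, hs]
        simp only [legendreCurve]
        ext
        · simp only [Prod.smul_mk, smul_eq_mul]
          field_simp
          linear_combination (32 * x - 16 * (1 + l)) * heq
        · simp only [Prod.smul_mk, smul_eq_mul]
          linear_combination -4 * heq
  obtain ⟨d, hd, h⟩ := key
  exact ⟨c ^ 4 * d, mul_ne_zero (pow_ne_zero 4 hc) hd, by rw [dbl_smul, h, smul_smul]⟩

lemma IsXRep.orb [DecidableEq K] (h2 : (2 : K) ≠ 0) (h0 : l ≠ 0) (h1 : l ≠ 1)
    {P : (legendreCurve l).Point} {v : K × K} (hv : IsXRep P v) (m : ℕ) :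
    IsXRep (2 ^ m • P) (orb l v m) := by
  induction m with
  | zero => simpa using hv
  | succ m ih =>
    rw [orb_succ, pow_succ', mul_smul, two_smul]
    exact ih.add_self h2 h0 h1

/-- A point is torsion if and only if its `x`-coordinate is preperiodic under duplication. -/
theorem isOfFinAddOrder_iff_prep [DecidableEq K] (h2 : (2 : K) ≠ 0) (h0 : l ≠ 0) (h1 : l ≠ 1)
    {P : (legendreCurve l).Point} {v : K × K} (hv : IsXRep P v) :
    IsOfFinAddOrder P ↔ Prep l v := by
  constructor
  · intro h
    -- The points 2^m P lie in a finite group, so two of them coincide.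
    have hfin : Finite (AddSubgroup.zmultiples P) := h.finite_zmultiples
    obtain ⟨m, n, hmn, heq⟩ := Finite.exists_ne_map_eq_of_infinite
      (fun m : ℕ => (⟨2 ^ m • P, AddSubgroup.nsmul_mem_zmultiples P _⟩ : AddSubgroup.zmultiples P))
    have heq' : 2 ^ m • P = 2 ^ n • P := congrArg Subtype.val heq
    have key := fun i j => cross_eq_zero_iff (hv.orb h2 h0 h1 i) (hv.orb h2 h0 h1 j)
    rcases lt_or_gt_of_ne hmn with hlt | hlt
    · exact ⟨m, n, hlt, (key m n).2 (.inl heq')⟩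
    · exact ⟨n, m, hlt, (key n m).2 (.inl heq'.symm)⟩
  · rintro ⟨m, n, hlt, h⟩
    rw [cross_eq_zero_iff (hv.orb h2 h0 h1 m) (hv.orb h2 h0 h1 n)] at h
    have hpow : 2 ^ m < 2 ^ n := Nat.pow_lt_pow_right (by norm_num) hlt
    rw [isOfFinAddOrder_iff_nsmul_eq_zero]
    -- From 2^m P = ±2^n P it follows that 2^n ∓ 2^m annihilates P.
    rcases h with h | h
    · refine ⟨2 ^ n - 2 ^ m, by omega, ?_⟩
      rw [sub_nsmul _ hpow.le, h]
      simp
    · refine ⟨2 ^ n + 2 ^ m, by positivity, ?_⟩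
      rw [add_nsmul, h]
      simp

/-- The product formula for the `x`-coordinates of `P + Q` and `P - Q`. -/
lemma exists_add_sub [DecidableEq K] {x y x' y' : K} (h : (legendreCurve l).Nonsingular x y)
    (h' : (legendreCurve l).Nonsingular x' y') (hx : x ≠ x') :
    ∃ (x₃ y₃ x₄ y₄ : K) (h₃ : (legendreCurve l).Nonsingular x₃ y₃)
      (h₄ : (legendreCurve l).Nonsingular x₄ y₄),
      Point.some x y h + .some x' y' h' = .some x₃ y₃ h₃ ∧
      Point.some x y h - .some x' y' h' = .some x₄ y₄ h₄ ∧
      x₃ * x₄ * (x - x') ^ 2 = (x * x' - l) ^ 2 := by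
  have e := equation_iff_legendre.1 h.1
  have e' := equation_iff_legendre.1 h'.1
  rw [sub_eq_add_neg, Point.neg_some, Point.add_of_X_ne hx, Point.add_of_X_ne hx]
  refine ⟨_, _, _, _, _, _, rfl, rfl, ?_⟩
  rw [slope_of_X_ne hx, slope_of_X_ne hx]
  simp only [negY_legendre]
  simp only [addX, legendreCurve]
  have hd : x - x' ≠ 0 := sub_ne_zero.2 hx
  -- The factors are the numerators of the two x-coordinates. Their product is even in y and in y',
  -- so the curve equations eliminate both.
  have e2 : ((y - y') ^ 2 - (x - x') ^ 2 * (x + x' - 1 - l)) *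
      ((y + y') ^ 2 - (x - x') ^ 2 * (x + x' - 1 - l)) = (x * x' - l) ^ 2 * (x - x') ^ 2 := by
    have a1 : ((y - y') ^ 2 - (x - x') ^ 2 * (x + x' - 1 - l)) *
      ((y + y') ^ 2 - (x - x') ^ 2 * (x + x' - 1 - l)) =
      (y ^ 2 - y' ^ 2) ^ 2 - 2 * (y ^ 2 + y' ^ 2) * ((x - x') ^ 2 * (x + x' - 1 - l)) +
        ((x - x') ^ 2 * (x + x' - 1 - l)) ^ 2 := by ring
    rw [a1, e, e']
    ring
  have hsub : y - -y' = y + y' := by ring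
  rw [hsub]
  field_simp
  linear_combination e2

end Curve

end SimTorsion

namespace SimTorsion

/-! ### Preperiodic points over a field of residue characteristic two -/

section Norm

lemma norm_four {k : Type*} [NormedField k] : ‖(4 : k)‖ = ‖(2 : k)‖ ^ 2 := by
  rw [← norm_pow]; norm_num

lemma norm_four_lt_one {k : Type*} [NormedField k] (h2 : ‖(2 : k)‖ < 1) : ‖(4 : k)‖ < 1 := by
  rw [norm_four]; exact pow_lt_one₀ (norm_nonneg _) h2 two_ne_zero

lemma norm_four_pos {k : Type*} [NormedField k] (h2' : (2 : k) ≠ 0) : 0 < ‖(4 : k)‖ := by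
  rw [norm_four]; exact pow_pos (norm_pos_iff.2 h2') 2

lemma dbl_snd_ne_zero {k : Type*} [NormedField k] {l x : k} (h2' : (2 : k) ≠ 0) (hx0 : x ≠ 0)
    (hx1 : x ≠ 1) (hxl : x ≠ l) : (dbl l (x, 1)).2 ≠ 0 := by
  have h4 : (4 : k) ≠ 0 := norm_pos_iff.1 (norm_four_pos h2')
  simp only [dbl, mul_one]
  exact mul_ne_zero (mul_ne_zero (mul_ne_zero h4 hx0) (sub_ne_zero.2 hx1)) (sub_ne_zero.2 hxl)

variable {k : Type*} [NormedField k] [IsUltrametricDist k]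

lemma norm_sub_eq_left {a b : k} (h : ‖b‖ < ‖a‖) : ‖a - b‖ = ‖a‖ := by
  rw [sub_eq_add_neg, IsUltrametricDist.norm_add_eq_max_of_norm_ne_norm (by simpa using h.ne'),
    norm_neg, max_eq_left h.le]

lemma norm_sub_eq_right {a b : k} (h : ‖a‖ < ‖b‖) : ‖a - b‖ = ‖b‖ := by
  rw [← neg_sub, norm_neg, norm_sub_eq_left h]

lemma norm_sub_le_of_le {a b : k} {r : ℝ} (ha : ‖a‖ ≤ r) (hb : ‖b‖ ≤ r) : ‖a - b‖ ≤ r := by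
  rw [sub_eq_add_neg]
  exact (IsUltrametricDist.norm_add_le_max a (-b)).trans (max_le ha (by rwa [norm_neg]))

lemma norm_sub_lt_of_lt {a b : k} {r : ℝ} (ha : ‖a‖ < r) (hb : ‖b‖ < r) : ‖a - b‖ < r := by
  rw [sub_eq_add_neg]
  exact (IsUltrametricDist.norm_add_le_max a (-b)).trans_lt (max_lt ha (by rwa [norm_neg]))

lemma norm_add_lt_of_lt {a b : k} {r : ℝ} (ha : ‖a‖ < r) (hb : ‖b‖ < r) : ‖a + b‖ < r :=
  (IsUltrametricDist.norm_add_le_max a b).trans_lt (max_lt ha hb)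

lemma norm_add_le_of_le {a b : k} {r : ℝ} (ha : ‖a‖ ≤ r) (hb : ‖b‖ ≤ r) : ‖a + b‖ ≤ r :=
  (IsUltrametricDist.norm_add_le_max a b).trans (max_le ha hb)

variable (h2 : ‖(2 : k)‖ < 1) (h2' : (2 : k) ≠ 0) {l : k}

/-- The basin of attraction of the point at infinity. -/
def NearInfty (l : k) (v : k × k) : Prop :=
  v.2 ≠ 0 ∧ ‖v.2‖ < ‖v.1‖ ∧ ‖l‖ * ‖v.2‖ < ‖v.1‖

include h2 h2' in
-- In the basin a dominates both b and λb, so every factor of the duplication forms that involves a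
-- has the norm of the corresponding power of a.
lemma NearInfty.dbl {v : k × k} (h : NearInfty l v) : NearInfty l (dbl l v) ∧
    ‖(dbl l v).1‖ / ‖(dbl l v).2‖ = ‖v.1‖ / ‖v.2‖ / ‖(4 : k)‖ := by
  obtain ⟨a, b⟩ := v
  obtain ⟨hb, h1, hl⟩ := h
  simp only at hb h1 hl
  have hb' : 0 < ‖b‖ := norm_pos_iff.2 hb
  have ha' : 0 < ‖a‖ := hb'.trans h1
  have e1 : ‖a ^ 2 - l * b ^ 2‖ = ‖a‖ ^ 2 := by
    rw [← norm_pow]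
    apply norm_sub_eq_left
    rw [norm_mul, norm_pow, norm_pow]
    nlinarith
  have e2 : ‖a - b‖ = ‖a‖ := norm_sub_eq_left h1
  have e3 : ‖a - l * b‖ = ‖a‖ := norm_sub_eq_left (by rwa [norm_mul])
  have n1 : ‖(SimTorsion.dbl l (a, b)).1‖ = ‖a‖ ^ 4 := by
    simp only [SimTorsion.dbl, norm_pow, e1]; ring
  have n2 : ‖(SimTorsion.dbl l (a, b)).2‖ = ‖(4 : k)‖ * ‖b‖ * ‖a‖ ^ 3 := by
    simp only [SimTorsion.dbl, norm_mul, e2, e3]; ring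
  have h4 := norm_four_lt_one h2
  have h4' := norm_four_pos h2'
  have hlt : ‖(4 : k)‖ * ‖b‖ ≤ ‖b‖ := by nlinarith
  refine ⟨⟨?_, ?_, ?_⟩, ?_⟩
  · rw [← norm_pos_iff, n2]; positivity
  · rw [n1, n2]
    have : ‖(4 : k)‖ * ‖b‖ * ‖a‖ ^ 3 < ‖a‖ * ‖a‖ ^ 3 := by
      apply mul_lt_mul_of_pos_right _ (by positivity); linarith
    linarith [show ‖a‖ ^ 4 = ‖a‖ * ‖a‖ ^ 3 by ring]
  · rw [n1, n2]
    have h5 : ‖l‖ * (‖(4 : k)‖ * ‖b‖) ≤ ‖l‖ * ‖b‖ :=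
      mul_le_mul_of_nonneg_left hlt (norm_nonneg l)
    have : (‖l‖ * (‖(4 : k)‖ * ‖b‖)) * ‖a‖ ^ 3 < ‖a‖ * ‖a‖ ^ 3 := by
      apply mul_lt_mul_of_pos_right _ (by positivity); linarith
    linarith [show ‖a‖ ^ 4 = ‖a‖ * ‖a‖ ^ 3 by ring]
  · rw [n1, n2]
    field_simp

include h2 h2' in
lemma NearInfty.orb {v : k × k} (h : NearInfty l v) (m : ℕ) : NearInfty l (orb l v m) ∧
    ‖(orb l v m).1‖ / ‖(orb l v m).2‖ = ‖v.1‖ / ‖v.2‖ / ‖(4 : k)‖ ^ m := by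
  induction m with
  | zero => simpa using h
  | succ m ih =>
    obtain ⟨i1, i2⟩ := ih
    obtain ⟨j1, j2⟩ := i1.dbl h2 h2'
    rw [orb_succ]
    exact ⟨j1, by rw [j2, i2, pow_succ, div_div]⟩

include h2 h2' in
-- The ratios |x| along the orbit are scaled by distinct powers of |4|, so no two iterates are
-- proportional.
lemma NearInfty.not_prep {v : k × k} (h : NearInfty l v) : ¬ Prep l v := by
  rintro ⟨m, n, hmn, hc⟩
  obtain ⟨⟨hm0, hm1, -⟩, hm⟩ := h.orb h2 h2' m
  obtain ⟨⟨hn0, hn1, -⟩, hn⟩ := h.orb h2 h2' n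
  rw [cross, sub_eq_zero] at hc
  have hc' := congrArg norm hc
  rw [norm_mul, norm_mul] at hc'
  have e : ‖v.1‖ / ‖v.2‖ / ‖(4 : k)‖ ^ m = ‖v.1‖ / ‖v.2‖ / ‖(4 : k)‖ ^ n := by
    rw [← hm, ← hn, div_eq_div_iff (norm_ne_zero_iff.2 hm0) (norm_ne_zero_iff.2 hn0), hc']
  have hv2 : ‖v.2‖ ≠ 0 := norm_ne_zero_iff.2 h.1
  have hv1 : ‖v.1‖ ≠ 0 := ((norm_nonneg _).trans_lt h.2.1).ne'
  have h4 := norm_four_pos h2'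
  rw [div_eq_div_iff (pow_pos h4 m).ne' (pow_pos h4 n).ne'] at e
  exact hmn.ne' (pow_right_injective₀ h4 (norm_four_lt_one h2).ne
    (mul_left_cancel₀ (div_ne_zero hv1 hv2) e))

include h2 h2' in
lemma Prep.norm_le {x : k} (h : Prep l (x, 1)) : ‖x‖ ≤ max 1 ‖l‖ := by
  by_contra! hlt
  rw [max_lt_iff] at hlt
  exact NearInfty.not_prep h2 h2' (v := (x, 1)) ⟨one_ne_zero, by simpa using hlt.1,
    by simpa using hlt.2⟩ h

include h2 h2' in
/-- Preperiodic points other than the points of order two are close to the square roots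
of the parameter. -/
lemma Prep.norm_of_norm_le_one {x : k} (hl : ‖l‖ ≤ 1) (hx0 : x ≠ 0) (hx1 : x ≠ 1) (hxl : x ≠ l)
    (h : Prep l (x, 1)) : ‖x‖ ≤ 1 ∧ ‖x ^ 2 - l‖ < 1 := by
  have hx := h.norm_le h2 h2'
  rw [max_eq_left hl] at hx
  refine ⟨hx, ?_⟩
  -- Otherwise the double has numerator of norm 1 and denominator of norm less than 1, so it lies in
  -- the basin of infinity.
  by_contra! hge
  have hle : ‖x ^ 2 - l‖ ≤ 1 := norm_sub_le_of_le (by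
    rw [norm_pow]; exact pow_le_one₀ (norm_nonneg _) hx) hl
  have h1 : ‖x ^ 2 - l‖ = 1 := le_antisymm hle hge
  have n1 : ‖(SimTorsion.dbl l (x, 1)).1‖ = 1 := by simp [SimTorsion.dbl, h1]
  have n2 : ‖(SimTorsion.dbl l (x, 1)).2‖ < 1 := by
    simp only [SimTorsion.dbl, mul_one, norm_mul]
    have a1 : ‖x - 1‖ ≤ 1 := norm_sub_le_of_le hx (by simp)
    have a2 : ‖x - l‖ ≤ 1 := norm_sub_le_of_le hx hl
    calc ‖(4 : k)‖ * ‖x‖ * ‖x - 1‖ * ‖x - l‖ ≤ ‖(4 : k)‖ * 1 * 1 * 1 := by gcongr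
      _ < 1 := by simpa using norm_four_lt_one h2
  refine NearInfty.not_prep h2 h2' ⟨dbl_snd_ne_zero h2' hx0 hx1 hxl, by rwa [n1], ?_⟩ h.dbl
  rw [n1]
  exact (mul_le_of_le_one_left (norm_nonneg _) hl).trans_lt n2

include h2 h2' in
-- If |x| ≤ 1 or |x| = |λ|, then the double lies in the basin of infinity. As |λ| > 1, the
-- inequality involving λ is the only one to check.
lemma Prep.norm_of_one_lt_norm {x : k} (hl : 1 < ‖l‖) (hx0 : x ≠ 0) (hx1 : x ≠ 1) (hxl : x ≠ l)
    (h : Prep l (x, 1)) : 1 < ‖x‖ ∧ ‖x‖ < ‖l‖ := by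
  have hx := h.norm_le h2 h2'
  rw [max_eq_right hl.le] at hx
  have h4 := norm_four_lt_one h2
  have hne := dbl_snd_ne_zero h2' hx0 hx1 hxl
  have aux : ‖l‖ * ‖(SimTorsion.dbl l (x, 1)).2‖ < ‖(SimTorsion.dbl l (x, 1)).1‖ → False := by
    intro hlt
    refine NearInfty.not_prep h2 h2' ⟨hne, ?_, hlt⟩ h.dbl
    exact (le_mul_of_one_le_left (norm_nonneg _) hl.le).trans_lt hlt
  have hl0 : 0 < ‖l‖ := one_pos.trans hl
  constructor
  · by_contra! hle
    apply aux
    have n1 : ‖x ^ 2 - l‖ = ‖l‖ := norm_sub_eq_right (by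
      rw [norm_pow]; exact (pow_le_one₀ (norm_nonneg _) hle).trans_lt hl)
    have n2 : ‖x - l‖ = ‖l‖ := norm_sub_eq_right (hle.trans_lt hl)
    have n3 : ‖x - 1‖ ≤ 1 := norm_sub_le_of_le hle (by simp)
    simp only [SimTorsion.dbl, mul_one, one_pow, norm_mul, norm_pow, n1, n2]
    calc ‖l‖ * (‖(4 : k)‖ * ‖x‖ * ‖x - 1‖ * ‖l‖) ≤ ‖l‖ * (‖(4 : k)‖ * 1 * 1 * ‖l‖) := by gcongr
      _ = ‖(4 : k)‖ * ‖l‖ ^ 2 := by ring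
      _ < ‖l‖ ^ 2 := by
        have : 0 < ‖l‖ ^ 2 := by positivity
        nlinarith
  · refine lt_of_le_of_ne hx fun heq => aux ?_
    have n1 : ‖x ^ 2 - l‖ = ‖l‖ ^ 2 := by
      rw [← heq, ← norm_pow]
      apply norm_sub_eq_left
      rw [norm_pow, heq]
      nlinarith
    have n2 : ‖x - l‖ ≤ ‖l‖ := norm_sub_le_of_le hx le_rfl
    have n3 : ‖x - 1‖ ≤ ‖l‖ := norm_sub_le_of_le hx (by simpa using hl.le)
    simp only [SimTorsion.dbl, mul_one, one_pow, norm_mul, norm_pow, n1]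
    calc ‖l‖ * (‖(4 : k)‖ * ‖x‖ * ‖x - 1‖ * ‖x - l‖)
        ≤ ‖l‖ * (‖(4 : k)‖ * ‖l‖ * ‖l‖ * ‖l‖) := by gcongr
      _ = ‖(4 : k)‖ * ‖l‖ ^ 4 := by ring
      _ < (‖l‖ ^ 2) ^ 2 := by
        have : 0 < ‖l‖ ^ 4 := by positivity
        nlinarith [show (‖l‖ ^ 2) ^ 2 = ‖l‖ ^ 4 by ring]

/-- The parameter is not one of those for which `x` belongs to a point of order dividing four. -/
def NotFour {K : Type*} [Field K] (l x : K) : Prop :=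
  l ≠ x ∧ l ≠ x ^ 2 ∧ l ≠ x * (2 - x) ∧ (2 * x - 1 ≠ 0 → l ≠ x ^ 2 / (2 * x - 1))

/-- If `x` does not belong to a point of order dividing four, then the double of the point
does not have order dividing two. -/
lemma NotFour.dbl {K : Type*} [Field K] {l x : K} (h : NotFour l x) (hx0 : x ≠ 0)
    (hB : (dbl l (x, 1)).2 ≠ 0) :
    (dbl l (x, 1)).1 / (dbl l (x, 1)).2 ≠ 0 ∧ (dbl l (x, 1)).1 / (dbl l (x, 1)).2 ≠ 1 ∧
      (dbl l (x, 1)).1 / (dbl l (x, 1)).2 ≠ l := by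
  obtain ⟨-, h1, h2, h3⟩ := h
  -- For the double y, the numerators of y, y-1 and y-λ are the squares of x²-λ, x(2-x)-λ and
  -- x²-λ(2x-1). Their vanishing gives the excluded parameters.
  refine ⟨?_, ?_, ?_⟩
  · refine div_ne_zero ?_ hB
    simp only [SimTorsion.dbl, one_pow, mul_one]
    exact pow_ne_zero 2 (sub_ne_zero.2 h1.symm)
  · rw [Ne, div_eq_one_iff_eq hB]
    simp only [SimTorsion.dbl, one_pow, mul_one]
    intro h
    have : (x * (2 - x) - l) ^ 2 = 0 := by linear_combination h
    exact h2 (sub_eq_zero.1 (pow_eq_zero_iff two_ne_zero |>.1 this)).symm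
  · rw [Ne, div_eq_iff hB]
    simp only [SimTorsion.dbl, one_pow, mul_one]
    intro h
    have : (x ^ 2 - l * (2 * x - 1)) ^ 2 = 0 := by linear_combination h
    have h' := sub_eq_zero.1 (pow_eq_zero_iff two_ne_zero |>.1 this)
    have hne : 2 * x - 1 ≠ 0 := by
      intro h0
      rw [h0, mul_zero] at h'
      exact hx0 (pow_eq_zero_iff two_ne_zero |>.1 h')
    exact h3 hne (by rw [h']; field_simp)

include h2 h2' in
/-- Preperiodic points of norm at most one that are not of order dividing four. -/
theorem Prep.exists_of_norm_le_one {x : k} (h : Prep l (x, 1)) (hx : ‖x‖ ≤ 1) (hx0 : x ≠ 0)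
    (hx1 : x ≠ 1) (h4 : NotFour l x) :
    ‖(l - x ^ 2) / (2 * x * (1 - x))‖ ≤ 1 ∧
      ‖((l - x ^ 2) / (2 * x * (1 - x))) ^ 2 - x‖ < 1 := by
  set u := (l - x ^ 2) / (2 * x * (1 - x)) with hu
  have hB := dbl_snd_ne_zero h2' hx0 hx1 h4.1.symm
  obtain ⟨y0, y1, yl⟩ := h4.dbl hx0 hB
  have hy : Prep l ((SimTorsion.dbl l (x, 1)).1 / (SimTorsion.dbl l (x, 1)).2, 1) := h.dbl.div hB
  set y := (SimTorsion.dbl l (x, 1)).1 / (SimTorsion.dbl l (x, 1)).2 with hydef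
  have hl : ‖l‖ ≤ 1 := by
    by_contra! hl
    exact absurd (h.norm_of_one_lt_norm h2 h2' hl hx0 hx1 h4.1.symm).1 hx.not_gt
  have hx' := (h.norm_of_norm_le_one h2 h2' hl hx0 hx1 h4.1.symm).2
  obtain ⟨hy1, hy2⟩ := hy.norm_of_norm_le_one h2 h2' hl y0 y1 yl
  have hx1' : (1 - x) ≠ 0 := sub_ne_zero.2 hx1.symm
  have hlx : x - l ≠ 0 := sub_ne_zero.2 h4.1.symm
  -- This is the duplication formula in the variable u.
  have eu : u ^ 2 = y * (2 * u - 1) := by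
    have e1 : 2 * u - 1 = (l - x) / (x * (1 - x)) := by
      rw [hu]; field_simp; ring
    have hB' : 4 * x * (x - 1) * (x - l) ≠ 0 := by simpa [SimTorsion.dbl] using hB
    have e2 : y = (x ^ 2 - l) ^ 2 / (4 * x * (x - 1) * (x - l)) := by
      rw [hydef]; simp [SimTorsion.dbl]
    rw [e1, e2, hu]
    have h2x : (2 * x * (1 - x)) ≠ 0 := mul_ne_zero (mul_ne_zero h2' hx0) hx1'
    rw [div_pow, div_mul_div_comm, div_eq_div_iff (pow_ne_zero 2 h2x)
      (mul_ne_zero hB' (mul_ne_zero hx0 hx1'))]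
    ring
  -- If |u| > 1, then |u|² = |y||2u-1| ≤ |u|, which is absurd.
  have hu1 : ‖u‖ ≤ 1 := by
    by_contra! hlt
    have b1 : ‖2 * u - 1‖ ≤ ‖u‖ := norm_sub_le_of_le
      (by rw [norm_mul]; exact mul_le_of_le_one_left (norm_nonneg _) h2.le) (by simpa using hlt.le)
    have b2 : ‖u‖ ^ 2 ≤ ‖u‖ := by
      rw [← norm_pow, eu, norm_mul]
      exact (mul_le_of_le_one_left (norm_nonneg _) hy1).trans b1
    nlinarith
  refine ⟨hu1, ?_⟩
  -- Both x and its double y are square roots of λ in the residue field. Square roots are unique in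
  -- characteristic two, so y ≡ x and u² = y(2u-1) ≡ x.
  have c1 : ‖(y - x) * (y - x)‖ < 1 := by
    have : (y - x) * (y - x) = (y ^ 2 - l) - (x ^ 2 - l) - 2 * (x * (y - x)) := by ring
    rw [this]
    refine norm_sub_lt_of_lt (norm_sub_lt_of_lt hy2 hx') ?_
    rw [norm_mul, norm_mul]
    have : ‖y - x‖ ≤ 1 := norm_sub_le_of_le hy1 hx
    calc ‖(2 : k)‖ * (‖x‖ * ‖y - x‖) ≤ ‖(2 : k)‖ * (1 * 1) := by gcongr
      _ < 1 := by simpa using h2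
  have c2 : ‖y - x‖ < 1 := by
    rw [norm_mul] at c1
    by_contra! hge
    nlinarith
  have : u ^ 2 - x = 2 * (u * y - y) + (y - x) := by rw [eu]; ring
  rw [this]
  refine norm_add_lt_of_lt ?_ c2
  rw [norm_mul]
  have : ‖u * y - y‖ ≤ 1 := norm_sub_le_of_le (by
    rw [norm_mul]; exact mul_le_one₀ hu1 (norm_nonneg _) hy1) hy1
  calc ‖(2 : k)‖ * ‖u * y - y‖ ≤ ‖(2 : k)‖ * 1 := by gcongr
    _ < 1 := by simpa using h2

include h2 h2' in
/-- Preperiodic points of norm greater than one that are not of order dividing four. -/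
theorem Prep.exists_of_one_lt_norm {x : k} (h : Prep l (x, 1)) (hx : 1 < ‖x‖) (h0 : l ≠ 0)
    (h4 : NotFour l x) : ‖(x ^ 2 - l) / (2 * l * (x - 1))‖ < 1 := by
  have hx0 : x ≠ 0 := by rintro rfl; simp at hx; linarith
  have hx1 : x ≠ 1 := by rintro rfl; simp at hx
  set u := (x ^ 2 - l) / (2 * l * (x - 1)) with hu
  have hB := dbl_snd_ne_zero h2' hx0 hx1 h4.1.symm
  obtain ⟨y0, y1, yl⟩ := h4.dbl hx0 hB
  have hy : Prep l ((SimTorsion.dbl l (x, 1)).1 / (SimTorsion.dbl l (x, 1)).2, 1) := h.dbl.div hB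
  set y := (SimTorsion.dbl l (x, 1)).1 / (SimTorsion.dbl l (x, 1)).2 with hydef
  have hl : 1 < ‖l‖ := by
    by_contra! hl
    exact absurd (h.norm_of_norm_le_one h2 h2' hl hx0 hx1 h4.1.symm).1 hx.not_ge
  have hy1 := (hy.norm_of_one_lt_norm h2 h2' hl y0 y1 yl).2
  have hx1' : (x - 1) ≠ 0 := sub_ne_zero.2 hx1
  have hlx : x - l ≠ 0 := sub_ne_zero.2 h4.1.symm
  have eu : l * u ^ 2 = y * (2 * u - 1) := by
    have e1 : 2 * u - 1 = x * (x - l) / (l * (x - 1)) := by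
      rw [hu]; field_simp; ring
    have hB' : 4 * x * (x - 1) * (x - l) ≠ 0 := by simpa [SimTorsion.dbl] using hB
    have e2 : y = (x ^ 2 - l) ^ 2 / (4 * x * (x - 1) * (x - l)) := by
      rw [hydef]; simp [SimTorsion.dbl]
    rw [e1, e2, hu]
    have h2x : (2 * l * (x - 1)) ≠ 0 := mul_ne_zero (mul_ne_zero h2' h0) hx1'
    rw [div_pow, div_mul_div_comm, mul_div_assoc', div_eq_div_iff (pow_ne_zero 2 h2x)
      (mul_ne_zero hB' (mul_ne_zero h0 hx1'))]
    ring
  -- If |u| ≥ 1, then |λ||u|² ≤ |y||u| < |λ||u| ≤ |λ||u|².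
  by_contra! hge
  have b1 : ‖2 * u - 1‖ ≤ ‖u‖ := norm_sub_le_of_le
    (by rw [norm_mul]; exact mul_le_of_le_one_left (norm_nonneg _) h2.le) (by simpa using hge)
  have b2 : ‖l‖ * ‖u‖ ^ 2 ≤ ‖y‖ * ‖u‖ := by
    rw [← norm_pow, ← norm_mul, eu, norm_mul]
    gcongr
  have b3 : ‖y‖ * ‖u‖ < ‖l‖ * ‖u‖ := by gcongr
  have b4 : ‖l‖ * ‖u‖ ≤ ‖l‖ * ‖u‖ ^ 2 := by
    have : ‖u‖ ≤ ‖u‖ ^ 2 := by nlinarith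
    gcongr
  linarith

end Norm

end SimTorsion

namespace SimTorsion

open Polynomial

/-! ### The inclusions -/

lemma norm_two_padicAlgCl : ‖(2 : PadicAlgCl 2)‖ = 1 / 2 := by
  have h := PadicAlgCl.valuation_p 2
  have h' := congrArg ((↑) : NNReal → ℝ) h
  rw [PadicAlgCl.valuation_coe] at h'
  simpa using h'

lemma norm_two_lt_one : ‖(2 : PadicAlgCl 2)‖ < 1 := by
  rw [norm_two_padicAlgCl]; norm_num

lemma mem_integers₂ {x : PadicAlgCl 2} : x ∈ integers₂ ↔ ‖x‖ ≤ 1 := by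
  rw [Valuation.mem_valuationSubring_iff, PadicAlgCl.valuation_def, ← NNReal.coe_le_coe]
  rfl

lemma mem_Z {i : Qbar →+* PadicAlgCl 2} {a : Qbar} : a ∈ Z i ↔ ‖i a‖ ≤ 1 := by
  rw [Z, ValuationSubring.mem_comap, mem_integers₂]

lemma residue_eq_iff (x y : integers₂) :
    IsLocalRing.residue integers₂ x = IsLocalRing.residue integers₂ y ↔
      ‖(x : PadicAlgCl 2) - y‖ < 1 := by
  rw [← sub_eq_zero, ← map_sub, IsLocalRing.residue_eq_zero_iff, IsLocalRing.mem_maximalIdeal,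
    mem_nonunits_iff]
  generalize hz : x - y = z
  have hz' : (x : PadicAlgCl 2) - y = z := by rw [← hz]; rfl
  rw [hz']
  have hle : ‖(z : PadicAlgCl 2)‖ ≤ 1 := mem_integers₂.1 z.2
  constructor
  · intro h
    refine lt_of_le_of_ne hle fun h1 => h ?_
    have hz0 : (z : PadicAlgCl 2) ≠ 0 := by
      intro h0; rw [h0, norm_zero] at h1; exact zero_ne_one h1
    refine IsUnit.of_mul_eq_one (⟨(z : PadicAlgCl 2)⁻¹, mem_integers₂.2 (by simp [h1])⟩) ?_
    ext
    simp [hz0]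
  · rintro h hu
    obtain ⟨w, hw⟩ := hu.exists_right_inv
    have hw1 : ‖(w : PadicAlgCl 2)‖ ≤ 1 := mem_integers₂.1 w.2
    have : ‖(z : PadicAlgCl 2)‖ * ‖(w : PadicAlgCl 2)‖ = 1 := by
      have hw' : (z : PadicAlgCl 2) * (w : PadicAlgCl 2) = 1 := congrArg Subtype.val hw
      have := norm_mul (z : PadicAlgCl 2) (w : PadicAlgCl 2)
      rwa [hw', norm_one, eq_comm] at this
    nlinarith [norm_nonneg (z : PadicAlgCl 2), norm_nonneg (w : PadicAlgCl 2)]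

lemma rho_eq_infty_iff {i : Qbar →+* PadicAlgCl 2} {a : Qbar} :
    rho i a = OnePoint.infty ↔ 1 < ‖i a‖ := by
  rw [← not_le, ← mem_integers₂]
  unfold rho
  split_ifs with h
  · simp [h]
  · simp [h]

lemma rho_eq_iff {i : Qbar →+* PadicAlgCl 2} {a b : Qbar} (ha : ‖i a‖ ≤ 1) (hb : ‖i b‖ ≤ 1) :
    rho i a = rho i b ↔ ‖i (a - b)‖ < 1 := by
  unfold rho
  rw [dif_pos (mem_integers₂.2 ha), dif_pos (mem_integers₂.2 hb), OnePoint.coe_eq_coe,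
    residue_eq_iff, map_sub]

lemma rho_zero (i : Qbar →+* PadicAlgCl 2) :
    rho i 0 = ((0 : residueField₂) : OnePoint residueField₂) := by
  have h : i 0 ∈ integers₂ := mem_integers₂.2 (by simp)
  unfold rho
  rw [dif_pos h, OnePoint.coe_eq_coe]
  have : (⟨i 0, h⟩ : integers₂) = 0 := by ext; simp
  rw [this, map_zero]

lemma rho_one (i : Qbar →+* PadicAlgCl 2) :
    rho i 1 = ((1 : residueField₂) : OnePoint residueField₂) := by
  have h : i 1 ∈ integers₂ := mem_integers₂.2 (by simp)
  unfold rho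
  rw [dif_pos h, OnePoint.coe_eq_coe]
  have : (⟨i 1, h⟩ : integers₂) = 1 := by ext; simp
  rw [this, map_one]

lemma rho_eq_zero_iff {i : Qbar →+* PadicAlgCl 2} {a : Qbar} :
    rho i a = ((0 : residueField₂) : OnePoint residueField₂) ↔ ‖i a‖ < 1 := by
  by_cases ha : ‖i a‖ ≤ 1
  · rw [← rho_zero, rho_eq_iff ha (by simp), sub_zero]
  · rw [rho_eq_infty_iff.2 (not_le.1 ha)]
    simp only [OnePoint.infty_ne_coe, false_iff]
    linarith

lemma rho_eq_one_iff {i : Qbar →+* PadicAlgCl 2} {a : Qbar} :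
    rho i a = ((1 : residueField₂) : OnePoint residueField₂) ↔ ‖i (a - 1)‖ < 1 := by
  by_cases ha : ‖i a‖ ≤ 1
  · rw [← rho_one, rho_eq_iff ha (by simp)]
  · rw [rho_eq_infty_iff.2 (not_le.1 ha)]
    simp only [OnePoint.infty_ne_coe, false_iff, not_lt]
    rw [map_sub, map_one, norm_sub_eq_left (by simpa using ha)]
    linarith

lemma mem_T_iff {a l : ℂ} : l ∈ T a ↔ l ≠ 0 ∧ l ≠ 1 ∧ Prep l (a, 1) := by
  constructor
  · rintro ⟨h0, h1, y, h, hfin⟩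
    exact ⟨h0, h1, (isOfFinAddOrder_iff_prep (l := l) two_ne_zero h0 h1
      ⟨1, one_ne_zero, by rw [one_smul]; rfl⟩).1 hfin⟩
  · rintro ⟨h0, h1, h⟩
    obtain ⟨y, hy⟩ := IsAlgClosed.exists_pow_nat_eq (a * (a - 1) * (a - l)) two_pos
    have hns := nonsingular_legendre two_ne_zero h0 h1 hy
    exact ⟨h0, h1, y, hns, (isOfFinAddOrder_iff_prep (l := l) two_ne_zero h0 h1
      (P := .some a y hns) ⟨1, one_ne_zero, by rw [one_smul]; rfl⟩).2 h⟩

/-- Preperiodicity can thus be moved from ℂ to the algebraic numbers and on to the 2-adic side. -/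
lemma prep_one_map_iff {K L : Type*} [Field K] [Field L] (f : K →+* L) {l x : K} :
    Prep (f l) (f x, 1) ↔ Prep l (x, 1) := by
  rw [← prep_map_iff f.injective]
  simp

lemma mem_T_coe_iff {a l : Qbar} :
    (l : ℂ) ∈ T (a : ℂ) ↔ l ≠ 0 ∧ l ≠ 1 ∧ Prep l (a, 1) := by
  rw [mem_T_iff, ← prep_one_map_iff (algebraMap Qbar ℂ)]
  simp [IntermediateField.algebraMap_apply]

lemma exists_not_prep (i : Qbar →+* PadicAlgCl 2) {a : Qbar} (ha0 : a ≠ 0) (ha1 : a ≠ 1) :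
    ∃ l : Qbar, ¬ Prep l (a, 1) := by
  have h2 : (i 2) = 2 := map_ofNat i 2
  have i0 : i a ≠ 0 := by simpa using ha0
  have i1 : i a ≠ 1 := (map_ne_one_iff i i.injective).2 ha1
  -- For a preperiodic point of order greater than two, |a| and |λ| are both at most 1 or both
  -- greater than 1. The witnesses 1/2 and 2 violate this.
  by_cases h : ‖i a‖ ≤ 1
  · have hl : ‖i (1 / 2)‖ = 2 := by
      rw [map_div₀, h2, map_one, norm_div, norm_one, norm_two_padicAlgCl]; norm_num
    refine ⟨1 / 2, fun hp => ?_⟩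
    rw [← prep_one_map_iff i] at hp
    have := hp.norm_of_one_lt_norm norm_two_lt_one two_ne_zero (by rw [hl]; norm_num) i0 i1
      (by intro h'; rw [h', hl] at h; norm_num at h)
    linarith [this.1]
  · have hl : ‖i 2‖ < 1 := by rw [h2]; exact norm_two_lt_one
    refine ⟨2, fun hp => h ?_⟩
    rw [← prep_one_map_iff i] at hp
    exact (hp.norm_of_norm_le_one norm_two_lt_one two_ne_zero hl.le i0 i1
      (by intro h'; rw [h'] at h; exact h hl.le)).1

/-- The elements of `T a` are algebraic if `a` is. -/
lemma exists_coe_eq_of_mem_T (i : Qbar →+* PadicAlgCl 2) {a : Qbar} (ha0 : a ≠ 0) (ha1 : a ≠ 1)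
    {l : ℂ} (hl : l ∈ T (a : ℂ)) : ∃ l' : Qbar, (l' : ℂ) = l := by
  obtain ⟨-, -, m, n, hmn, h⟩ := mem_T_iff.1 hl
  -- The relation between the two iterates, with the parameter as an indeterminate.
  set p : Qbar[X] := cross (orb X (C a, 1) m) (orb X (C a, 1) n) with hp
  have hev : aeval l p = 0 := by
    have := map_cross_orb (aeval l : Qbar[X] →ₐ[Qbar] ℂ).toRingHom X (C a, 1) m n
    simp only [AlgHom.toRingHom_eq_coe, RingHom.coe_coe, aeval_X, Prod.map_apply, aeval_C,
      map_one] at this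
    rw [hp, this]
    exact h
  -- If p vanished, `a` would be preperiodic for every parameter.
  have hp0 : p ≠ 0 := by
    intro hp0
    obtain ⟨l₀, hl₀⟩ := exists_not_prep i ha0 ha1
    refine hl₀ ⟨m, n, hmn, ?_⟩
    have := map_cross_orb (evalRingHom l₀) X (C a, 1) m n
    rw [← hp, hp0, map_zero] at this
    simpa using this.symm
  have halg : IsAlgebraic Qbar l := ⟨p, hp0, hev⟩
  have : Algebra.IsAlgebraic ℚ Qbar := algebraicClosure.isAlgebraic ℚ ℂ
  have halg' : IsAlgebraic ℚ l := halg.restrictScalars ℚ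
  exact ⟨⟨l, (mem_algebraicClosure_iff).2 halg'⟩, rfl⟩

lemma mem_R_of_mem_Z {i : Qbar →+* PadicAlgCl 2} {a l : Qbar} (ha : ‖i a‖ ≤ 1) :
    l ∈ R i a ↔ ∃ u : Qbar, ‖i u‖ ≤ 1 ∧ ‖i (u ^ 2 - a)‖ < 1 ∧
      l = a ^ 2 + 2 * u * a * (1 - a) := by
  rw [R, if_pos (mem_Z.2 ha), Set.mem_ofPred_eq]
  refine exists_congr fun u => ?_
  rw [mem_Z]
  refine and_congr_right fun hu => ?_
  rw [rho_eq_iff (by rw [map_pow, norm_pow]; exact pow_le_one₀ (norm_nonneg _) hu) ha]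

lemma mem_R_of_not_mem_Z {i : Qbar →+* PadicAlgCl 2} {a l : Qbar} (ha : 1 < ‖i a‖) :
    l ∈ R i a ↔ ∃ u : Qbar, ‖i u‖ < 1 ∧
      1 + 2 * (a - 1) * u ≠ 0 ∧ l = a ^ 2 / (1 + 2 * (a - 1) * u) := by
  rw [R, if_neg (by rw [mem_Z]; exact not_le.2 ha), Set.mem_ofPred_eq]
  refine exists_congr fun u => ?_
  rw [mem_Z, rho_eq_zero_iff, ← and_assoc, ← and_assoc, ← and_assoc]
  simp only [and_congr_left_iff]
  exact fun _ _ => ⟨fun h => h.2, fun h => ⟨h.le, h⟩⟩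

/-- Outside `S` the order does not divide four, and the two local theorems apply. The element u is a
rational expression in a and l, so it is itself an algebraic number and the estimates descend along
i. -/
lemma mem_S_or_mem_R (i : Qbar →+* PadicAlgCl 2) {a l : Qbar} (ha0 : a ≠ 0) (ha1 : a ≠ 1)
    (hl0 : l ≠ 0) (h : Prep l (a, 1)) : l ∈ S a ∪ R i a := by
  rw [Set.mem_union, or_iff_not_imp_left]
  intro hS
  have h2 : i 2 = 2 := map_ofNat i 2
  simp only [S, Set.mem_ofPred_eq, not_or, not_and] at hS
  have hN : NotFour (i l) (i a) := by
    obtain ⟨s1, s2, s3, s4⟩ := hS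
    have e : 2 * i a - 1 = i (2 * a - 1) := by simp [h2]
    refine ⟨i.injective.ne s1, ?_, ?_, ?_⟩
    · rw [← map_pow]; exact i.injective.ne s2
    · rw [show i a * (2 - i a) = i (a * (2 - a)) by simp [h2]]; exact i.injective.ne s3
    · rw [e, ← map_pow, ← map_div₀]
      exact fun h => i.injective.ne (s4 fun h' => h (by rw [h', map_zero]))
  rw [← prep_one_map_iff i] at h
  have i0 : i a ≠ 0 := by simpa using ha0
  have i1 : i a ≠ 1 := (map_ne_one_iff i i.injective).2 ha1
  have h1a : (1 - a) ≠ 0 := sub_ne_zero.2 ha1.symm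
  have ha1' : (a - 1) ≠ 0 := sub_ne_zero.2 ha1
  rcases le_or_gt ‖i a‖ 1 with hle | hlt
  · obtain ⟨u1, u2⟩ := h.exists_of_norm_le_one norm_two_lt_one two_ne_zero hle i0 i1 hN
    have e : (i l - i a ^ 2) / (2 * i a * (1 - i a)) = i ((l - a ^ 2) / (2 * a * (1 - a))) := by
      simp [h2]
    rw [e] at u1 u2
    rw [mem_R_of_mem_Z hle]
    refine ⟨_, u1, by rwa [map_sub, map_pow], ?_⟩
    field_simp
    ring
  · have u1 := h.exists_of_one_lt_norm norm_two_lt_one two_ne_zero hlt (by simpa using hl0) hN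
    have e : (i a ^ 2 - i l) / (2 * i l * (i a - 1)) = i ((a ^ 2 - l) / (2 * l * (a - 1))) := by
      simp [h2]
    rw [e] at u1
    rw [mem_R_of_not_mem_Z hlt]
    have e2 : 1 + 2 * (a - 1) * ((a ^ 2 - l) / (2 * l * (a - 1))) = a ^ 2 / l := by
      field_simp
      ring
    refine ⟨_, u1, ?_, ?_⟩
    · rw [e2]; exact div_ne_zero (pow_ne_zero 2 ha0) hl0
    · rw [e2]; field_simp

lemma S_finite (a : Qbar) : (S a).Finite := by
  refine (Set.toFinite {a, a ^ 2, a * (2 - a), a ^ 2 / (2 * a - 1)}).subset ?_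
  rintro l (h | h | h | ⟨-, h⟩) <;> simp [h]

theorem T₂_subset (i : Qbar →+* PadicAlgCl 2) {a b : Qbar} (ha0 : a ≠ 0) (ha1 : a ≠ 1)
    (hb0 : b ≠ 0) (hb1 : b ≠ 1) (h : R i a ∩ R i b = ∅) :
    T₂ (a : ℂ) (b : ℂ) ⊆ ((↑) : Qbar → ℂ) '' ((S a ∩ S b) ∪ (S a ∩ R i b) ∪ (R i a ∩ S b)) := by
  rintro l ⟨hla, hlb⟩
  obtain ⟨l, rfl⟩ := exists_coe_eq_of_mem_T i ha0 ha1 hla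
  obtain ⟨hl0, hl1, pa⟩ := mem_T_coe_iff.1 hla
  obtain ⟨-, -, pb⟩ := mem_T_coe_iff.1 hlb
  refine ⟨l, ?_, rfl⟩
  have ma := mem_S_or_mem_R i ha0 ha1 hl0 pa
  have mb := mem_S_or_mem_R i hb0 hb1 hl0 pb
  have hn : ¬ (l ∈ R i a ∧ l ∈ R i b) := fun hh => by
    have : l ∈ R i a ∩ R i b := hh
    simp [h] at this
  simp only [Set.mem_union, Set.mem_inter_iff] at ma mb ⊢
  tauto

lemma union_subset_S_union_S (i : Qbar →+* PadicAlgCl 2) (a b : Qbar) :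
    (S a ∩ S b) ∪ (S a ∩ R i b) ∪ (R i a ∩ S b) ⊆ S a ∪ S b := by
  rintro l ((h | h) | h)
  exacts [.inl h.1, .inl h.1, .inr h.2]

lemma T₂_finite (i : Qbar →+* PadicAlgCl 2) {a b : Qbar} (ha0 : a ≠ 0) (ha1 : a ≠ 1)
    (hb0 : b ≠ 0) (hb1 : b ≠ 1) (h : R i a ∩ R i b = ∅) : (T₂ (a : ℂ) (b : ℂ)).Finite :=
  ((((S_finite a).union (S_finite b)).subset (union_subset_S_union_S i a b)).image _).subset
    (T₂_subset i ha0 ha1 hb0 hb1 h)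

end SimTorsion

namespace SimTorsion

/-! ### Sufficient conditions for the disjointness -/

/-! ### Ultrametric estimates for a common value of the two parametrizations -/

section Close

variable {k : Type*} [NormedField k] {a b u w : k}

lemma norm_mul_lt_one_of_lt_of_le (ha : ‖a‖ < 1) (hb : ‖b‖ ≤ 1) : ‖a * b‖ < 1 := by
  rw [norm_mul]
  exact (mul_le_of_le_one_right (norm_nonneg _) hb).trans_lt ha

lemma norm_mul_le_one_of_le (ha : ‖a‖ ≤ 1) (hb : ‖b‖ ≤ 1) : ‖a * b‖ ≤ 1 := by
  rw [norm_mul]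
  exact mul_le_one₀ ha (norm_nonneg _) hb

/-- Substitute the hypothesis into (a-b)² = a² - b² - 2b(a-b); a factor 2 comes out. -/
lemma sq_norm_sub_eq (h2 : ‖(2 : k)‖ = 1 / 2)
    (h : a ^ 2 + 2 * u * a * (1 - a) = b ^ 2 + 2 * w * b * (1 - b)) :
    ‖a - b‖ ^ 2 = 1 / 2 * ‖(a - b) * b + u * a * (1 - a) - w * b * (1 - b)‖ := by
  rw [← h2, ← norm_pow, ← norm_mul, ← norm_neg (2 * _)]
  congr 1
  linear_combination h

variable [IsUltrametricDist k]

/-- Frobenius is injective on the residue field. -/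
lemma norm_sub_lt_one_of_sq (h2 : ‖(2 : k)‖ < 1) (ha : ‖a‖ ≤ 1) (hb : ‖b‖ ≤ 1)
    (h : ‖a ^ 2 - b ^ 2‖ < 1) : ‖a - b‖ < 1 := by
  have h1 : ‖(a - b) ^ 2‖ < 1 := by
    rw [show (a - b) ^ 2 = a ^ 2 - b ^ 2 - 2 * (b * (a - b)) by ring]
    refine norm_sub_lt_of_lt h ?_
    rw [norm_mul, norm_mul]
    calc ‖(2 : k)‖ * (‖b‖ * ‖a - b‖) ≤ ‖(2 : k)‖ * (1 * 1) := by
          have := norm_sub_le_of_le ha hb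
          gcongr
      _ < 1 := by simpa using h2
  rw [norm_pow] at h1
  by_contra! hge
  nlinarith

/-- From u² ≡ a ≡ b ≡ w² it follows that u ≡ w, so the bracket in `sq_norm_sub_eq` has norm less
than 1. -/
lemma sq_norm_sub_lt_of_close (h2 : ‖(2 : k)‖ = 1 / 2) (ha : ‖a‖ ≤ 1) (hb : ‖b‖ ≤ 1)
    (hu : ‖u‖ ≤ 1) (hw : ‖w‖ ≤ 1) (hab : ‖a - b‖ < 1) (hua : ‖u ^ 2 - a‖ < 1)
    (hwb : ‖w ^ 2 - b‖ < 1) (h : a ^ 2 + 2 * u * a * (1 - a) = b ^ 2 + 2 * w * b * (1 - b)) :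
    ‖a - b‖ ^ 2 < 1 / 2 := by
  have huw : ‖u - w‖ < 1 := by
    refine norm_sub_lt_one_of_sq (by rw [h2]; norm_num) hu hw ?_
    rw [show u ^ 2 - w ^ 2 = (u ^ 2 - a) + (a - b) - (w ^ 2 - b) by ring]
    exact norm_sub_lt_of_lt (norm_add_lt_of_lt hua hab) hwb
  rw [sq_norm_sub_eq h2 h, show (a - b) * b + u * a * (1 - a) - w * b * (1 - b) =
    (a - b) * b + (u - w) * (a * (1 - a)) + (a - b) * (w * (1 - a - b)) by ring]
  have h1a : ‖1 - a‖ ≤ 1 := norm_sub_le_of_le (by simp) ha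
  have := norm_add_lt_of_lt (norm_add_lt_of_lt (norm_mul_lt_one_of_lt_of_le hab hb)
    (norm_mul_lt_one_of_lt_of_le huw (norm_mul_le_one_of_le ha h1a)))
    (norm_mul_lt_one_of_lt_of_le hab (norm_mul_le_one_of_le hw (norm_sub_le_of_le h1a hb)))
  linarith

/-- All of a, b, u, w reduce to 1. With r = |a-1|, each term of the bracket in `sq_norm_sub_eq` is a
factor of norm at most r times a factor of norm less than 1, whence r² < r/2. -/
lemma norm_lt_half_of_near_one (h2 : ‖(2 : k)‖ = 1 / 2) (ha : ‖a‖ ≤ 1) (hb : ‖b‖ ≤ 1)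
    (hu : ‖u‖ ≤ 1) (hw : ‖w‖ ≤ 1) (ha1 : ‖a - 1‖ < 1) (hb1 : ‖b - 1‖ < 1)
    (hua : ‖u ^ 2 - a‖ < 1) (hwb : ‖w ^ 2 - b‖ < 1) (hab : ‖a - b‖ = ‖a - 1‖) (ha0 : a ≠ 1)
    (h : a ^ 2 + 2 * u * a * (1 - a) = b ^ 2 + 2 * w * b * (1 - b)) : ‖a - 1‖ < 1 / 2 := by
  have hr : 0 < ‖a - 1‖ := norm_pos_iff.2 (sub_ne_zero.2 ha0)
  have h2' : ‖(2 : k)‖ < 1 := by rw [h2]; norm_num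
  have hu1 : ‖u - 1‖ < 1 := by
    refine norm_sub_lt_one_of_sq h2' hu (by simp) ?_
    rw [show u ^ 2 - 1 ^ 2 = (u ^ 2 - a) + (a - 1) by ring]
    exact norm_add_lt_of_lt hua ha1
  have hw1 : ‖w - 1‖ < 1 := by
    refine norm_sub_lt_one_of_sq h2' hw (by simp) ?_
    rw [show w ^ 2 - 1 ^ 2 = (w ^ 2 - b) + (b - 1) by ring]
    exact norm_add_lt_of_lt hwb hb1
  have e := sq_norm_sub_eq h2 h
  rw [show (a - b) * b + u * a * (1 - a) - w * b * (1 - b) =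
    (a - b) * ((1 - w) * b) - (a - 1) * ((1 - w * b) - (1 - u * a)) by ring, hab] at e
  have t1 : ‖(w - 1) * b‖ < 1 := norm_mul_lt_one_of_lt_of_le hw1 hb
  have t2 : ‖1 - u * a‖ < 1 := by
    rw [show 1 - u * a = -((u - 1) * a) - (a - 1) by ring]
    exact norm_sub_lt_of_lt (by rw [norm_neg]; exact norm_mul_lt_one_of_lt_of_le hu1 ha) ha1
  have t3 : ‖1 - w * b‖ < 1 := by
    rw [show 1 - w * b = -((w - 1) * b) - (b - 1) by ring]
    exact norm_sub_lt_of_lt (by rwa [norm_neg]) hb1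
  have t4 : ‖(1 - w) * b‖ < 1 := by
    rw [show (1 - w) * b = -((w - 1) * b) by ring, norm_neg]
    exact t1
  have scale : ∀ {x y : k}, ‖x‖ ≤ ‖a - 1‖ → ‖y‖ < 1 → ‖x * y‖ < ‖a - 1‖ := by
    intro x y hx hy
    rw [norm_mul]
    calc ‖x‖ * ‖y‖ ≤ ‖a - 1‖ * ‖y‖ := by gcongr
      _ < ‖a - 1‖ * 1 := by gcongr
      _ = ‖a - 1‖ := mul_one _
  have hlt := norm_sub_lt_of_lt (scale hab.le t4) (scale le_rfl (norm_sub_lt_of_lt t3 t2))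
  nlinarith

/-- The same argument with r = |a|, using |b| ≤ |a|. It also serves at infinity, after inversion. -/
lemma norm_lt_half_of_near_zero (h2 : ‖(2 : k)‖ = 1 / 2) (ha0 : a ≠ 0) (ha : ‖a‖ < 1)
    (hu : ‖u‖ < 1) (hw : ‖w‖ < 1) (hab : ‖a - b‖ = ‖a‖)
    (h : a ^ 2 + 2 * u * a * (1 - a) = b ^ 2 + 2 * w * b * (1 - b)) : ‖a‖ < 1 / 2 := by
  have hr : 0 < ‖a‖ := norm_pos_iff.2 ha0
  have hb : ‖b‖ ≤ ‖a‖ := by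
    rw [show b = a - (a - b) by ring]
    exact norm_sub_le_of_le le_rfl hab.le
  have scale : ∀ {x y : k}, ‖x‖ ≤ ‖a‖ → ‖y‖ < 1 → ‖x * y‖ < ‖a‖ := by
    intro x y hx hy
    rw [norm_mul]
    calc ‖x‖ * ‖y‖ ≤ ‖a‖ * ‖y‖ := by gcongr
      _ < ‖a‖ * 1 := by gcongr
      _ = ‖a‖ := mul_one _
  have e := sq_norm_sub_eq h2 h
  rw [hab, show (a - b) * b + u * a * (1 - a) - w * b * (1 - b) =
    (a - b) * b + a * (u * (1 - a)) - b * (w * (1 - b)) by ring] at e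
  have hlt := norm_sub_lt_of_lt (norm_add_lt_of_lt (scale hab.le (hb.trans_lt ha))
    (scale le_rfl (norm_mul_lt_one_of_lt_of_le hu (norm_sub_le_of_le (a := 1) (by simp) ha.le))))
    (scale hb (norm_mul_lt_one_of_lt_of_le hw
      (norm_sub_le_of_le (a := 1) (by simp) (hb.trans ha.le))))
  nlinarith

end Close

/-! ### Translation between the valuation and the norm -/

section Valuation

variable {i : Qbar →+* PadicAlgCl 2} {a b : Qbar}

lemma v_of_ne_zero (ha : a ≠ 0) : v i a = ((-Real.logb 2 ‖i a‖ : ℝ) : WithTop ℝ) := by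
  rw [v, if_neg ha]

lemma norm_pos_of_ne_zero (ha : a ≠ 0) : 0 < ‖i a‖ := norm_pos_iff.2 (by simpa using ha)

lemma ne_zero_of_v_le {r : ℝ} (h : v i a ≤ (r : WithTop ℝ)) : a ≠ 0 := by
  rintro rfl
  simp [v] at h

lemma le_norm_of_v_le {r : ℝ} (h : v i a ≤ (r : WithTop ℝ)) : (2 : ℝ) ^ (-r) ≤ ‖i a‖ := by
  have ha := ne_zero_of_v_le h
  rw [v_of_ne_zero ha, WithTop.coe_le_coe, neg_le] at h
  exact (Real.le_logb_iff_rpow_le one_lt_two (norm_pos_of_ne_zero ha)).1 h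

lemma norm_le_of_le_v {r : ℝ} (h : (r : WithTop ℝ) ≤ v i a) : ‖i a‖ ≤ (2 : ℝ) ^ (-r) := by
  by_cases ha : a = 0
  · rw [ha, map_zero, norm_zero]; positivity
  · rw [v_of_ne_zero ha, WithTop.coe_le_coe, le_neg] at h
    exact (Real.logb_le_iff_le_rpow one_lt_two (norm_pos_of_ne_zero ha)).1 h

lemma norm_eq_of_v_eq (h : v i a = v i b) : ‖i a‖ = ‖i b‖ := by
  by_cases ha : a = 0
  · by_cases hb : b = 0
    · rw [ha, hb]
    · rw [v_of_ne_zero hb, v, if_pos ha] at h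
      exact absurd h WithTop.top_ne_coe
  · by_cases hb : b = 0
    · rw [v_of_ne_zero ha, v, if_pos hb] at h
      exact absurd h (by simp)
    · rw [v_of_ne_zero ha, v_of_ne_zero hb, WithTop.coe_inj, neg_inj] at h
      exact Real.logb_injOn_pos one_lt_two (norm_pos_of_ne_zero ha) (norm_pos_of_ne_zero hb) h

end Valuation

/-! ### Disjointness in the five situations -/

section Disjoint

variable {i : Qbar →+* PadicAlgCl 2} {a b : Qbar}

/-- In the integral case the correction term is divisible by 2. In the other case the denominator
has norm at most |a|, so the quotient stays non-integral. -/
lemma rho_eq_rho_sq_of_mem_R {l : Qbar} (h : l ∈ R i a) : rho i l = rho i (a ^ 2) := by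
  have h2 : i 2 = 2 := map_ofNat i 2
  rcases le_or_gt ‖i a‖ 1 with ha | ha
  · obtain ⟨u, hu, -, rfl⟩ := (mem_R_of_mem_Z ha).1 h
    have hsq : ‖i (a ^ 2)‖ ≤ 1 := by
      rw [map_pow, norm_pow]; exact pow_le_one₀ (norm_nonneg _) ha
    have e : ‖i (a ^ 2 + 2 * u * a * (1 - a) - a ^ 2)‖ < 1 := by
      rw [show i (a ^ 2 + 2 * u * a * (1 - a) - a ^ 2) = 2 * (i u * i a * (1 - i a)) by
        rw [show a ^ 2 + 2 * u * a * (1 - a) - a ^ 2 = 2 * (u * a * (1 - a)) by ring]; simp [h2]]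
      exact norm_mul_lt_one_of_lt_of_le norm_two_lt_one (norm_mul_le_one_of_le
        (norm_mul_le_one_of_le hu ha) (norm_sub_le_of_le (by simp) ha))
    rw [rho_eq_iff ?_ hsq]
    · exact e
    · rw [show a ^ 2 + 2 * u * a * (1 - a) = (a ^ 2 + 2 * u * a * (1 - a) - a ^ 2) + a ^ 2 by ring,
        map_add]
      exact norm_add_le_of_le e.le hsq
  · obtain ⟨u, hu, hne, rfl⟩ := (mem_R_of_not_mem_Z ha).1 h
    rw [rho_eq_infty_iff.2, rho_eq_infty_iff.2]
    · rw [map_pow, norm_pow]; exact one_lt_pow₀ ha two_ne_zero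
    · have hd : ‖i (1 + 2 * (a - 1) * u)‖ ≤ ‖i a‖ := by
        rw [show i (1 + 2 * (a - 1) * u) = 1 + 2 * (i a - 1) * i u by simp [h2]]
        refine norm_add_le_of_le (by simpa using ha.le) ?_
        rw [norm_mul, norm_mul, norm_two_padicAlgCl]
        have : ‖i a - 1‖ ≤ ‖i a‖ := norm_sub_le_of_le le_rfl (by simpa using ha.le)
        calc 1 / 2 * ‖i a - 1‖ * ‖i u‖ ≤ 1 * ‖i a‖ * 1 := by gcongr; norm_num
          _ = ‖i a‖ := by ring
      have hd0 : 0 < ‖i (1 + 2 * (a - 1) * u)‖ := norm_pos_of_ne_zero hne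
      rw [map_div₀, norm_div, map_pow, norm_pow, one_lt_div hd0]
      nlinarith

/-- A common element would give a² and b² the same reduction, and squaring is injective on
reductions. -/
lemma disjoint_of_rho_ne (h : rho i a ≠ rho i b) : R i a ∩ R i b = ∅ := by
  refine Set.eq_empty_of_forall_notMem ?_
  rintro l ⟨hla, hlb⟩
  have e := (rho_eq_rho_sq_of_mem_R hla).symm.trans (rho_eq_rho_sq_of_mem_R hlb)
  have aux : ∀ c : Qbar, ‖i (c ^ 2)‖ ≤ 1 ↔ ‖i c‖ ≤ 1 := fun c => by
    rw [map_pow, norm_pow, pow_le_one_iff_of_nonneg (norm_nonneg _) two_ne_zero]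
  have aux' : ∀ c : Qbar, rho i (c ^ 2) = OnePoint.infty ↔ rho i c = OnePoint.infty := fun c => by
    rw [rho_eq_infty_iff, rho_eq_infty_iff, ← not_le, aux, not_le]
  by_cases ha : ‖i a‖ ≤ 1
  · by_cases hb : ‖i b‖ ≤ 1
    · rw [rho_eq_iff ((aux a).2 ha) ((aux b).2 hb)] at e
      rw [Ne, rho_eq_iff ha hb] at h
      rw [map_sub, map_pow, map_pow] at e
      exact h (by rw [map_sub]; exact norm_sub_lt_one_of_sq norm_two_lt_one ha hb e)
    · have hb' := (aux' b).2 (rho_eq_infty_iff.2 (not_le.1 hb))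
      rw [hb', aux', rho_eq_infty_iff] at e
      linarith
  · have ha' := rho_eq_infty_iff.2 (not_le.1 ha)
    rw [(aux' a).2 ha', eq_comm, aux'] at e
    exact h (ha'.trans e.symm)

lemma disjoint_of_forall (ha : ‖i a‖ ≤ 1) (hb : ‖i b‖ ≤ 1)
    (h : ∀ u w : PadicAlgCl 2, ‖u‖ ≤ 1 → ‖w‖ ≤ 1 → ‖u ^ 2 - i a‖ < 1 → ‖w ^ 2 - i b‖ < 1 →
      i a ^ 2 + 2 * u * i a * (1 - i a) ≠ i b ^ 2 + 2 * w * i b * (1 - i b)) :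
    R i a ∩ R i b = ∅ := by
  have h2 : i 2 = 2 := map_ofNat i 2
  refine Set.eq_empty_of_forall_notMem ?_
  rintro l ⟨hla, hlb⟩
  obtain ⟨u, hu, hua, rfl⟩ := (mem_R_of_mem_Z ha).1 hla
  obtain ⟨w, hw, hwb, e⟩ := (mem_R_of_mem_Z hb).1 hlb
  refine h (i u) (i w) hu hw (by simpa using hua) (by simpa using hwb) ?_
  simpa [h2] using congrArg i e

lemma disjoint_of_v_le_half (h : rho i a = rho i b)
    (hinf : rho i a ≠ OnePoint.infty) (hv : v i (a - b) ≤ ((1 / 2 : ℝ) : WithTop ℝ)) :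
    R i a ∩ R i b = ∅ := by
  have ha : ‖i a‖ ≤ 1 := by rwa [Ne, rho_eq_infty_iff, not_lt] at hinf
  have hb : ‖i b‖ ≤ 1 := by rwa [h, Ne, rho_eq_infty_iff, not_lt] at hinf
  have hab := (rho_eq_iff ha hb).1 h
  refine disjoint_of_forall ha hb fun u w hu hw hua hwb e => ?_
  rw [map_sub] at hab
  have := sq_norm_sub_lt_of_close norm_two_padicAlgCl ha hb hu hw hab hua hwb e
  have h1 := le_norm_of_v_le hv
  rw [map_sub] at h1
  have h2 : ((2 : ℝ) ^ (-(1 / 2 : ℝ))) ^ 2 = 1 / 2 := by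
    rw [← Real.rpow_natCast, ← Real.rpow_mul (by norm_num)]
    norm_num
  have h3 : ((2 : ℝ) ^ (-(1 / 2 : ℝ))) ^ 2 ≤ ‖i a - i b‖ ^ 2 := by gcongr
  linarith

lemma half_le_norm_of_v_le_one (h : v i a ≤ 1) : 1 / 2 ≤ ‖i a‖ := by
  have := le_norm_of_v_le (r := 1) (by simpa using h)
  rwa [Real.rpow_neg (by norm_num), Real.rpow_one, ← one_div] at this

lemma disjoint_of_rho_eq_one (ha : rho i a = ((1 : residueField₂) : OnePoint residueField₂))
    (hb : rho i b = ((1 : residueField₂) : OnePoint residueField₂)) (hv : v i (a - 1) ≤ 1)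
    (hab : v i (a - b) = v i (a - 1)) : R i a ∩ R i b = ∅ := by
  have ha1 := rho_eq_one_iff.1 ha
  have hb1 := rho_eq_one_iff.1 hb
  have ha' : ‖i a‖ ≤ 1 := by
    rw [← not_lt, ← rho_eq_infty_iff, ha]; simp
  have hb' : ‖i b‖ ≤ 1 := by
    rw [← not_lt, ← rho_eq_infty_iff, hb]; simp
  have hne : a - 1 ≠ 0 := ne_zero_of_v_le (r := 1) (by simpa using hv)
  have hn := norm_eq_of_v_eq hab
  have hhalf := half_le_norm_of_v_le_one hv
  rw [map_sub, map_one] at ha1 hb1 hhalf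
  rw [map_sub, map_sub, map_one] at hn
  refine disjoint_of_forall ha' hb' fun u w hu hw hua hwb e => hhalf.not_gt ?_
  exact norm_lt_half_of_near_one norm_two_padicAlgCl ha' hb' hu hw ha1 hb1 hua hwb hn
    ((map_ne_one_iff i i.injective).2 (sub_ne_zero.1 hne)) e

lemma norm_lt_one_of_sq_sub {x y : PadicAlgCl 2} (hy : ‖y‖ < 1) (h : ‖x ^ 2 - y‖ < 1) :
    ‖x‖ < 1 := by
  have := norm_add_lt_of_lt h hy
  rw [sub_add_cancel, norm_pow] at this
  by_contra! hge
  nlinarith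

lemma disjoint_of_rho_eq_zero (ha : rho i a = ((0 : residueField₂) : OnePoint residueField₂))
    (hb : rho i b = ((0 : residueField₂) : OnePoint residueField₂)) (hv : v i a ≤ 1)
    (hab : v i (a - b) = v i a) : R i a ∩ R i b = ∅ := by
  have ha0 := rho_eq_zero_iff.1 ha
  have hb0 := rho_eq_zero_iff.1 hb
  have hne : a ≠ 0 := ne_zero_of_v_le (r := 1) (by simpa using hv)
  have hn := norm_eq_of_v_eq hab
  rw [map_sub] at hn
  refine disjoint_of_forall ha0.le hb0.le fun u w hu hw hua hwb e =>
    (half_le_norm_of_v_le_one hv).not_gt ?_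
  exact norm_lt_half_of_near_zero norm_two_padicAlgCl (by simpa using hne) ha0
    (norm_lt_one_of_sq_sub ha0 hua) (norm_lt_one_of_sq_sub hb0 hwb) hn e

/-- Inversion turns a²/(1+2(a-1)u) into the integral expression for 1/a with the same u, so the
estimate near zero applies to 1/a and 1/b and gives |a| > 2. -/
lemma disjoint_of_rho_eq_infty (ha : rho i a = OnePoint.infty) (hb : rho i b = OnePoint.infty)
    (hv : ((-1 : ℝ) : WithTop ℝ) ≤ v i a) (hab : v i (a - b) = v i b) : R i a ∩ R i b = ∅ := by
  have h2 : i 2 = 2 := map_ofNat i 2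
  have ha1 := rho_eq_infty_iff.1 ha
  have hb1 := rho_eq_infty_iff.1 hb
  have hn := norm_eq_of_v_eq hab
  have hle := norm_le_of_le_v hv
  rw [neg_neg, Real.rpow_one] at hle
  rw [map_sub] at hn
  have ha0 : a ≠ 0 := by rintro rfl; simp at ha1; linarith
  have hb0 : b ≠ 0 := by rintro rfl; simp at hb1; linarith
  have ia0 : i a ≠ 0 := by simpa using ha0
  have ib0 : i b ≠ 0 := by simpa using hb0
  refine Set.eq_empty_of_forall_notMem ?_
  rintro l ⟨hla, hlb⟩
  obtain ⟨u, hu, hua, rfl⟩ := (mem_R_of_not_mem_Z ha1).1 hla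
  obtain ⟨w, hw, hwb, e⟩ := (mem_R_of_not_mem_Z hb1).1 hlb
  have e' : (a⁻¹) ^ 2 + 2 * u * a⁻¹ * (1 - a⁻¹) = (b⁻¹) ^ 2 + 2 * w * b⁻¹ * (1 - b⁻¹) := by
    have key : ∀ c t : Qbar, c ≠ 0 → (c⁻¹) ^ 2 + 2 * t * c⁻¹ * (1 - c⁻¹) =
        (c ^ 2 / (1 + 2 * (c - 1) * t))⁻¹ := by
      intro c t hc
      rw [inv_div]
      field_simp
    rw [key a u ha0, key b w hb0, e]
  have e'' : (i a)⁻¹ ^ 2 + 2 * i u * (i a)⁻¹ * (1 - (i a)⁻¹) =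
      (i b)⁻¹ ^ 2 + 2 * i w * (i b)⁻¹ * (1 - (i b)⁻¹) := by
    simpa [h2] using congrArg i e'
  have hdiff : ‖(i a)⁻¹ - (i b)⁻¹‖ = ‖(i a)⁻¹‖ := by
    rw [inv_sub_inv ia0 ib0, norm_div, norm_mul, norm_sub_rev, hn, norm_inv]
    have := norm_pos_of_ne_zero (i := i) hb0
    have := norm_pos_of_ne_zero (i := i) ha0
    field_simp
  have := norm_lt_half_of_near_zero norm_two_padicAlgCl (inv_ne_zero ia0)
    (by rw [norm_inv]; exact inv_lt_one_of_one_lt₀ ha1) hu hw hdiff e''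
  rw [norm_inv, ← one_div, one_div_lt_one_div (by linarith) (by norm_num)] at this
  linarith

end Disjoint

end SimTorsion

namespace SimTorsion

open Filter Topology

/-! ### A criterion for torsion -/

section Criterion

variable {k : Type*} [NormedField k] [IsUltrametricDist k] {l x : k}

lemma norm_le_of_isOfFinAddOrder [DecidableEq k] (h2 : ‖(2 : k)‖ < 1) (h2' : (2 : k) ≠ 0)
    (h0 : l ≠ 0) (h1 : l ≠ 1) {x y : k} {h : (legendreCurve l).Nonsingular x y}
    (hP : IsOfFinAddOrder (WeierstrassCurve.Affine.Point.some x y h)) : ‖x‖ ≤ max 1 ‖l‖ :=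
  ((isOfFinAddOrder_iff_prep (v := (x, 1)) h2' h0 h1
    ⟨1, one_ne_zero, by rw [one_smul]; rfl⟩).1 hP).norm_le h2 h2'

/-- For two multiples of a torsion point, the form `pairNum` is bounded in terms of `cross`. -/
theorem Prep.norm_pairNum_le [IsAlgClosed k] (h2 : ‖(2 : k)‖ < 1) (h2' : (2 : k) ≠ 0)
    (h0 : l ≠ 0) (h1 : l ≠ 1) (h : Prep l (x, 1)) {m n : ℕ}
    (hc : cross (orb l (x, 1) m) (orb l (x, 1) n) ≠ 0) :
    ‖pairNum l (orb l (x, 1) m) (orb l (x, 1) n)‖ ≤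
      max 1 ‖l‖ * ‖cross (orb l (x, 1) m) (orb l (x, 1) n)‖ := by
  classical
  obtain ⟨y, hy⟩ := IsAlgClosed.exists_pow_nat_eq (x * (x - 1) * (x - l)) two_pos
  have hns := nonsingular_legendre h2' h0 h1 hy
  set P : (legendreCurve l).Point := .some x y hns with hP
  have hrep : IsXRep P (x, 1) := ⟨1, one_ne_zero, by rw [one_smul]; rfl⟩
  have htors : IsOfFinAddOrder P := (isOfFinAddOrder_iff_prep h2' h0 h1 hrep).2 h
  obtain ⟨c, hc0, ec⟩ := hrep.orb h2' h0 h1 m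
  obtain ⟨d, hd0, ed⟩ := hrep.orb h2' h0 h1 n
  have tV : IsOfFinAddOrder (2 ^ m • P) := htors.nsmul
  have tW : IsOfFinAddOrder (2 ^ n • P) := htors.nsmul
  rw [ec, ed, cross_smul_smul] at hc ⊢
  rw [pairNum_smul_smul, norm_mul, norm_mul _ (cross _ _), mul_left_comm]
  refine mul_le_mul_of_nonneg_left ?_ (norm_nonneg _)
  have hc' := right_ne_zero_of_mul hc
  generalize 2 ^ m • P = V at tV hc' ⊢
  generalize 2 ^ n • P = W at tW hc' ⊢
  -- If exactly one of the points is at infinity, `pairNum`/`cross` is up to sign the x-coordinate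
  -- of the other one.
  cases V with
  | zero =>
    cases W with
    | zero => simp [cross, xpt] at hc'
    | some x' y' h' =>
      simpa [pairNum, cross, xpt] using norm_le_of_isOfFinAddOrder h2 h2' h0 h1 tW
  | some x₁ y₁ hx₁ =>
    cases W with
    | zero => simpa [pairNum, cross, xpt] using norm_le_of_isOfFinAddOrder h2 h2' h0 h1 tV
    | some x' y' h' =>
      have hne : x₁ ≠ x' := by
        rintro rfl
        simp [cross, xpt] at hc'
      obtain ⟨x₃, y₃, x₄, y₄, h₃, h₄, e₃, e₄, e⟩ := exists_add_sub hx₁ h' hne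
      have b₃ := norm_le_of_isOfFinAddOrder h2 h2' h0 h1 (e₃ ▸ tV.add tW)
      have b₄ : ‖x₄‖ ≤ max 1 ‖l‖ := by
        refine norm_le_of_isOfFinAddOrder h2 h2' h0 h1 (h := h₄) ?_
        rw [← e₄, sub_eq_add_neg]
        exact tV.add tW.neg
      simp only [pairNum, cross, xpt, mul_one]
      have hM : 0 ≤ max 1 ‖l‖ := le_max_of_le_left zero_le_one
      -- The square of the quotient is the product of the x-coordinates of V + W and V - W, and both
      -- of these points are torsion.
      refine (sq_le_sq₀ (norm_nonneg _) (mul_nonneg hM (norm_nonneg _))).1 ?_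
      rw [mul_pow, ← norm_pow, ← norm_pow, ← e, norm_mul, norm_mul, sq (max 1 ‖l‖)]
      gcongr

include l x in
/-- For a point of infinite order, `pairNum` is not bounded in terms of `cross`. -/
theorem exists_lt_norm_pairNum (h2 : ‖(2 : k)‖ < 1) (h2' : (2 : k) ≠ 0) (h0 : l ≠ 0) (h1 : l ≠ 1)
    (E : Subfield k) (hE : ∀ M : ℝ, IsCompact {z : k | z ∈ E ∧ ‖z‖ ≤ M}) (hl : l ∈ E) (hx : x ∈ E)
    (h : ¬ Prep l (x, 1)) (C : ℝ) : ∃ m n, cross (orb l (x, 1) m) (orb l (x, 1) n) ≠ 0 ∧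
      C * ‖cross (orb l (x, 1) m) (orb l (x, 1) n)‖ <
        ‖pairNum l (orb l (x, 1) m) (orb l (x, 1) n)‖ := by
  by_contra! hcon
  have hB : ∀ m, (orb l (x, 1) m).2 ≠ 0 := fun m hm => h (prep_of_orb_snd_eq_zero hm)
  set X : ℕ → k := fun m => (orb l (x, 1) m).1 / (orb l (x, 1) m).2 with hX
  have horb : ∀ m, orb l (x, 1) m = (orb l (x, 1) m).2 • (X m, 1) := by
    intro m
    ext
    · simp [hX, mul_div_cancel₀ _ (hB m)]
    · simp
  -- The assumed bound in affine coordinates; `cross` is nonzero because no two iterates agree.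
  have hbound : ∀ m n, m ≠ n → ‖X m * X n - l‖ ≤ C * ‖X m - X n‖ := by
    intro m n hmn
    have hne : cross (orb l (x, 1) m) (orb l (x, 1) n) ≠ 0 := by
      intro h0
      rcases lt_or_gt_of_ne hmn with hlt | hlt
      · exact h ⟨m, n, hlt, h0⟩
      · exact h ⟨n, m, hlt, by rw [cross_comm, h0, neg_zero]⟩
    have := hcon m n hne
    rw [horb m, horb n, pairNum_smul_smul, cross_smul_smul, norm_mul, norm_mul _ (cross _ _),
      mul_left_comm] at this
    have hpos : 0 < ‖(orb l (x, 1) m).2 * (orb l (x, 1) n).2‖ :=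
      norm_pos_iff.2 (mul_ne_zero (hB m) (hB n))
    simpa [pairNum, cross] using le_of_mul_le_mul_left this hpos
  have hrec : ∀ m, X (m + 1) * (4 * X m * (X m - 1) * (X m - l)) = (X m ^ 2 - l) ^ 2 := by
    intro m
    have e1 : X (m + 1) * (orb l (x, 1) (m + 1)).2 = (orb l (x, 1) (m + 1)).1 :=
      div_mul_cancel₀ _ (hB (m + 1))
    rw [orb_succ, horb m, dbl_smul] at e1
    simp only [dbl, Prod.smul_mk, smul_eq_mul, mul_one, one_pow] at e1
    refine mul_left_cancel₀ (pow_ne_zero 4 (hB m)) ?_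
    linear_combination e1
  have hmem : ∀ m, X m ∈ E := by
    intro m
    have : (orb l (x, 1) m).1 ∈ E ∧ (orb l (x, 1) m).2 ∈ E := by
      induction m with
      | zero => exact ⟨hx, E.one_mem⟩
      | succ m ih =>
        rw [orb_succ]
        obtain ⟨i1, i2⟩ := ih
        have h4 : (4 : k) ∈ E := ofNat_mem E 4
        exact ⟨pow_mem (sub_mem (pow_mem i1 2) (mul_mem hl (pow_mem i2 2))) 2,
          mul_mem (mul_mem (mul_mem (mul_mem h4 i1) i2) (sub_mem i1 i2))
            (sub_mem i1 (mul_mem hl i2))⟩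
    exact div_mem this.1 this.2
  -- An iterate outside this disc would lie in the basin of infinity. For consecutive terms far out,
  -- the assumed bound reads |X||X'| ≤ C|X'|, although |X| exceeds C.
  have hle : ∀ m, ‖X m‖ ≤ max 1 ‖l‖ := by
    intro m
    by_contra! hlt
    have hnear : NearInfty l (orb l (x, 1) m) := by
      rw [max_lt_iff] at hlt
      have hpos := norm_pos_iff.2 (hB m)
      simp only [hX, norm_div, lt_div_iff₀ hpos, one_mul] at hlt
      exact ⟨hB m, hlt.1, hlt.2⟩
    have hgrow : ∀ j, ‖X (m + j)‖ = ‖X m‖ / ‖(4 : k)‖ ^ j := by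
      intro j
      have := (hnear.orb h2 h2' j).2
      have e : orb l (orb l (x, 1) m) j = orb l (x, 1) (m + j) := by
        rw [orb, orb, orb, ← Function.iterate_add_apply, add_comm]
      rw [e] at this
      simpa [hX, norm_div] using this
    have h4 := norm_four_pos h2'
    have h4' := norm_four_lt_one h2
    rw [max_lt_iff] at hlt
    obtain ⟨j, hj⟩ := pow_unbounded_of_one_lt C (one_lt_inv_iff₀.2 ⟨h4, h4'⟩)
    have hj1 : C < ‖X (m + j)‖ := by
      rw [hgrow, div_eq_mul_inv, ← inv_pow]
      have : 0 < (‖(4 : k)‖⁻¹) ^ j := by positivity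
      nlinarith
    have hXj : ‖X m‖ ≤ ‖X (m + j)‖ := by
      rw [hgrow, le_div_iff₀ (pow_pos h4 j)]
      exact mul_le_of_le_one_right (norm_nonneg _) (pow_le_one₀ h4.le h4'.le)
    have hXs : ‖X (m + j)‖ < ‖X (m + j + 1)‖ := by
      rw [add_assoc, hgrow, hgrow, pow_succ, ← div_div,
        lt_div_iff₀ h4]
      refine mul_lt_of_lt_one_right ?_ h4'
      rw [← hgrow]; linarith
    have hb := hbound (m + j) (m + j + 1) (by omega)
    rw [norm_sub_eq_right hXs, norm_sub_eq_left, norm_mul] at hb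
    · exact hj1.not_ge (le_of_mul_le_mul_right hb (by linarith))
    · rw [norm_mul]; nlinarith
  obtain ⟨z, hz, φ, hφ, hlim⟩ := (hE (max 1 ‖l‖)).tendsto_subseq (x := X)
    (fun m => ⟨hmem m, hle m⟩)
  -- Consecutive terms of the convergent subsequence have difference tending to 0, so the bound
  -- forces z·z = λ.
  have hz2 : z ^ 2 = l := by
    have t1 : Tendsto (fun n => X (φ (n + 1))) atTop (𝓝 z) := hlim.comp (tendsto_add_atTop_nat 1)
    have t2 : Tendsto (fun n => ‖X (φ n) * X (φ (n + 1)) - l‖) atTop (𝓝 ‖z * z - l‖) :=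
      ((hlim.mul t1).sub tendsto_const_nhds).norm
    have t3 : Tendsto (fun n => C * ‖X (φ n) - X (φ (n + 1))‖) atTop (𝓝 (C * ‖z - z‖)) :=
      ((hlim.sub t1).norm).const_mul C
    have := le_of_tendsto_of_tendsto' t2 t3 (fun n => hbound _ _ (hφ (by omega)).ne)
    rw [sub_self, norm_zero, mul_zero, norm_le_zero_iff, sub_eq_zero] at this
    rw [sq, this]
  have hz0 : z ≠ 0 := by rintro rfl; exact h0 (by rw [← hz2]; ring)
  have hz1 : z ≠ 1 := by rintro rfl; exact h1 (by rw [← hz2]; ring)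
  have hzl : z ≠ l := by
    intro hzl
    rw [hzl, sq] at hz2
    exact h1 (mul_left_cancel₀ h0 (by rw [hz2, mul_one]))
  have hden : 4 * z * (z - 1) * (z - l) ≠ 0 := by
    have := dbl_snd_ne_zero h2' hz0 hz1 hzl
    simpa [dbl] using this
  -- Doubling a square root of λ gives 0, and doubling 0 gives infinity. The iterates two steps
  -- after the subsequence therefore cannot stay bounded.
  have hstep : Tendsto (fun n => X (φ n + 1)) atTop (𝓝 0) := by
    have e1 : Tendsto (fun n => (X (φ n) ^ 2 - l) ^ 2) atTop (𝓝 ((z ^ 2 - l) ^ 2)) :=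
      ((hlim.pow 2).sub tendsto_const_nhds).pow 2
    have e2 : Tendsto (fun n => 4 * X (φ n) * (X (φ n) - 1) * (X (φ n) - l)) atTop
        (𝓝 (4 * z * (z - 1) * (z - l))) :=
      ((hlim.const_mul 4).mul (hlim.sub tendsto_const_nhds)).mul (hlim.sub tendsto_const_nhds)
    have e3 := e1.div e2 hden
    rw [hz2, sub_self, zero_pow two_ne_zero, zero_div] at e3
    refine e3.congr' ?_
    filter_upwards [e2.eventually_ne hden] with n hn
    rw [Pi.div_apply, ← hrec]
    exact mul_div_cancel_right₀ _ hn
  have f1 : Tendsto (fun n => ‖(X (φ n + 1) ^ 2 - l) ^ 2‖) atTop (𝓝 ‖((0 : k) ^ 2 - l) ^ 2‖) :=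
    (((hstep.pow 2).sub tendsto_const_nhds).pow 2).norm
  have f2 : Tendsto (fun n => max 1 ‖l‖ * ‖4 * X (φ n + 1) * (X (φ n + 1) - 1) * (X (φ n + 1) - l)‖)
      atTop (𝓝 (max 1 ‖l‖ * ‖4 * (0 : k) * (0 - 1) * (0 - l)‖)) :=
    ((((hstep.const_mul 4).mul (hstep.sub tendsto_const_nhds)).mul
      (hstep.sub tendsto_const_nhds)).norm).const_mul _
  have := le_of_tendsto_of_tendsto' f1 f2 (fun n => by
    rw [← hrec, norm_mul]
    gcongr
    exact hle _)
  simp [h0] at this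

end Criterion

lemma isCompact_closedBall_of_finiteDimensional (E : IntermediateField ℚ_[2] (PadicAlgCl 2))
    [FiniteDimensional ℚ_[2] E] (M : ℝ) :
    IsCompact {z : PadicAlgCl 2 | z ∈ E.toSubfield ∧ ‖z‖ ≤ M} := by
  have : ProperSpace E := FiniteDimensional.proper ℚ_[2] E
  have h := (isCompact_closedBall (0 : E) M).image continuous_subtype_val
  convert h using 1
  ext z
  constructor
  · rintro ⟨hz, hM⟩
    exact ⟨⟨z, hz⟩, by simpa using hM, rfl⟩
  · rintro ⟨w, hw, rfl⟩
    exact ⟨w.2, by simpa using hw⟩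

end SimTorsion

namespace SimTorsion

open Polynomial

/-! ### Certificates for infinite order -/

/-! ### Integrality of coefficients and Lagrange interpolation -/

section Bounds

variable {k : Type*} [NormedField k] [IsUltrametricDist k]

/-- Gauss's lemma for a linear factor: the coefficients of Q are bounded by recursion, downwards
from the top if |η| ≤ 1 and upwards from the bottom if |η| > 1. -/
lemma norm_coeff_le_one_of_eq_mul {G Q : k[X]} {η : k} (h : G = (X - C η) * Q)
    (hG : ∀ j, ‖G.coeff j‖ ≤ 1) (j : ℕ) : ‖Q.coeff j‖ ≤ 1 := by
  have hs : ∀ j, G.coeff (j + 1) = Q.coeff j - η * Q.coeff (j + 1) := by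
    intro j
    rw [h, sub_mul, coeff_sub, coeff_X_mul, coeff_C_mul]
  have h0 : G.coeff 0 = -(η * Q.coeff 0) := by
    rw [h, sub_mul, coeff_sub, coeff_X_mul_zero, coeff_C_mul, zero_sub]
  rcases le_or_gt ‖η‖ 1 with hη | hη
  · have key : ∀ t j, Q.natDegree < j + t → ‖Q.coeff j‖ ≤ 1 := by
      intro t
      induction t with
      | zero => intro j hj; rw [coeff_eq_zero_of_natDegree_lt (by simpa using hj)]; simp
      | succ t ih =>
        intro j hj
        rw [show Q.coeff j = G.coeff (j + 1) + η * Q.coeff (j + 1) by rw [hs]; ring]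
        refine norm_add_le_of_le (hG _) ?_
        rw [norm_mul]
        exact mul_le_one₀ hη (norm_nonneg _) (ih _ (by omega))
    exact key (Q.natDegree + 1) j (by omega)
  · have key : ∀ x : k, ‖η * x‖ ≤ 1 → ‖x‖ ≤ 1 := by
      intro x hx
      rw [norm_mul] at hx
      nlinarith [norm_nonneg x]
    induction j with
    | zero =>
      apply key
      rw [← norm_neg, ← h0]
      exact hG 0
    | succ j ih =>
      apply key
      rw [show η * Q.coeff (j + 1) = Q.coeff j - G.coeff (j + 1) by rw [hs]; ring]
      exact norm_sub_le_of_le ih (hG _)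

/-- A bound for the coefficients of a polynomial from its values at the roots of another one, by
Euler's version of Lagrange interpolation. -/
lemma norm_coeff_le_of_eval_roots [IsAlgClosed k] {G s : k[X]} (hsep : G.Separable)
    (hdeg : s.degree < G.degree) (hG : ∀ j, ‖G.coeff j‖ ≤ 1) {r : ℝ} (hr : 0 ≤ r)
    (hs : ∀ η, G.IsRoot η → ∃ c, ‖c‖ ≤ r ∧ s.eval η = c * G.derivative.eval η) (j : ℕ) :
    ‖s.coeff j‖ ≤ r := by
  classical
  have hG0 : G ≠ 0 := hsep.ne_zero
  choose! c hc1 hc2 using hs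
  set Z := G.roots.toFinset with hZ
  have hcard : G.degree = Z.card := by
    rw [hZ, Multiset.toFinset_card_of_nodup (nodup_roots hsep),
      ← (IsAlgClosed.splits G).natDegree_eq_card_roots, degree_eq_natDegree hG0]
  have hmem : ∀ {η}, η ∈ Z ↔ G.IsRoot η := by
    intro η; rw [hZ, Multiset.mem_toFinset, mem_roots hG0]
  have hfac : ∀ {η}, G.IsRoot η → G = (X - C η) * (G /ₘ (X - C η)) := fun h =>
    (mul_divByMonic_eq_iff_isRoot.2 h).symm
  have heval : ∀ {η}, G.IsRoot η → (G /ₘ (X - C η)).eval η = G.derivative.eval η := by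
    intro η h
    conv_rhs => rw [hfac h]
    simp
  have heval' : ∀ {η ξ}, G.IsRoot η → G.IsRoot ξ → η ≠ ξ → (G /ₘ (X - C η)).eval ξ = 0 := by
    intro η ξ h h' hne
    have := congrArg (eval ξ) (hfac h)
    rw [h'.eq_zero, eval_mul, eq_comm, mul_eq_zero] at this
    refine this.resolve_left ?_
    simpa [sub_eq_zero] using hne.symm
  -- The quotient of G by X - η takes the value G'(η) at η and 0 at the other roots, so no
  -- denominators enter the interpolation formula.
  have hsum : s = ∑ η ∈ Z, C (c η) * (G /ₘ (X - C η)) := by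
    refine eq_of_degrees_lt_of_eval_finset_eq Z (by rwa [← hcard]) ?_ ?_
    · refine (degree_sum_le _ _).trans_lt ?_
      rw [Finset.sup_lt_iff (by rw [← hcard, bot_lt_iff_ne_bot, Ne, degree_eq_bot]; exact hG0)]
      intro η hη
      rw [← hcard]
      rw [← smul_eq_C_mul]
      exact (degree_smul_le _ _).trans_lt
        (degree_divByMonic_lt G _ hG0 (by rw [degree_X_sub_C]; exact one_pos))
    · intro ξ hξ
      rw [eval_finsetSum, Finset.sum_eq_single_of_mem ξ hξ]
      · rw [eval_mul, eval_C, heval (hmem.1 hξ), hc2 ξ (hmem.1 hξ)]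
      · intro η hη hne
        rw [eval_mul, heval' (hmem.1 hη) (hmem.1 hξ) hne, mul_zero]
  rw [hsum, finsetSum_coeff]
  refine IsUltrametricDist.norm_sum_le_of_forall_le_of_nonneg hr fun η hη => ?_
  rw [coeff_C_mul, norm_mul]
  calc ‖c η‖ * ‖(G /ₘ (X - C η)).coeff j‖ ≤ r * 1 := by
        gcongr
        · exact hc1 η (hmem.1 hη)
        · exact norm_coeff_le_one_of_eq_mul (hfac (hmem.1 hη)) hG j
    _ = r := mul_one r

lemma norm_le_one_of_monic {p : ℤ[X]} (hp : p.Monic) {x : k} (hx : aeval x p = 0) : ‖x‖ ≤ 1 := by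
  by_contra! hlt
  have h := hx
  rw [hp.as_sum, map_add, map_pow, aeval_X, map_sum] at h
  have hle : ‖∑ j ∈ Finset.range p.natDegree, aeval x (C (p.coeff j) * X ^ j : ℤ[X])‖ ≤
      ‖x‖ ^ p.natDegree / ‖x‖ := by
    refine IsUltrametricDist.norm_sum_le_of_forall_le_of_nonneg (by positivity) fun j hj => ?_
    rw [le_div_iff₀ (by linarith)]
    rw [map_mul, aeval_C, map_pow, aeval_X, norm_mul, norm_pow, eq_intCast, mul_assoc, ← pow_succ]
    refine (mul_le_of_le_one_left (by positivity)
      (IsUltrametricDist.norm_intCast_le_one k _)).trans ?_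
    exact pow_le_pow_right₀ hlt.le (Finset.mem_range.1 hj)
  rw [add_eq_zero_iff_eq_neg] at h
  have h' := congrArg norm h
  rw [norm_neg, norm_pow] at h'
  rw [← h', le_div_iff₀ (by linarith)] at hle
  have : 0 < ‖x‖ ^ p.natDegree := by positivity
  nlinarith

lemma norm_leadingCoeff_mul_le_one {G : ℤ[X]} {x : k} (hx : aeval x G = 0) :
    ‖(G.leadingCoeff : k) * x‖ ≤ 1 := by
  obtain ⟨p, hp, h⟩ := isIntegral_leadingCoeff_smul (R := ℤ) G x hx
  have := norm_le_one_of_monic hp h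
  rwa [zsmul_eq_mul] at this

/-- In each monomial a power t^j is absorbed by x^j, and the remaining power of t is integral. -/
lemma norm_pow_mul_aeval_le_one {t x : k} (ht : ‖t‖ ≤ 1) (hx : ‖t * x‖ ≤ 1) (h : ℤ[X]) {N : ℕ}
    (hN : h.natDegree ≤ N) : ‖t ^ N * aeval x h‖ ≤ 1 := by
  rw [aeval_eq_sum_range, Finset.mul_sum]
  refine IsUltrametricDist.norm_sum_le_of_forall_le_of_nonneg zero_le_one fun j hj => ?_
  have hj' : j ≤ N := (Nat.lt_succ_iff.1 (Finset.mem_range.1 hj)).trans hN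
  obtain ⟨d, rfl⟩ := Nat.exists_eq_add_of_le hj'
  rw [zsmul_eq_mul, show t ^ (j + d) * ((h.coeff j : k) * x ^ j) =
    (h.coeff j : k) * t ^ d * (t * x) ^ j by ring, norm_mul, norm_mul, norm_pow, norm_pow]
  exact mul_le_one₀ (mul_le_one₀ (IsUltrametricDist.norm_intCast_le_one k _) (by positivity)
    (pow_le_one₀ (norm_nonneg _) ht)) (by positivity) (pow_le_one₀ (norm_nonneg _) hx)

lemma norm_intCast_of_odd (h2 : ‖(2 : k)‖ < 1) {z : ℤ} (hz : Odd z) : ‖(z : k)‖ = 1 := by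
  obtain ⟨m, rfl⟩ := hz
  have : ‖(-(2 * m : k))‖ < ‖(1 : k)‖ := by
    rw [norm_neg, norm_mul, norm_one]
    exact (mul_le_of_le_one_right (norm_nonneg _)
      (IsUltrametricDist.norm_intCast_le_one k m)).trans_lt h2
  have h := norm_sub_eq_left this
  push_cast
  rw [← norm_one (α := k), ← h]
  congr 1
  ring

end Bounds

/-! ### Vanishing at a root as divisibility by an irreducible polynomial -/

section Roots

variable {L : Type*} [Field L] [Algebra ℚ L] {f : ℚ[X]} {x : L}

lemma aeval_eq_zero_iff_dvd (hf : Irreducible f) (hx : aeval x f = 0) (p : ℚ[X]) :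
    aeval x p = 0 ↔ f ∣ p := by
  constructor
  · intro h
    by_contra hn
    obtain ⟨a, b, e⟩ := (hf.coprime_iff_not_dvd).2 hn
    have := congrArg (aeval x) e
    simp [hx, h] at this
  · rintro ⟨q, rfl⟩
    rw [map_mul, hx, zero_mul]

lemma map_orb_aeval (x : L) (b l : ℚ[X]) (m n : ℕ) :
    aeval x (cross (orb l (b, 1) m) (orb l (b, 1) n)) =
      cross (orb (aeval x l) (aeval x b, 1) m) (orb (aeval x l) (aeval x b, 1) n) := by
  have := map_cross_orb (aeval x : ℚ[X] →ₐ[ℚ] L).toRingHom l (b, 1) m n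
  simpa using this

lemma map_pairNum_aeval (x : L) (b l : ℚ[X]) (m n : ℕ) :
    aeval x (pairNum l (orb l (b, 1) m) (orb l (b, 1) n)) =
      pairNum (aeval x l) (orb (aeval x l) (aeval x b, 1) m)
        (orb (aeval x l) (aeval x b, 1) n) := by
  have := map_pairNum (aeval x : ℚ[X] →ₐ[ℚ] L).toRingHom l (orb l (b, 1) m) (orb l (b, 1) n)
  rw [map_orb, map_orb] at this
  simpa using this

lemma prep_aeval_iff (hf : Irreducible f) (hx : aeval x f = 0) (b l : ℚ[X]) :
    Prep (aeval x l) (aeval x b, 1) ↔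
      ∃ m n, m < n ∧ f ∣ cross (orb l (b, 1) m) (orb l (b, 1) n) := by
  simp only [Prep, ← map_orb_aeval, aeval_eq_zero_iff_dvd hf hx]

end Roots

/-- The existence of a certificate for the fact that the point with `x`-coordinate `b θ` on the
curve with parameter `l θ` has infinite order, where `θ` is a root of `f`. -/
def InfiniteOrderCert (f b l : ℚ[X]) : Prop :=
  ∃ (G h s : ℤ[X]) (κ : ℚ) (E V : ℤ) (N m n j : ℕ), G ≠ 0 ∧
    C κ * f = G.map (Int.castRingHom ℚ) ∧ C (E : ℚ) * l = h.map (Int.castRingHom ℚ) ∧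
    h.natDegree ≤ N ∧ s.degree < G.degree ∧ Odd (s.coeff j) ∧
    IsCoprime f (cross (orb l (b, 1) m) (orb l (b, 1) n)) ∧
    f ∣ s.map (Int.castRingHom ℚ) * cross (orb l (b, 1) m) (orb l (b, 1) n) -
      C ((2 * V * E * G.leadingCoeff ^ N : ℤ) : ℚ) * (G.derivative.map (Int.castRingHom ℚ)) *
        pairNum l (orb l (b, 1) m) (orb l (b, 1) n)

lemma aeval_map_int {L : Type*} [Field L] [Algebra ℚ L] (x : L) (p : ℤ[X]) :
    aeval x (p.map (Int.castRingHom ℚ)) = aeval x p := by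
  have : Int.castRingHom ℚ = algebraMap ℤ ℚ := rfl
  rw [this, aeval_map_algebraMap]

/-- Soundness of the certificates. -/
theorem InfiniteOrderCert.not_prep {k : Type*} [NormedField k] [IsUltrametricDist k]
    [IsAlgClosed k] [Algebra ℚ k] (h2 : ‖(2 : k)‖ < 1) (h2' : (2 : k) ≠ 0) {L : Type*} [Field L]
    [Algebra ℚ L] {θ : L}
    {f b l : ℚ[X]} (hf : Irreducible f) (hθ : aeval θ f = 0) (h0 : aeval θ l ≠ 0)
    (h1 : aeval θ l ≠ 1) (hcert : InfiniteOrderCert f b l) :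
    ¬ Prep (aeval θ l) (aeval θ b, 1) := by
  obtain ⟨G, h, s, κ, E, V, N, m, n, j, hG0, hκ, hE, hN, hdeg, hodd, hnd, hdvd⟩ := hcert
  rw [prep_aeval_iff hf hθ]
  intro hp
  have hinj : Function.Injective (Int.castRingHom k) := by
    have : CharZero k := algebraRat.charZero k
    exact Int.cast_injective
  have hκ0 : κ ≠ 0 := by
    rintro rfl
    rw [C_0, zero_mul, eq_comm, Polynomial.map_eq_zero_iff (Int.cast_injective)] at hκ
    exact hG0 hκ
  have hmap : (G.map (Int.castRingHom ℚ)).map (algebraMap ℚ k) = G.map (Int.castRingHom k) := by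
    rw [map_map]; congr 1; exact RingHom.ext_int _ _
  have hsep : (G.map (Int.castRingHom k)).Separable := by
    rw [← hmap, ← hκ]
    exact ((hf.separable).unit_mul (isUnit_C.2 hκ0.isUnit)).map
  have hle : ∀ z : ℤ, ‖(z : k)‖ ≤ 1 := IsUltrametricDist.norm_intCast_le_one k
  -- Torsion makes every coefficient of s have norm at most |2|, whereas an odd integer has norm 1.
  have key := norm_coeff_le_of_eval_roots (k := k) (G := G.map (Int.castRingHom k))
    (s := s.map (Int.castRingHom k)) hsep
    (by rwa [degree_map_eq_of_injective hinj, degree_map_eq_of_injective hinj])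
    (fun j => by rw [coeff_map]; exact hle _) (norm_nonneg (2 : k)) ?_ j
  · rw [coeff_map, eq_intCast, norm_intCast_of_odd h2 hodd] at key
    linarith
  intro η hη
  have hGη : aeval η G = 0 := by
    rw [IsRoot, eval_map] at hη
    exact hη
  have hfη : aeval η f = 0 := by
    have := congrArg (aeval η) hκ
    rw [aeval_map_int, hGη, map_mul, aeval_C] at this
    exact (mul_eq_zero.1 this).resolve_left
      ((_root_.map_ne_zero _).2 hκ0)
  -- All roots of f satisfy the same rational relations, so torsion at θ passes to every 2-adic root
  -- η.
  have transfer : ∀ p : ℚ[X], aeval θ p = 0 ↔ aeval η p = 0 := fun p => by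
    rw [aeval_eq_zero_iff_dvd hf hθ, aeval_eq_zero_iff_dvd hf hfη]
  have hl0 : aeval η l ≠ 0 := mt (transfer l).2 h0
  have hl1 : aeval η l ≠ 1 := by
    have := mt (transfer (l - 1)).2 (by simpa [sub_eq_zero] using h1)
    simpa [sub_eq_zero] using this
  have hprep := (prep_aeval_iff hf hfη b l).2 hp
  set cr := cross (orb (aeval η l) (aeval η b, 1) m) (orb (aeval η l) (aeval η b, 1) n) with hcr
  set pn := pairNum (aeval η l) (orb (aeval η l) (aeval η b, 1) m)
    (orb (aeval η l) (aeval η b, 1) n) with hpn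
  have hcr0 : cr ≠ 0 := by
    rw [hcr, ← map_orb_aeval]
    exact mt (aeval_eq_zero_iff_dvd hf hfη _).1 (hf.coprime_iff_not_dvd.1 hnd)
  have hbd : ‖pn‖ ≤ max 1 ‖aeval η l‖ * ‖cr‖ := hprep.norm_pairNum_le h2 h2' hl0 hl1 hcr0
  have hev := (aeval_eq_zero_iff_dvd hf hfη _).2 hdvd
  rw [map_sub, map_mul, map_mul, map_mul, map_orb_aeval, map_pairNum_aeval, aeval_map_int,
    aeval_map_int, aeval_C, ← hcr, ← hpn, map_intCast, sub_eq_zero] at hev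
  set W : k := E * (G.leadingCoeff : k) ^ N with hW
  -- The integer W clears the denominators of λ(η): both W and Wλ(η) are integral, hence so is
  -- W·pn/cr by the torsion bound.
  have hW1 : ‖W‖ ≤ 1 := by
    rw [hW, norm_mul, norm_pow]
    exact mul_le_one₀ (hle _) (by positivity) (pow_le_one₀ (norm_nonneg _) (hle _))
  have hWl : ‖W * aeval η l‖ ≤ 1 := by
    have e : (E : k) * aeval η l = aeval η h := by
      have := congrArg (aeval η) hE
      rw [aeval_map_int, map_mul, aeval_C, map_intCast] at this
      exact this
    rw [hW, mul_right_comm, e, mul_comm]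
    exact norm_pow_mul_aeval_le_one (hle _) (norm_leadingCoeff_mul_le_one hGη) h hN
  have hWz : ‖W * (pn / cr)‖ ≤ 1 := by
    rw [norm_mul, norm_div]
    have hcrp : 0 < ‖cr‖ := norm_pos_iff.2 hcr0
    have : ‖pn‖ / ‖cr‖ ≤ max 1 ‖aeval η l‖ := by rwa [div_le_iff₀ hcrp]
    refine (mul_le_mul_of_nonneg_left this (norm_nonneg _)).trans ?_
    rw [mul_max_of_nonneg _ _ (norm_nonneg _), mul_one, ← norm_mul]
    exact max_le hW1 hWl
  refine ⟨2 * (V * (W * (pn / cr))), ?_, ?_⟩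
  · rw [norm_mul, norm_mul]
    exact mul_le_of_le_one_right (norm_nonneg _) (mul_le_one₀ (hle _) (norm_nonneg _) hWz)
  · rw [eval_map, derivative_map, eval_map]
    change aeval η s = _ * aeval η (derivative G)
    refine mul_right_cancel₀ hcr0 ?_
    rw [hev, hW]
    push_cast
    field_simp

lemma exists_int_map_eq (p : ℚ[X]) : ∃ (z : ℤ) (q : ℤ[X]), 0 < z ∧
    C (z : ℚ) * p = q.map (Int.castRingHom ℚ) := by
  obtain ⟨z, hz0, hz⟩ := IsLocalization.integerNormalization_spec (nonZeroDivisors ℤ) p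
  replace hz0 : z ≠ 0 := nonZeroDivisors.ne_zero hz0
  set q := IsLocalization.integerNormalization (nonZeroDivisors ℤ) p
  have e : C (z : ℚ) * p = q.map (Int.castRingHom ℚ) := by
    have : Int.castRingHom ℚ = algebraMap ℤ ℚ := rfl
    rw [this, hz]
    ext j
    simp
  rcases lt_or_gt_of_ne hz0 with h | h
  · refine ⟨-z, -q, by omega, ?_⟩
    rw [Polynomial.map_neg, ← e]
    simp
  · exact ⟨z, q, h, e⟩

/-- A rational polynomial with a coefficient that is not integral at two is the quotient of an
integral polynomial with an odd coefficient by an even number. -/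
lemma exists_odd_coeff {r : ℚ[X]} {j : ℕ} (hj : Even (r.coeff j).den) :
    ∃ (V : ℤ) (s : ℤ[X]) (i : ℕ), C ((2 * V : ℤ) : ℚ) * r = s.map (Int.castRingHom ℚ) ∧
      V ≠ 0 ∧ Odd (s.coeff i) := by
  classical
  -- The least positive multiplier n that makes n·r integral is taken. It is even, and if all
  -- coefficients of n·r were even, n/2 would also do.
  have hex : ∃ n : ℕ, 0 < n ∧ ∃ s : ℤ[X], C (n : ℚ) * r = s.map (Int.castRingHom ℚ) := by
    obtain ⟨z, q, hz, hq⟩ := exists_int_map_eq r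
    lift z to ℕ using hz.le
    exact ⟨z, by exact_mod_cast hz, q, by exact_mod_cast hq⟩
  obtain ⟨hn0, s, hs⟩ := Nat.find_spec hex
  have hmin := fun m => Nat.find_min hex (m := m)
  set n := Nat.find hex
  have hcoeff : ∀ i, (n : ℚ) * r.coeff i = (s.coeff i : ℚ) := by
    intro i
    have := congrArg (fun p => coeff p i) hs
    simpa using this
  have hdvd : (r.coeff j).den ∣ n := by
    have h := hcoeff j
    have h3 : (n : ℚ) * (r.coeff j).num = s.coeff j * (r.coeff j).den := by
      rw [← h, mul_assoc, Rat.mul_den_eq_num]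
    have h4 : (n : ℤ) * (r.coeff j).num = s.coeff j * (r.coeff j).den := by exact_mod_cast h3
    have h5 : ((r.coeff j).den : ℤ) ∣ n * (r.coeff j).num := ⟨s.coeff j, by rw [h4]; ring⟩
    have h6 : (r.coeff j).den ∣ n * (r.coeff j).num.natAbs := by
      have := Int.natAbs_dvd_natAbs.2 h5
      simpa [Int.natAbs_mul] using this
    exact (r.coeff j).reduced.symm.dvd_of_dvd_mul_right h6
  obtain ⟨V, hV⟩ := (even_iff_two_dvd.1 hj).trans hdvd
  by_contra hcon
  have hs2 : ∀ i, (2 : ℤ) ∣ s.coeff i := by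
    intro i
    rw [← even_iff_two_dvd, ← Int.not_odd_iff_even]
    intro ho
    refine hcon ⟨V, s, i, ?_, by omega, ho⟩
    rw [← hs, hV]
    push_cast
    rfl
  obtain ⟨s', hs'⟩ := (C_dvd_iff_dvd_coeff (2 : ℤ) s).2 hs2
  refine hmin V (by omega) ⟨by omega, s', ?_⟩
  have h2 : (C (2 : ℚ)) ≠ 0 := by rw [Ne, C_eq_zero]; norm_num
  refine mul_left_cancel₀ h2 ?_
  have : (s.map (Int.castRingHom ℚ)) = C (2 : ℚ) * s'.map (Int.castRingHom ℚ) := by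
    rw [hs', Polynomial.map_mul, map_C]
    simp
  rw [← this, ← hs, hV, ← mul_assoc, ← C_mul]
  push_cast
  rfl

lemma norm_eval_le_of_coeff {k : Type*} [NormedField k] [IsUltrametricDist k] [Algebra ℚ k]
    {r : ℚ[X]} {x : k} {d : ℕ} (hd : r.natDegree ≤ d) (hr : ∀ j, ‖algebraMap ℚ k (r.coeff j)‖ ≤ 1) :
    ‖aeval x r‖ ≤ max 1 ‖x‖ ^ d := by
  rw [aeval_eq_sum_range]
  refine IsUltrametricDist.norm_sum_le_of_forall_le_of_nonneg (by positivity) fun j hj => ?_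
  rw [Algebra.smul_def, norm_mul, norm_pow]
  calc ‖algebraMap ℚ k (r.coeff j)‖ * ‖x‖ ^ j ≤ 1 * max 1 ‖x‖ ^ j := by
        gcongr
        · exact hr j
        · exact le_max_right _ _
    _ ≤ max 1 ‖x‖ ^ d := by
        rw [one_mul]
        exact pow_le_pow_right₀ (le_max_left _ _)
          ((Nat.lt_succ_iff.1 (Finset.mem_range.1 hj)).trans hd)

/-- Completeness of the certificates. -/
theorem infiniteOrderCert_of_not_prep {f b l : ℚ[X]} (hf : Irreducible f) {η : PadicAlgCl 2}
    (hη : aeval η f = 0) (h0 : aeval η l ≠ 0) (h1 : aeval η l ≠ 1)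
    (hnp : ¬ Prep (aeval η l) (aeval η b, 1)) : InfiniteOrderCert f b l := by
  obtain ⟨κ, G, hκ, hG⟩ := exists_int_map_eq f
  obtain ⟨E, h, hE, hh⟩ := exists_int_map_eq l
  have hG0 : G ≠ 0 := by
    rintro rfl
    rw [Polynomial.map_zero, mul_eq_zero, C_eq_zero] at hG
    rcases hG with hG | hG
    · exact hκ.ne' (by exact_mod_cast hG)
    · exact hf.ne_zero hG
  set W : ℤ := E * G.leadingCoeff ^ h.natDegree with hW
  have hW0 : W ≠ 0 := mul_ne_zero hE.ne' (pow_ne_zero _ (leadingCoeff_ne_zero.2 hG0))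
  have hκ0 : (κ : ℚ) ≠ 0 := by exact_mod_cast hκ.ne'
  have hder : aeval η G.derivative ≠ 0 := by
    have hsep : (G.map (Int.castRingHom ℚ)).Separable := by
      rw [← hG]
      exact (hf.separable).unit_mul (isUnit_C.2 hκ0.isUnit)
    have hGη : aeval η (G.map (Int.castRingHom ℚ)) = 0 := by
      rw [← hG, map_mul, hη, mul_zero]
    have := hsep.aeval_derivative_ne_zero hGη
    rwa [derivative_map, aeval_map_int] at this
  set D : PadicAlgCl 2 := W * aeval η G.derivative with hD
  have hD0 : D ≠ 0 := mul_ne_zero (by exact_mod_cast hW0) hder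
  -- The orbit stays in a finite extension of ℚ₂, whose bounded closed subsets are compact.
  let F : IntermediateField ℚ_[2] (PadicAlgCl 2) := IntermediateField.adjoin ℚ_[2] {η}
  have hfin : FiniteDimensional ℚ_[2] F :=
    IntermediateField.adjoin.finiteDimensional (Algebra.IsIntegral.isIntegral η)
  have hηF : η ∈ F := IntermediateField.mem_adjoin_simple_self _ η
  have hmem : ∀ p : ℚ[X], aeval η p ∈ F.toSubfield := by
    intro p
    rw [aeval_eq_sum_range]
    refine sum_mem fun j _ => ?_
    rw [Algebra.smul_def]
    exact mul_mem (by rw [eq_ratCast]; exact SubfieldClass.ratCast_mem _ _) (pow_mem hηF j)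
  -- The constant is chosen so that r(η), defined below, is too large for a polynomial of degree at
  -- most deg f with 2-integral coefficients.
  obtain ⟨m, n, hc, hlt⟩ := exists_lt_norm_pairNum norm_two_lt_one two_ne_zero h0 h1 F.toSubfield
    (isCompact_closedBall_of_finiteDimensional F) (hmem l) (hmem b) hnp
    (max 1 ‖η‖ ^ f.natDegree / ‖D‖)
  rw [← map_orb_aeval, ← map_pairNum_aeval] at hlt
  rw [← map_orb_aeval] at hc
  set cr := cross (orb l (b, 1) m) (orb l (b, 1) n) with hcr
  set pn := pairNum l (orb l (b, 1) m) (orb l (b, 1) n) with hpn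
  have hnd : ¬ f ∣ cr := mt (aeval_eq_zero_iff_dvd hf hη cr).2 hc
  obtain ⟨a, e, hbez⟩ := (hf.coprime_iff_not_dvd).2 hnd
  set p : ℚ[X] := C (W : ℚ) * G.derivative.map (Int.castRingHom ℚ) * pn with hp
  -- By the Bézout identity, e inverts `cr` modulo f, so r represents p/cr with degree less than
  -- that of f.
  set r := (p * e) % f with hr
  have hdvd : f ∣ r * cr - p := by
    have h1 : f ∣ r - p * e := by
      rw [hr]
      exact ⟨-(p * e / f), by linear_combination (EuclideanDomain.mod_add_div (p * e) f)⟩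
    have : r * cr - p = (r - p * e) * cr - f * (p * a) := by
      linear_combination p * hbez
    rw [this]
    exact dvd_sub (h1.mul_right _) (dvd_mul_right _ _)
  have hrdeg : r.degree < f.degree := EuclideanDomain.mod_lt _ hf.ne_zero
  have hrη : aeval η r * aeval η cr = D * aeval η pn := by
    have := (aeval_eq_zero_iff_dvd hf hη _).2 hdvd
    rw [map_sub, map_mul, sub_eq_zero] at this
    rw [this, hp, map_mul, map_mul, aeval_map_int, aeval_C, hD, map_intCast]
    rfl
  have hbig : max 1 ‖η‖ ^ f.natDegree < ‖aeval η r‖ := by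
    have hcp : 0 < ‖aeval η cr‖ := norm_pos_iff.2 hc
    have hDp : 0 < ‖D‖ := norm_pos_iff.2 hD0
    refine lt_of_mul_lt_mul_right ?_ hcp.le
    rw [← norm_mul, hrη, norm_mul]
    calc max 1 ‖η‖ ^ f.natDegree * ‖aeval η cr‖
        = ‖D‖ * (max 1 ‖η‖ ^ f.natDegree / ‖D‖ * ‖aeval η cr‖) := by field_simp
      _ < ‖D‖ * ‖aeval η pn‖ := by gcongr
  -- With odd denominators only, all coefficients of r would be 2-integral, against the size of
  -- r(η).
  have hcoef : ∃ j, Even (r.coeff j).den := by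
    by_contra! hcon
    refine hbig.not_ge (norm_eval_le_of_coeff (natDegree_le_natDegree hrdeg.le) fun j => ?_)
    have hod : Odd ((r.coeff j).den : ℤ) := by
      have := Nat.not_even_iff_odd.1 (hcon j)
      exact_mod_cast this
    have hden := norm_intCast_of_odd norm_two_lt_one hod
    have e1 : algebraMap ℚ (PadicAlgCl 2) (r.coeff j) * (((r.coeff j).den : ℤ) : PadicAlgCl 2) =
        ((r.coeff j).num : PadicAlgCl 2) := by
      have := congrArg (algebraMap ℚ (PadicAlgCl 2)) (Rat.mul_den_eq_num (r.coeff j))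
      rw [map_mul, map_natCast, map_intCast] at this
      exact_mod_cast this
    have e2 := norm_mul (algebraMap ℚ (PadicAlgCl 2) (r.coeff j))
      (((r.coeff j).den : ℤ) : PadicAlgCl 2)
    rw [e1, hden, mul_one] at e2
    rw [← e2]
    exact IsUltrametricDist.norm_intCast_le_one _ _
  obtain ⟨j, hj⟩ := hcoef
  obtain ⟨V, s, i, hs, -, hodd⟩ := exists_odd_coeff hj
  have hdegG : G.degree = f.degree := by
    rw [← degree_map_eq_of_injective (f := Int.castRingHom ℚ) Int.cast_injective, ← hG,
      degree_C_mul hκ0]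
  have hdegs : s.degree ≤ r.degree := by
    rw [← degree_map_eq_of_injective (f := Int.castRingHom ℚ) Int.cast_injective, ← hs]
    rw [← smul_eq_C_mul]
    exact degree_smul_le _ _
  refine ⟨G, h, s, κ, E, V, h.natDegree, m, n, i, hG0, hG, hh, le_rfl,
    hdegs.trans_lt (hrdeg.trans_eq hdegG.symm), hodd,
    hf.coprime_iff_not_dvd.2 hnd, ?_⟩
  have : s.map (Int.castRingHom ℚ) * cr - C ((2 * V * E * G.leadingCoeff ^ h.natDegree : ℤ) : ℚ) *
      G.derivative.map (Int.castRingHom ℚ) * pn = C ((2 * V : ℤ) : ℚ) * (r * cr - p) := by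
    rw [← hs, hp, hW]
    push_cast
    simp only [C_mul]
    ring
  rw [this]
  exact hdvd.mul_left _

end SimTorsion

namespace SimTorsion

open Polynomial Encodable

/-! ### Exact computation with polynomial codes -/

attribute [fun_prop] Primrec
attribute [fun_prop] Primrec.id Primrec.const Primrec.comp Primrec.fst Primrec.snd Primrec.pair

/-! ### Primitive recursive arithmetic on natural numbers, integers and lists -/

section Primrec

variable {α β : Type} [Primcodable α] [Primcodable β]

@[fun_prop]
lemma primrec_and {f g : α → Bool} (hf : Primrec f) (hg : Primrec g) :
    Primrec fun a => f a && g a := Primrec.and.comp hf hg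

@[fun_prop]
lemma primrec_not {f : α → Bool} (hf : Primrec f) : Primrec fun a => !f a := Primrec.not.comp hf

@[fun_prop]
lemma primrec_beq [DecidableEq β] {f g : α → β} (hf : Primrec f) (hg : Primrec g) :
    Primrec fun a => f a == g a := Primrec.beq.comp hf hg

@[fun_prop]
lemma primrec_decide_le {f g : α → ℕ} (hf : Primrec f) (hg : Primrec g) :
    Primrec fun a => decide (f a ≤ g a) :=
  (primrecRel_iff_primrec_decide.1 Primrec.nat_le).comp hf hg

@[fun_prop]
lemma primrec_decide_lt {f g : α → ℕ} (hf : Primrec f) (hg : Primrec g) :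
    Primrec fun a => decide (f a < g a) :=
  (primrecRel_iff_primrec_decide.1 Primrec.nat_lt).comp hf hg

@[fun_prop]
lemma primrec_nat_add {f g : α → ℕ} (hf : Primrec f) (hg : Primrec g) :
    Primrec fun a => f a + g a := Primrec.nat_add.comp hf hg

@[fun_prop]
lemma primrec_nat_sub {f g : α → ℕ} (hf : Primrec f) (hg : Primrec g) :
    Primrec fun a => f a - g a := Primrec.nat_sub.comp hf hg

@[fun_prop]
lemma primrec_nat_mul {f g : α → ℕ} (hf : Primrec f) (hg : Primrec g) :
    Primrec fun a => f a * g a := Primrec.nat_mul.comp hf hg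

@[fun_prop]
lemma primrec_nat_max {f g : α → ℕ} (hf : Primrec f) (hg : Primrec g) :
    Primrec fun a => max (f a) (g a) := Primrec.nat_max.comp hf hg

@[fun_prop]
lemma primrec_list_cons {f : α → β} {g : α → List β} (hf : Primrec f) (hg : Primrec g) :
    Primrec fun a => f a :: g a := Primrec.list_cons.comp hf hg

@[fun_prop]
lemma primrec_list_append {f g : α → List β} (hf : Primrec f) (hg : Primrec g) :
    Primrec fun a => f a ++ g a := Primrec.list_append.comp hf hg

@[fun_prop]
lemma primrec_list_length {f : α → List β} (hf : Primrec f) :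
    Primrec fun a => (f a).length := Primrec.list_length.comp hf

@[fun_prop]
lemma primrec_list_getD {f : α → List β} {g : α → ℕ} (d : β) (hf : Primrec f) (hg : Primrec g) :
    Primrec fun a => (f a).getD (g a) d := (Primrec.list_getD d).comp hf hg

/-- The code of n ≥ 0 is 2n and that of -(n+1) is 2n+1: parity gives the sign, and half of an even
code is the value. -/
lemma primrec_int_toNat : Primrec Int.toNat := by
  have h : Primrec fun z : ℤ =>
      bif (encode z).bodd then 0 else (encode z).div2 :=
    Primrec.cond (Primrec.nat_bodd.comp Primrec.encode) (Primrec.const 0)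
      (Primrec.nat_div2.comp Primrec.encode)
  refine h.of_eq fun z => ?_
  cases z with
  | ofNat n =>
    have : encode (Int.ofNat n) = 2 * n := rfl
    rw [this]
    simp [Nat.div2_val]
  | negSucc n =>
    have : encode (Int.negSucc n) = 2 * n + 1 := rfl
    rw [this]
    simp

lemma primrec_int_subNatNat : Primrec₂ Int.subNatNat := by
  refine Primrec₂.encode_iff.1 ?_
  have h : Primrec fun p : ℕ × ℕ =>
      if p.2 ≤ p.1 then 2 * (p.1 - p.2) else 2 * (p.2 - p.1 - 1) + 1 :=
    Primrec.ite (Primrec.nat_le.comp Primrec.snd Primrec.fst) (by fun_prop) (by fun_prop)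
  refine Primrec.of_eq h fun p => ?_
  obtain ⟨m, n⟩ := p
  simp only
  split_ifs with hle
  · rw [Int.subNatNat_of_le hle]; rfl
  · rw [Int.subNatNat_of_lt (not_le.1 hle), show n - m - 1 = (n - m).pred from rfl]
    rfl

lemma primrec_int_neg : Primrec fun z : ℤ => -z := by
  refine Primrec.encode_iff.1 ?_
  -- Negation exchanges the codes 2n and 2n-1 for n > 0; truncated subtraction fixes the code 0.
  have h : Primrec fun z : ℤ => bif (encode z).bodd then encode z + 1 else encode z - 1 :=
    Primrec.cond (Primrec.nat_bodd.comp Primrec.encode)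
      (Primrec.nat_add.comp Primrec.encode (Primrec.const 1))
      (Primrec.nat_sub.comp Primrec.encode (Primrec.const 1))
  refine h.of_eq fun z => ?_
  cases z with
  | ofNat n =>
    cases n with
    | zero => rfl
    | succ n =>
      have : encode (Int.ofNat (n + 1)) = 2 * (n + 1) := rfl
      rw [this]
      have h' : encode (-(Int.ofNat (n + 1))) = 2 * n + 1 := rfl
      rw [h']
      simp
      omega
  | negSucc n =>
    have : encode (Int.negSucc n) = 2 * n + 1 := rfl
    rw [this]
    have h' : encode (-(Int.negSucc n)) = 2 * (n + 1) := rfl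
    rw [h']
    simp
    omega

@[fun_prop]
lemma primrec_int_add {f g : α → ℤ} (hf : Primrec f) (hg : Primrec g) :
    Primrec fun a => f a + g a := by
  -- An integer is the difference of its positive and negative parts, which reduces the sum to
  -- natural numbers.
  have t : ∀ {h : α → ℤ}, Primrec h → Primrec fun a => (h a).toNat :=
    fun hh => primrec_int_toNat.comp hh
  have s : ∀ {h : α → ℤ}, Primrec h → Primrec fun a => (-h a).toNat :=
    fun hh => primrec_int_toNat.comp (primrec_int_neg.comp hh)
  refine (primrec_int_subNatNat.comp (primrec_nat_add (t hf) (t hg))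
    (primrec_nat_add (s hf) (s hg))).of_eq fun a => ?_
  rw [Int.subNatNat_eq_coe]
  omega

@[fun_prop]
lemma primrec_int_mul {f g : α → ℤ} (hf : Primrec f) (hg : Primrec g) :
    Primrec fun a => f a * g a := by
  have t : ∀ {h : α → ℤ}, Primrec h → Primrec fun a => (h a).toNat :=
    fun hh => primrec_int_toNat.comp hh
  have s : ∀ {h : α → ℤ}, Primrec h → Primrec fun a => (-h a).toNat :=
    fun hh => primrec_int_toNat.comp (primrec_int_neg.comp hh)
  refine (primrec_int_subNatNat.comp
    (primrec_nat_add (primrec_nat_mul (t hf) (t hg)) (primrec_nat_mul (s hf) (s hg)))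
    (primrec_nat_add (primrec_nat_mul (t hf) (s hg))
      (primrec_nat_mul (s hf) (t hg)))).of_eq fun a => ?_
  rw [Int.subNatNat_eq_coe]
  have e1 := Int.toNat_sub_toNat_neg (f a)
  have e2 := Int.toNat_sub_toNat_neg (g a)
  conv_rhs => rw [← e1, ← e2]
  push_cast
  ring

@[fun_prop]
lemma primrec_int_natCast {f : α → ℕ} (hf : Primrec f) : Primrec fun a => (f a : ℤ) := by
  refine (primrec_int_subNatNat.comp hf (Primrec.const 0)).of_eq fun a => ?_
  rw [Int.subNatNat_eq_coe]
  simp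

end Primrec

/-- Addition of codes of rational numbers. -/
def ratAdd (c d : ℤ × ℕ) : ℤ × ℕ :=
  (c.1 * ((d.2 + 1 : ℕ) : ℤ) + d.1 * ((c.2 + 1 : ℕ) : ℤ), (c.2 + 1) * (d.2 + 1) - 1)

/-- Multiplication of codes of rational numbers. -/
def ratMul (c d : ℤ × ℕ) : ℤ × ℕ := (c.1 * d.1, (c.2 + 1) * (d.2 + 1) - 1)

/-- A code stores the denominator minus one; truncation is harmless because the product is positive.
-/
lemma ratOfCode_den (m n : ℕ) :
    (((m + 1) * (n + 1) - 1 : ℕ) : ℚ) + 1 = ((m : ℚ) + 1) * ((n : ℚ) + 1) := by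
  rw [Nat.cast_sub (Nat.mul_pos m.succ_pos n.succ_pos)]
  push_cast
  ring

lemma ratOfCode_ratAdd (c d : ℤ × ℕ) : ratOfCode (ratAdd c d) = ratOfCode c + ratOfCode d := by
  have h1 : (c.2 : ℚ) + 1 ≠ 0 := by positivity
  have h2 : (d.2 : ℚ) + 1 ≠ 0 := by positivity
  simp only [ratOfCode, ratAdd, ratOfCode_den]
  push_cast
  field_simp

lemma ratOfCode_ratMul (c d : ℤ × ℕ) : ratOfCode (ratMul c d) = ratOfCode c * ratOfCode d := by
  have h1 : (c.2 : ℚ) + 1 ≠ 0 := by positivity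
  have h2 : (d.2 : ℚ) + 1 ≠ 0 := by positivity
  simp only [ratOfCode, ratMul, ratOfCode_den]
  push_cast
  field_simp

lemma ratOfCode_int (z : ℤ) : ratOfCode (z, 0) = z := by simp [ratOfCode]

lemma ratOfCode_surjective (q : ℚ) : ∃ c, ratOfCode c = q := by
  refine ⟨(q.num, q.den - 1), ?_⟩
  have : ((q.den - 1 : ℕ) : ℚ) + 1 = q.den := by
    rw [Nat.cast_sub q.den_pos]; simp
  simp only [ratOfCode, this]
  exact Rat.num_div_den q

lemma ratOfCode_eq_zero_iff (c : ℤ × ℕ) : ratOfCode c = 0 ↔ c.1 = 0 := by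
  have h1 : (c.2 : ℚ) + 1 ≠ 0 := by positivity
  simp [ratOfCode, h1]

/-- Addition of codes of polynomials. -/
def codeAdd (p q : PolyCode) : PolyCode :=
  (List.range (max p.length q.length)).map fun j => ratAdd (p.getD j (0, 0)) (q.getD j (0, 0))

/-- Multiplication of codes of polynomials. -/
def codeMul (p q : PolyCode) : PolyCode :=
  p.foldr (fun c r => codeAdd (q.map (ratMul c)) ((0, 0) :: r)) []

/-- Subtraction of codes of polynomials. -/
def codeSub (p q : PolyCode) : PolyCode := codeAdd p (codeMul [(-1, 0)] q)

/-- The code of the derivative of a polynomial. -/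
def codeDeriv (p : PolyCode) : PolyCode :=
  (List.range p.length).map fun j => ratMul (((j + 1 : ℕ) : ℤ), 0) (p.getD (j + 1) (0, 0))

/-- Powers of codes of polynomials. -/
def codePow (p : PolyCode) (n : ℕ) : PolyCode :=
  Nat.rec (motive := fun _ => PolyCode) [(1, 0)] (fun _ r => codeMul p r) n

/-- The code of a polynomial with integral coefficients. -/
def codeOfInts (p : List ℤ) : PolyCode := p.map fun z => (z, 0)

/-- The test for a code of the polynomial zero. -/
def codeIsZero (p : PolyCode) : Bool := p.foldr (fun c r => (c.1 == 0) && r) true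

/-- The test for equality of the encoded polynomials. -/
def codeEq (p q : PolyCode) : Bool := codeIsZero (codeSub p q)

section PrimrecCode

variable {α : Type} [Primcodable α]

@[fun_prop]
lemma primrec_ratAdd {f g : α → ℤ × ℕ} (hf : Primrec f) (hg : Primrec g) :
    Primrec fun a => ratAdd (f a) (g a) := by
  unfold ratAdd; fun_prop

@[fun_prop]
lemma primrec_ratMul {f g : α → ℤ × ℕ} (hf : Primrec f) (hg : Primrec g) :
    Primrec fun a => ratMul (f a) (g a) := by
  unfold ratMul; fun_prop

@[fun_prop]
lemma primrec_codeAdd {f g : α → PolyCode} (hf : Primrec f) (hg : Primrec g) :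
    Primrec fun a => codeAdd (f a) (g a) := by
  unfold codeAdd
  refine Primrec.list_map (Primrec.list_range.comp (by fun_prop)) ?_
  change Primrec fun x : α × ℕ => _
  fun_prop

@[fun_prop]
lemma primrec_codeMul {f g : α → PolyCode} (hf : Primrec f) (hg : Primrec g) :
    Primrec fun a => codeMul (f a) (g a) := by
  unfold codeMul
  refine Primrec.list_foldr (h := fun a x => codeAdd ((g a).map (ratMul x.1)) ((0, 0) :: x.2)) hf
    (Primrec.const []) ?_
  change Primrec fun x : α × ((ℤ × ℕ) × PolyCode) => _
  refine primrec_codeAdd (Primrec.list_map (by fun_prop) ?_) (by fun_prop)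
  change Primrec fun x : (α × ((ℤ × ℕ) × PolyCode)) × (ℤ × ℕ) => _
  fun_prop

@[fun_prop]
lemma primrec_codeSub {f g : α → PolyCode} (hf : Primrec f) (hg : Primrec g) :
    Primrec fun a => codeSub (f a) (g a) := by
  unfold codeSub; fun_prop

@[fun_prop]
lemma primrec_codeDeriv {f : α → PolyCode} (hf : Primrec f) :
    Primrec fun a => codeDeriv (f a) := by
  unfold codeDeriv
  refine Primrec.list_map (Primrec.list_range.comp (by fun_prop)) ?_
  change Primrec fun x : α × ℕ => _
  fun_prop

@[fun_prop]
lemma primrec_codePow {f : α → PolyCode} {g : α → ℕ} (hf : Primrec f) (hg : Primrec g) :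
    Primrec fun a => codePow (f a) (g a) := by
  unfold codePow
  refine Primrec.nat_rec' (h := fun a x => codeMul (f a) x.2) hg (Primrec.const [(1, 0)]) ?_
  change Primrec fun x : α × (ℕ × PolyCode) => _
  fun_prop

@[fun_prop]
lemma primrec_codeOfInts {f : α → List ℤ} (hf : Primrec f) :
    Primrec fun a => codeOfInts (f a) := by
  unfold codeOfInts
  refine Primrec.list_map hf ?_
  change Primrec fun x : α × ℤ => _
  fun_prop

@[fun_prop]
lemma primrec_codeEq {f g : α → PolyCode} (hf : Primrec f) (hg : Primrec g) :
    Primrec fun a => codeEq (f a) (g a) := by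
  unfold codeEq codeIsZero
  refine Primrec.list_foldr (f := fun a => codeSub (f a) (g a))
    (h := fun _ (x : (ℤ × ℕ) × Bool) => (x.1.1 == 0) && x.2) (by fun_prop)
    (Primrec.const true) ?_
  change Primrec fun x : α × ((ℤ × ℕ) × Bool) => _
  fun_prop

end PrimrecCode

/-! ### Correctness of the operations on codes -/

section Semantics

lemma polyOfCode_cons (c : ℤ × ℕ) (p : PolyCode) :
    polyOfCode (c :: p) = C (ratOfCode c) + X * polyOfCode p := rfl

/-- The default (0, 0) encodes 0, so entries past the end of a list are zero coefficients. -/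
lemma coeff_polyOfCode (p : PolyCode) (j : ℕ) :
    (polyOfCode p).coeff j = ratOfCode (p.getD j (0, 0)) := by
  induction p generalizing j with
  | nil => simp [polyOfCode, ratOfCode]
  | cons c p ih =>
    rw [polyOfCode_cons, coeff_add]
    cases j with
    | zero => simp
    | succ j => simp [ih, coeff_C_succ]

lemma getD_map_range {β : Type} (f : ℕ → β) (n j : ℕ) (d : β) :
    ((List.range n).map f).getD j d = if j < n then f j else d := by
  split_ifs with h
  · simp [List.getD_eq_getElem?_getD, h]
  · simp [List.getD_eq_getElem?_getD, h]

lemma getD_of_length_le {β : Type} {p : List β} {j : ℕ} (d : β) (h : p.length ≤ j) :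
    p.getD j d = d := List.getD_eq_default _ _ h

lemma polyOfCode_codeAdd (p q : PolyCode) :
    polyOfCode (codeAdd p q) = polyOfCode p + polyOfCode q := by
  ext j
  rw [coeff_add, coeff_polyOfCode, coeff_polyOfCode, coeff_polyOfCode, codeAdd, getD_map_range]
  split_ifs with h
  · exact ratOfCode_ratAdd _ _
  · rw [not_lt, max_le_iff] at h
    rw [getD_of_length_le _ h.1, getD_of_length_le _ h.2]
    simp [ratOfCode]

lemma polyOfCode_map_ratMul (c : ℤ × ℕ) (q : PolyCode) :
    polyOfCode (q.map (ratMul c)) = C (ratOfCode c) * polyOfCode q := by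
  induction q with
  | nil => simp [polyOfCode]
  | cons d q ih =>
    rw [List.map_cons, polyOfCode_cons, polyOfCode_cons, ih, ratOfCode_ratMul, C_mul]
    ring

lemma polyOfCode_codeMul (p q : PolyCode) :
    polyOfCode (codeMul p q) = polyOfCode p * polyOfCode q := by
  induction p with
  | nil => simp [codeMul, polyOfCode]
  | cons c p ih =>
    change polyOfCode (codeAdd (q.map (ratMul c)) ((0, 0) :: codeMul p q)) = _
    rw [polyOfCode_codeAdd, polyOfCode_map_ratMul, polyOfCode_cons, polyOfCode_cons, ih,
      ratOfCode_int]
    simp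
    ring

lemma polyOfCode_const (z : ℤ) : polyOfCode [(z, 0)] = C (z : ℚ) := by
  rw [polyOfCode_cons, ratOfCode_int]; simp [polyOfCode]

lemma polyOfCode_codeSub (p q : PolyCode) :
    polyOfCode (codeSub p q) = polyOfCode p - polyOfCode q := by
  rw [codeSub, polyOfCode_codeAdd, polyOfCode_codeMul, polyOfCode_const]
  simp
  ring

lemma polyOfCode_codeDeriv (p : PolyCode) :
    polyOfCode (codeDeriv p) = derivative (polyOfCode p) := by
  ext j
  rw [coeff_derivative, coeff_polyOfCode, coeff_polyOfCode, codeDeriv, getD_map_range]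
  split_ifs with h
  · rw [ratOfCode_ratMul, ratOfCode_int]
    push_cast
    ring
  · rw [getD_of_length_le _ (by omega : p.length ≤ j + 1)]
    simp [ratOfCode]

lemma polyOfCode_codePow (p : PolyCode) (n : ℕ) :
    polyOfCode (codePow p n) = polyOfCode p ^ n := by
  induction n with
  | zero =>
    change polyOfCode [(1, 0)] = _
    rw [polyOfCode_const]; simp
  | succ n ih =>
    change polyOfCode (codeMul p (codePow p n)) = _
    rw [polyOfCode_codeMul, ih, pow_succ']

lemma codeIsZero_iff (p : PolyCode) : codeIsZero p = true ↔ polyOfCode p = 0 := by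
  have h : codeIsZero p = true ↔ ∀ c ∈ p, c.1 = 0 := by
    induction p with
    | nil => simp [codeIsZero]
    | cons c p ih =>
      have : codeIsZero (c :: p) = ((c.1 == 0) && codeIsZero p) := rfl
      rw [this, Bool.and_eq_true, ih]
      simp
  rw [h]
  constructor
  · intro hp
    ext j
    rw [coeff_polyOfCode, coeff_zero, ratOfCode_eq_zero_iff]
    rcases lt_or_ge j p.length with hj | hj
    · rw [List.getD_eq_getElem _ _ hj]
      exact hp _ (List.getElem_mem hj)
    · rw [getD_of_length_le _ hj]
  · intro hp c hc
    obtain ⟨j, hj, rfl⟩ := List.getElem_of_mem hc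
    rw [← ratOfCode_eq_zero_iff, ← List.getD_eq_getElem p (0, 0) hj, ← coeff_polyOfCode, hp,
      coeff_zero]

/-- Codes are not unique: fractions may be unreduced and lists may end in zeros. Equality is
therefore tested on the difference. -/
lemma codeEq_iff (p q : PolyCode) : codeEq p q = true ↔ polyOfCode p = polyOfCode q := by
  rw [codeEq, codeIsZero_iff, polyOfCode_codeSub, sub_eq_zero]

lemma polyOfCode_surjective (p : ℚ[X]) : ∃ c, polyOfCode c = p := by
  choose f hf using ratOfCode_surjective
  refine ⟨(List.range (p.natDegree + 1)).map fun j => f (p.coeff j), ?_⟩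
  ext j
  rw [coeff_polyOfCode, getD_map_range]
  split_ifs with h
  · exact hf _
  · rw [coeff_eq_zero_of_natDegree_lt (by omega)]
    simp [ratOfCode]

/-- The polynomial with a given list of integral coefficients. -/
noncomputable def intPoly (p : List ℤ) : ℤ[X] := ∑ j ∈ Finset.range p.length, C (p.getD j 0) * X ^ j

lemma coeff_intPoly (p : List ℤ) (j : ℕ) : (intPoly p).coeff j = p.getD j 0 := by
  rw [intPoly, finsetSum_coeff]
  simp only [coeff_C_mul, coeff_X_pow, mul_ite, mul_one, mul_zero, Finset.sum_ite_eq,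
    Finset.mem_range]
  split_ifs with h
  · rfl
  · rw [getD_of_length_le _ (not_lt.1 h)]

lemma polyOfCode_codeOfInts (p : List ℤ) :
    polyOfCode (codeOfInts p) = (intPoly p).map (Int.castRingHom ℚ) := by
  ext j
  rw [coeff_polyOfCode, coeff_map, coeff_intPoly, codeOfInts]
  rw [show ((0 : ℤ), (0 : ℕ)) = (fun z : ℤ => (z, (0 : ℕ))) 0 from rfl, List.getD_map,
    ratOfCode_int]
  simp

lemma intPoly_range (p : ℤ[X]) {n : ℕ} (h : p.natDegree < n) :
    intPoly ((List.range n).map p.coeff) = p := by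
  ext j
  rw [coeff_intPoly, getD_map_range]
  split_ifs with hj
  · rfl
  · rw [coeff_eq_zero_of_natDegree_lt (by omega)]

lemma degree_intPoly_lt (p : List ℤ) : (intPoly p).degree < p.length := by
  rw [degree_lt_iff_coeff_zero]
  intro j hj
  rw [coeff_intPoly, getD_of_length_le _ hj]

end Semantics

end SimTorsion

namespace SimTorsion

open Polynomial Encodable

/-! ### Recursively enumerable predicates -/

/-- A predicate is recursively enumerable if it is the projection of a primitive recursive one. -/
def RecEnum {α : Type} [Primcodable α] (p : α → Prop) : Prop :=
  ∃ q : α × ℕ → Bool, Primrec q ∧ ∀ a, p a ↔ ∃ n, q (a, n) = true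

section RecEnum

variable {α β : Type} [Primcodable α] [Primcodable β]

/-- Witnesses of any encodable type are found by decoding natural numbers; a number that decodes to
nothing is rejected. -/
lemma RecEnum.of_exists {p : α → Prop} (q : α × β → Bool) (hq : Primrec q)
    (h : ∀ a, p a ↔ ∃ b, q (a, b) = true) : RecEnum p := by
  refine ⟨fun x => Option.casesOn (decode (α := β) x.2) false fun b => q (x.1, b), ?_, ?_⟩
  · refine Primrec.option_casesOn (Primrec.decode.comp Primrec.snd) (Primrec.const false) ?_
    change Primrec fun y : (α × ℕ) × β => _
    fun_prop
  · intro a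
    rw [h]
    constructor
    · rintro ⟨b, hb⟩
      exact ⟨encode b, by simpa using hb⟩
    · rintro ⟨n, hn⟩
      cases hd : decode (α := β) n with
      | none => simp [hd] at hn
      | some b => exact ⟨b, by simpa [hd] using hn⟩

lemma RecEnum.of_bool {p : α → Prop} (q : α → Bool) (hq : Primrec q)
    (h : ∀ a, p a ↔ q a = true) : RecEnum p :=
  ⟨fun x => q x.1, by fun_prop, fun a => by simp [h]⟩

lemma RecEnum.eq [DecidableEq β] {f g : α → β} (hf : Primrec f) (hg : Primrec g) :
    RecEnum fun a => f a = g a :=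
  .of_bool (fun a => decide (f a = g a))
    ((primrecRel_iff_primrec_decide.1 Primrec.eq).comp hf hg) (by simp)

lemma RecEnum.comp {p : β → Prop} (h : RecEnum p) {g : α → β} (hg : Primrec g) :
    RecEnum fun a => p (g a) := by
  obtain ⟨q, hq, hp⟩ := h
  exact ⟨fun x => q (g x.1, x.2), by fun_prop, fun a => hp (g a)⟩

lemma RecEnum.and {p p' : α → Prop} (h : RecEnum p) (h' : RecEnum p') :
    RecEnum fun a => p a ∧ p' a := by
  obtain ⟨q, hq, hp⟩ := h
  obtain ⟨q', hq', hp'⟩ := h'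
  refine .of_exists (β := ℕ × ℕ) (fun x => q (x.1, x.2.1) && q' (x.1, x.2.2)) (by fun_prop) ?_
  intro a
  rw [hp, hp']
  simp

lemma RecEnum.or {p p' : α → Prop} (h : RecEnum p) (h' : RecEnum p') :
    RecEnum fun a => p a ∨ p' a := by
  obtain ⟨q, hq, hp⟩ := h
  obtain ⟨q', hq', hp'⟩ := h'
  refine ⟨fun x => q x || q' x, Primrec.or.comp hq hq', fun a => ?_⟩
  simp only [hp, hp', ← exists_or, Bool.or_eq_true]

lemma RecEnum.ex {p : α → β → Prop} (h : RecEnum fun x : α × β => p x.1 x.2) :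
    RecEnum fun a => ∃ b, p a b := by
  obtain ⟨q, hq, hp⟩ := h
  refine .of_exists (β := β × ℕ) (fun x => q ((x.1, x.2.1), x.2.2)) (by fun_prop) fun a => ?_
  constructor
  · rintro ⟨b, hb⟩
    obtain ⟨n, hn⟩ := (hp (a, b)).1 hb
    exact ⟨(b, n), hn⟩
  · rintro ⟨⟨b, n⟩, hn⟩
    exact ⟨b, (hp (a, b)).2 ⟨n, hn⟩⟩

/-- A recursively enumerable relation is uniformized by a partial recursive function. -/
lemma RecEnum.exists_partrec {p : α × β → Prop} (h : RecEnum p) :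
    ∃ F : α →. β, Partrec F ∧ ∀ a, (∃ b, p (a, b)) → ∃ b ∈ F a, p (a, b) := by
  obtain ⟨q, hq, hp⟩ := h
  -- The search runs over pairs of a value and a witness for it, so one unbounded search suffices.
  let g : α → ℕ → Option β := fun a n =>
    (decode (α := β × ℕ) n).bind fun y => bif q ((a, y.1), y.2) then some y.1 else none
  have hg : Primrec₂ g := by
    refine Primrec.option_bind (Primrec.decode.comp Primrec.snd) ?_
    change Primrec fun y : (α × ℕ) × (β × ℕ) => _
    exact Primrec.cond (by fun_prop) (Primrec.option_some.comp (by fun_prop)) (Primrec.const none)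
  refine ⟨fun a => Nat.rfindOpt (g a), Partrec.rfindOpt hg.to_comp, ?_⟩
  rintro a ⟨b, hb⟩
  obtain ⟨n, hn⟩ := (hp (a, b)).1 hb
  have hdom : (Nat.rfindOpt (g a)).Dom := by
    rw [Nat.rfindOpt_dom]
    exact ⟨encode (b, n), b, by simp [g, hn]⟩
  refine ⟨(Nat.rfindOpt (g a)).get hdom, Part.get_mem hdom, ?_⟩
  obtain ⟨m, hm⟩ := Nat.rfindOpt_spec (Part.get_mem hdom)
  generalize (Nat.rfindOpt (g a)).get hdom = c at hm
  simp only [g, Option.mem_def, Option.bind_eq_some_iff] at hm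
  obtain ⟨⟨c', n'⟩, -, hm⟩ := hm
  cases hq' : q ((a, c'), n') with
  | false => simp [hq'] at hm
  | true =>
    simp only [hq', cond_true, Option.some.injEq] at hm
    subst hm
    exact (hp (a, c')).2 ⟨n', hq'⟩

end RecEnum

/-! ### Enumerating certificates -/

/-- The duplication map on codes. -/
def dblCode (l : PolyCode) (v : PolyCode × PolyCode) : PolyCode × PolyCode :=
  (codePow (codeSub (codePow v.1 2) (codeMul l (codePow v.2 2))) 2,
    codeMul (codeMul (codeMul (codeMul [(4, 0)] v.1) v.2) (codeSub v.1 v.2))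
      (codeSub v.1 (codeMul l v.2)))

/-- The iterates of the duplication map on codes. -/
def orbCode (l b : PolyCode) (m : ℕ) : PolyCode × PolyCode :=
  Nat.rec (motive := fun _ => PolyCode × PolyCode) (b, [(1, 0)]) (fun _ v => dblCode l v) m

/-- The code of `cross`. -/
def crossCode (v w : PolyCode × PolyCode) : PolyCode :=
  codeSub (codeMul v.1 w.2) (codeMul w.1 v.2)

/-- The code of `pairNum`. -/
def pairNumCode (l : PolyCode) (v w : PolyCode × PolyCode) : PolyCode :=
  codeSub (codeMul v.1 w.1) (codeMul (codeMul l v.2) w.2)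

section

variable {α : Type} [Primcodable α]

@[fun_prop]
lemma primrec_orbCode {f g : α → PolyCode} {h : α → ℕ} (hf : Primrec f) (hg : Primrec g)
    (hh : Primrec h) : Primrec fun a => orbCode (f a) (g a) (h a) := by
  unfold orbCode
  refine Primrec.nat_rec' (g := fun a => (g a, [(1, 0)])) (h := fun a x => dblCode (f a) x.2) hh
    (by fun_prop) ?_
  change Primrec fun x : α × (ℕ × (PolyCode × PolyCode)) => _
  unfold dblCode
  fun_prop

@[fun_prop]
lemma primrec_crossCode {f g : α → PolyCode × PolyCode} (hf : Primrec f) (hg : Primrec g) :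
    Primrec fun a => crossCode (f a) (g a) := by
  unfold crossCode; fun_prop

@[fun_prop]
lemma primrec_pairNumCode {h : α → PolyCode} {f g : α → PolyCode × PolyCode} (hh : Primrec h)
    (hf : Primrec f) (hg : Primrec g) : Primrec fun a => pairNumCode (h a) (f a) (g a) := by
  unfold pairNumCode; fun_prop

end

lemma polyOfCode_orbCode (l b : PolyCode) (m : ℕ) :
    (polyOfCode (orbCode l b m).1, polyOfCode (orbCode l b m).2) =
      orb (polyOfCode l) (polyOfCode b, 1) m := by
  induction m with
  | zero =>
    change (polyOfCode b, polyOfCode [(1, 0)]) = _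
    rw [polyOfCode_const]; simp
  | succ m ih =>
    rw [orb_succ, ← ih]
    change (polyOfCode (dblCode l (orbCode l b m)).1, polyOfCode (dblCode l (orbCode l b m)).2) = _
    simp only [dblCode, dbl, polyOfCode_codePow, polyOfCode_codeSub, polyOfCode_codeMul,
      polyOfCode_const]
    have h4 : (C (4 : ℚ) : ℚ[X]) = 4 := map_ofNat C 4
    simp [h4]

lemma polyOfCode_crossCode (l b : PolyCode) (m n : ℕ) :
    polyOfCode (crossCode (orbCode l b m) (orbCode l b n)) =
      cross (orb (polyOfCode l) (polyOfCode b, 1) m) (orb (polyOfCode l) (polyOfCode b, 1) n) := by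
  rw [← polyOfCode_orbCode, ← polyOfCode_orbCode, crossCode, polyOfCode_codeSub,
    polyOfCode_codeMul, polyOfCode_codeMul, cross]

lemma polyOfCode_pairNumCode (l b : PolyCode) (m n : ℕ) :
    polyOfCode (pairNumCode l (orbCode l b m) (orbCode l b n)) =
      pairNum (polyOfCode l) (orb (polyOfCode l) (polyOfCode b, 1) m)
        (orb (polyOfCode l) (polyOfCode b, 1) n) := by
  rw [← polyOfCode_orbCode, ← polyOfCode_orbCode, pairNumCode, polyOfCode_codeSub,
    polyOfCode_codeMul, polyOfCode_codeMul, polyOfCode_codeMul, pairNum]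

/-- Divisibility of the encoded polynomials. -/
def CodeDvd (f p : PolyCode) : Prop := polyOfCode f ∣ polyOfCode p

/-- Coprimality of the encoded polynomials. -/
def CodeCoprime (f p : PolyCode) : Prop := IsCoprime (polyOfCode f) (polyOfCode p)

/-- The point with `x`-coordinate `b` on the curve with parameter `l` is torsion modulo `f`. -/
def CodeTorsion (f b l : PolyCode) : Prop :=
  ∃ m n, m < n ∧ CodeDvd f (crossCode (orbCode l b m) (orbCode l b n))

/-- There is a certificate for infinite order. -/
def CodeInfinite (f b l : PolyCode) : Prop :=
  InfiniteOrderCert (polyOfCode f) (polyOfCode b) (polyOfCode l)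

lemma recEnum_codeDvd : RecEnum fun x : PolyCode × PolyCode => CodeDvd x.1 x.2 := by
  refine .of_exists (β := PolyCode) (fun x => codeEq x.1.2 (codeMul x.1.1 x.2)) (by fun_prop) ?_
  rintro ⟨f, p⟩
  simp only [codeEq_iff, polyOfCode_codeMul, CodeDvd, dvd_def]
  constructor
  · rintro ⟨q, hq⟩
    obtain ⟨c, rfl⟩ := polyOfCode_surjective q
    exact ⟨c, hq⟩
  · rintro ⟨c, hc⟩
    exact ⟨_, hc⟩

/-- A Bézout pair is a finite witness. For irreducible f this makes nonvanishing at a root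
enumerable, just as vanishing is. -/
lemma recEnum_codeCoprime : RecEnum fun x : PolyCode × PolyCode => CodeCoprime x.1 x.2 := by
  refine .of_exists (β := PolyCode × PolyCode)
    (fun x => codeEq (codeAdd (codeMul x.2.1 x.1.1) (codeMul x.2.2 x.1.2)) [(1, 0)])
    (by fun_prop) ?_
  rintro ⟨f, p⟩
  simp only [codeEq_iff, polyOfCode_codeMul, polyOfCode_codeAdd, CodeCoprime, IsCoprime,
    polyOfCode_const]
  constructor
  · rintro ⟨a, b, h⟩
    obtain ⟨a, rfl⟩ := polyOfCode_surjective a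
    obtain ⟨b, rfl⟩ := polyOfCode_surjective b
    exact ⟨(a, b), by simpa using h⟩
  · rintro ⟨⟨a, b⟩, h⟩
    exact ⟨_, _, by simpa using h⟩

lemma recEnum_codeTorsion :
    RecEnum fun x : PolyCode × PolyCode × PolyCode => CodeTorsion x.1 x.2.1 x.2.2 := by
  refine .ex (.ex (.and (.of_bool (fun x => decide (x.1.2 < x.2)) (by fun_prop) (by simp)) ?_))
  exact recEnum_codeDvd.comp (g := fun x : ((PolyCode × PolyCode × PolyCode) × ℕ) × ℕ =>
    (x.1.1.1, crossCode (orbCode x.1.1.2.2 x.1.1.2.1 x.1.2) (orbCode x.1.1.2.2 x.1.1.2.1 x.2)))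
    (by fun_prop)

/-- The test whether the given data form a certificate for infinite order, apart from
divisibility conditions. -/
def certTest (f l : PolyCode) (g : List ℤ) (t : ℤ) (h s : List ℤ) (κ : ℤ × ℕ) (E : ℤ)
    (N j : ℕ) (z : ℤ) : Bool :=
  !(t == 0) && (codeEq (codeMul [κ] f) (codeOfInts (g ++ [t])) &&
    (codeEq (codeMul [(E, 0)] l) (codeOfInts h) && (decide (h.length ≤ N + 1) &&
      (decide (s.length ≤ g.length) && (s.getD j 0 == 2 * z + 1)))))

/-- The polynomial that is required to be divisible by `f` in a certificate. -/
def certCode (l b : PolyCode) (g : List ℤ) (t : ℤ) (s : List ℤ) (E V : ℤ) (N m n : ℕ) : PolyCode :=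
  codeSub (codeMul (codeOfInts s) (crossCode (orbCode l b m) (orbCode l b n)))
    (codeMul (codeMul (codeMul [(2 * V * E, 0)] (codePow [(t, 0)] N))
      (codeDeriv (codeOfInts (g ++ [t])))) (pairNumCode l (orbCode l b m) (orbCode l b n)))

/-- Storing the nonzero leading coefficient as a separate last entry lets the degree be read off
from the length. -/
lemma natDegree_intPoly_concat {g : List ℤ} {t : ℤ} (ht : t ≠ 0) :
    (intPoly (g ++ [t])).natDegree = g.length := by
  have hc : (intPoly (g ++ [t])).coeff g.length = t := by simp [coeff_intPoly]
  refine le_antisymm ?_ (le_natDegree_of_ne_zero (by rwa [hc]))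
  rw [natDegree_le_iff_coeff_eq_zero]
  intro j hj
  rw [coeff_intPoly, getD_of_length_le _ (by simpa using hj)]

lemma leadingCoeff_intPoly_concat {g : List ℤ} {t : ℤ} (ht : t ≠ 0) :
    (intPoly (g ++ [t])).leadingCoeff = t := by
  rw [leadingCoeff, natDegree_intPoly_concat ht, coeff_intPoly]
  simp

lemma polyOfCode_certCode (l b : PolyCode) (g : List ℤ) {t : ℤ} (ht : t ≠ 0) (s : List ℤ)
    (E V : ℤ) (N m n : ℕ) :
    polyOfCode (certCode l b g t s E V N m n) = (intPoly s).map (Int.castRingHom ℚ) *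
      cross (orb (polyOfCode l) (polyOfCode b, 1) m) (orb (polyOfCode l) (polyOfCode b, 1) n) -
      C ((2 * V * E * (intPoly (g ++ [t])).leadingCoeff ^ N : ℤ) : ℚ) *
        ((intPoly (g ++ [t])).derivative.map (Int.castRingHom ℚ)) *
        pairNum (polyOfCode l) (orb (polyOfCode l) (polyOfCode b, 1) m)
          (orb (polyOfCode l) (polyOfCode b, 1) n) := by
  rw [certCode, leadingCoeff_intPoly_concat ht]
  simp only [polyOfCode_codeSub, polyOfCode_codeMul, polyOfCode_codeOfInts, polyOfCode_crossCode,
    polyOfCode_pairNumCode, polyOfCode_codeDeriv, polyOfCode_codePow, polyOfCode_const,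
    derivative_map]
  push_cast
  simp only [C_mul, C_pow]

lemma certTest_iff {f l : PolyCode} {g : List ℤ} {t : ℤ} {h s : List ℤ} {κ : ℤ × ℕ} {E : ℤ}
    {N j : ℕ} {z : ℤ} : certTest f l g t h s κ E N j z = true ↔ t ≠ 0 ∧
      C (ratOfCode κ) * polyOfCode f = (intPoly (g ++ [t])).map (Int.castRingHom ℚ) ∧
      C (E : ℚ) * polyOfCode l = (intPoly h).map (Int.castRingHom ℚ) ∧
      h.length ≤ N + 1 ∧ s.length ≤ g.length ∧ (intPoly s).coeff j = 2 * z + 1 := by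
  simp only [certTest, Bool.and_eq_true, codeEq_iff, polyOfCode_codeMul, polyOfCode_codeOfInts,
    decide_eq_true_eq, polyOfCode_const, coeff_intPoly, Bool.not_eq_true', beq_iff_eq,
    beq_eq_false_iff_ne, polyOfCode_cons κ]
  simp [polyOfCode]

/-- The directly testable conditions are separated from coprimality and divisibility, which need
witnesses of their own. -/
lemma codeInfinite_iff (f b l : PolyCode) : CodeInfinite f b l ↔
    ∃ (c : List ℤ × ℤ × List ℤ × List ℤ × (ℤ × ℕ) × ℤ × ℕ × ℕ × ℤ) (d : ℤ × ℕ × ℕ),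
      certTest f l c.1 c.2.1 c.2.2.1 c.2.2.2.1 c.2.2.2.2.1 c.2.2.2.2.2.1 c.2.2.2.2.2.2.1
        c.2.2.2.2.2.2.2.1 c.2.2.2.2.2.2.2.2 = true ∧
      CodeCoprime f (crossCode (orbCode l b d.2.1) (orbCode l b d.2.2)) ∧
      CodeDvd f (certCode l b c.1 c.2.1 c.2.2.2.1 c.2.2.2.2.2.1 d.1 c.2.2.2.2.2.2.1
        d.2.1 d.2.2) := by
  constructor
  · rintro ⟨G, h, s, κ, E, V, N, m, n, j, hG0, hκ, hE, hN, hdeg, ⟨z, hz⟩, hco, hdvd⟩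
    obtain ⟨κ, rfl⟩ := ratOfCode_surjective κ
    -- The odd coefficient shows s ≠ 0, so degrees can be compared as natural numbers.
    have hsG : s.natDegree < G.natDegree := by
      refine natDegree_lt_natDegree ?_ hdeg
      rintro rfl
      rw [coeff_zero] at hz
      omega
    have ht : G.leadingCoeff ≠ 0 := leadingCoeff_ne_zero.2 hG0
    have eG : intPoly ((List.range G.natDegree).map G.coeff ++ [G.leadingCoeff]) = G := by
      conv_rhs => rw [← intPoly_range G (Nat.lt_succ_self _)]
      rw [List.range_succ, List.map_append]
      rfl
    have eh : intPoly ((List.range (h.natDegree + 1)).map h.coeff) = h :=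
      intPoly_range h (Nat.lt_succ_self _)
    have es : intPoly ((List.range G.natDegree).map s.coeff) = s := intPoly_range s hsG
    refine ⟨((List.range G.natDegree).map G.coeff, G.leadingCoeff,
      (List.range (h.natDegree + 1)).map h.coeff, (List.range G.natDegree).map s.coeff,
      κ, E, N, j, z), (V, m, n), ?_, ?_, ?_⟩
    · rw [certTest_iff, eG, eh, es]
      exact ⟨ht, hκ, hE, by simpa using hN, by simp, hz⟩
    · rwa [CodeCoprime, polyOfCode_crossCode]
    · rwa [CodeDvd, polyOfCode_certCode _ _ _ ht, eG, es]
  · rintro ⟨⟨g, t, h, s, κ, E, N, j, z⟩, ⟨V, m, n⟩, htest, hco, hdvd⟩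
    obtain ⟨ht, hκ, hE, hh, hs, hz⟩ := certTest_iff.1 htest
    rw [CodeCoprime, polyOfCode_crossCode] at hco
    rw [CodeDvd, polyOfCode_certCode _ _ _ ht] at hdvd
    have hG0 : intPoly (g ++ [t]) ≠ 0 := by
      rw [← leadingCoeff_ne_zero, leadingCoeff_intPoly_concat ht]
      exact ht
    refine ⟨intPoly (g ++ [t]), intPoly h, intPoly s, ratOfCode κ, E, V, N, m, n, j, hG0, hκ, hE,
      ?_, ?_, ⟨z, hz⟩, hco, hdvd⟩
    · rw [natDegree_le_iff_coeff_eq_zero]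
      intro i hi
      have hh' : h.length ≤ N + 1 := hh
      rw [coeff_intPoly, getD_of_length_le _ (by omega)]
    · rw [degree_eq_natDegree hG0, natDegree_intPoly_concat ht]
      exact (degree_intPoly_lt s).trans_le (by exact_mod_cast hs)

lemma recEnum_codeInfinite :
    RecEnum fun x : PolyCode × PolyCode × PolyCode => CodeInfinite x.1 x.2.1 x.2.2 := by
  simp only [codeInfinite_iff]
  refine .ex (.ex (.and ?_ (.and ?_ ?_)))
  · refine .of_bool _ ?_ fun _ => Iff.rfl
    unfold certTest
    fun_prop
  · exact recEnum_codeCoprime.comp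
      (g := fun x : ((PolyCode × PolyCode × PolyCode) × (List ℤ × ℤ × List ℤ × List ℤ × (ℤ × ℕ) ×
        ℤ × ℕ × ℕ × ℤ)) × (ℤ × ℕ × ℕ) => (x.1.1.1, crossCode (orbCode x.1.1.2.2 x.1.1.2.1 x.2.2.1)
          (orbCode x.1.1.2.2 x.1.1.2.1 x.2.2.2))) (by fun_prop)
  · refine recEnum_codeDvd.comp
      (g := fun x : ((PolyCode × PolyCode × PolyCode) × (List ℤ × ℤ × List ℤ × List ℤ × (ℤ × ℕ) ×
        ℤ × ℕ × ℕ × ℤ)) × (ℤ × ℕ × ℕ) => (x.1.1.1, certCode x.1.1.2.2 x.1.1.2.1 x.1.2.1 x.1.2.2.1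
          x.1.2.2.2.2.1 x.1.2.2.2.2.2.2.1 x.2.1 x.1.2.2.2.2.2.2.2.1 x.2.2.1 x.2.2.2)) ?_
    unfold certCode
    fun_prop

end SimTorsion

namespace SimTorsion

open Polynomial

/-! ### The algorithm -/

/-! ### Statements about values at θ as statements about codes -/

section Evaluation

variable {f : PolyCode} {θ : Qbar}

lemma evalCode_eq_zero_iff (hf : Irreducible (polyOfCode f)) (hθ : aeval θ (polyOfCode f) = 0)
    (p : PolyCode) : evalCode θ p = 0 ↔ CodeDvd f p :=
  aeval_eq_zero_iff_dvd hf hθ _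

lemma evalCode_ne_zero_iff (hf : Irreducible (polyOfCode f)) (hθ : aeval θ (polyOfCode f) = 0)
    (p : PolyCode) : evalCode θ p ≠ 0 ↔ CodeCoprime f p := by
  rw [Ne, evalCode_eq_zero_iff hf hθ, CodeCoprime, hf.coprime_iff_not_dvd, CodeDvd]

lemma evalCode_const (θ : Qbar) (z : ℤ) : evalCode θ [(z, 0)] = z := by
  rw [evalCode, polyOfCode_const]
  simp

lemma evalCode_codeSub (θ : Qbar) (p q : PolyCode) :
    evalCode θ (codeSub p q) = evalCode θ p - evalCode θ q := by
  simp only [evalCode, polyOfCode_codeSub, map_sub]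

lemma evalCode_codeMul (θ : Qbar) (p q : PolyCode) :
    evalCode θ (codeMul p q) = evalCode θ p * evalCode θ q := by
  simp only [evalCode, polyOfCode_codeMul, map_mul]

lemma prep_evalCode_iff (hf : Irreducible (polyOfCode f)) (hθ : aeval θ (polyOfCode f) = 0)
    (b l : PolyCode) : Prep (evalCode θ l) (evalCode θ b, 1) ↔ CodeTorsion f b l :=
  prep_aeval_iff hf hθ (polyOfCode b) (polyOfCode l) |>.trans <| by
    simp only [CodeTorsion, CodeDvd, polyOfCode_crossCode]

/-- Completeness of the certificates is applied at the 2-adic root i θ and soundness at θ itself. -/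
lemma not_prep_evalCode_iff (i : Qbar →+* PadicAlgCl 2) (hf : Irreducible (polyOfCode f))
    (hθ : aeval θ (polyOfCode f) = 0) {b l : PolyCode} (h0 : evalCode θ l ≠ 0)
    (h1 : evalCode θ l ≠ 1) : ¬ Prep (evalCode θ l) (evalCode θ b, 1) ↔ CodeInfinite f b l := by
  have hi : ∀ p : ℚ[X], aeval (i θ) p = i (aeval θ p) := fun p =>
    aeval_algHom_apply i.toRatAlgHom θ p
  constructor
  · intro h
    refine infiniteOrderCert_of_not_prep hf (η := i θ) (by rw [hi, hθ, map_zero]) ?_ ?_ ?_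
    · rw [hi]; exact (map_ne_zero i).2 h0
    · rw [hi]; exact (map_ne_one_iff i i.injective).2 h1
    · rw [hi, hi]; exact fun hp => h ((prep_one_map_iff i).1 hp)
  · exact fun h => InfiniteOrderCert.not_prep (k := PadicAlgCl 2) norm_two_lt_one two_ne_zero hf hθ
      h0 h1 h

/-- The number with code `c` belongs to `T₂` of the numbers with codes `a` and `b`. -/
def CodeMem (f a b c : PolyCode) : Prop :=
  CodeCoprime f c ∧ CodeCoprime f (codeSub c [(1, 0)]) ∧ CodeTorsion f a c ∧ CodeTorsion f b c

/-- The number with code `c` does not belong to `T₂` of the numbers with codes `a` and `b`. -/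
def CodeNotMem (f a b c : PolyCode) : Prop :=
  CodeDvd f c ∨ CodeDvd f (codeSub c [(1, 0)]) ∨
    (CodeCoprime f c ∧ CodeCoprime f (codeSub c [(1, 0)])) ∧
      (CodeInfinite f a c ∨ CodeInfinite f b c)

lemma evalCode_mem_T₂_iff (hf : Irreducible (polyOfCode f)) (hθ : aeval θ (polyOfCode f) = 0)
    (a b c : PolyCode) :
    (evalCode θ c : ℂ) ∈ T₂ (evalCode θ a : ℂ) (evalCode θ b : ℂ) ↔ CodeMem f a b c := by
  rw [T₂, Set.mem_inter_iff, mem_T_coe_iff, mem_T_coe_iff, CodeMem, ← prep_evalCode_iff hf hθ,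
    ← prep_evalCode_iff hf hθ, ← evalCode_ne_zero_iff hf hθ, ← evalCode_ne_zero_iff hf hθ,
    evalCode_codeSub, evalCode_const, Int.cast_one, sub_ne_zero]
  tauto

/-- The values 0 and 1 are split off first, since certificates are meaningful only for nonsingular
curves. -/
lemma evalCode_notMem_T₂_iff (i : Qbar →+* PadicAlgCl 2) (hf : Irreducible (polyOfCode f))
    (hθ : aeval θ (polyOfCode f) = 0) (a b c : PolyCode) :
    (evalCode θ c : ℂ) ∉ T₂ (evalCode θ a : ℂ) (evalCode θ b : ℂ) ↔ CodeNotMem f a b c := by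
  rw [T₂, Set.mem_inter_iff, mem_T_coe_iff, mem_T_coe_iff, CodeNotMem,
    ← evalCode_eq_zero_iff hf hθ, ← evalCode_eq_zero_iff hf hθ, ← evalCode_ne_zero_iff hf hθ,
    ← evalCode_ne_zero_iff hf hθ, evalCode_codeSub, evalCode_const, Int.cast_one, sub_ne_zero,
    sub_eq_zero]
  by_cases h0 : evalCode θ c = 0
  · simp [h0]
  by_cases h1 : evalCode θ c = 1
  · simp [h1]
  rw [← not_prep_evalCode_iff i hf hθ h0 h1, ← not_prep_evalCode_iff i hf hθ h0 h1]
  tauto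

end Evaluation

/-! ### Enumerability of membership and of nonmembership -/

section Enumeration

lemma recEnum_codeMem : RecEnum fun x : PolyCode × PolyCode × PolyCode × PolyCode =>
    CodeMem x.1 x.2.1 x.2.2.1 x.2.2.2 := by
  refine .and ?_ (.and ?_ (.and ?_ ?_))
  · exact recEnum_codeCoprime.comp
      (g := fun x : PolyCode × PolyCode × PolyCode × PolyCode => (x.1, x.2.2.2)) (by fun_prop)
  · exact recEnum_codeCoprime.comp (g := fun x : PolyCode × PolyCode × PolyCode × PolyCode =>
      (x.1, codeSub x.2.2.2 [(1, 0)])) (by fun_prop)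
  · exact recEnum_codeTorsion.comp (g := fun x : PolyCode × PolyCode × PolyCode × PolyCode =>
      (x.1, x.2.1, x.2.2.2)) (by fun_prop)
  · exact recEnum_codeTorsion.comp (g := fun x : PolyCode × PolyCode × PolyCode × PolyCode =>
      (x.1, x.2.2.1, x.2.2.2)) (by fun_prop)

lemma recEnum_codeNotMem : RecEnum fun x : PolyCode × PolyCode × PolyCode × PolyCode =>
    CodeNotMem x.1 x.2.1 x.2.2.1 x.2.2.2 := by
  refine .or ?_ (.or ?_ (.and (.and ?_ ?_) (.or ?_ ?_)))
  · exact recEnum_codeDvd.comp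
      (g := fun x : PolyCode × PolyCode × PolyCode × PolyCode => (x.1, x.2.2.2)) (by fun_prop)
  · exact recEnum_codeDvd.comp (g := fun x : PolyCode × PolyCode × PolyCode × PolyCode =>
      (x.1, codeSub x.2.2.2 [(1, 0)])) (by fun_prop)
  · exact recEnum_codeCoprime.comp
      (g := fun x : PolyCode × PolyCode × PolyCode × PolyCode => (x.1, x.2.2.2)) (by fun_prop)
  · exact recEnum_codeCoprime.comp (g := fun x : PolyCode × PolyCode × PolyCode × PolyCode =>
      (x.1, codeSub x.2.2.2 [(1, 0)])) (by fun_prop)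
  · exact recEnum_codeInfinite.comp (g := fun x : PolyCode × PolyCode × PolyCode × PolyCode =>
      (x.1, x.2.1, x.2.2.2)) (by fun_prop)
  · exact recEnum_codeInfinite.comp (g := fun x : PolyCode × PolyCode × PolyCode × PolyCode =>
      (x.1, x.2.2.1, x.2.2.2)) (by fun_prop)

/-- The list `L` consists of a code of the quotient `n / d` if this belongs to `T₂`, and it is
empty otherwise or if `d` vanishes. -/
def QuotientList (f a b d n : PolyCode) (L : List PolyCode) : Prop :=
  (L = [] ∧ CodeDvd f d) ∨ ∃ c, (CodeCoprime f d ∧ CodeDvd f (codeSub (codeMul d c) n)) ∧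
    ((L = [c] ∧ CodeMem f a b c) ∨ (L = [] ∧ CodeNotMem f a b c))

variable {α : Type} [Primcodable α]

lemma recEnum_quotientList {f a b d n : α → PolyCode} {L : α → List PolyCode} (hf : Primrec f)
    (ha : Primrec a) (hb : Primrec b) (hd : Primrec d) (hn : Primrec n) (hL : Primrec L) :
    RecEnum fun x => QuotientList (f x) (a x) (b x) (d x) (n x) (L x) := by
  refine .or (.and (.eq hL (by fun_prop)) (recEnum_codeDvd.comp (g := fun x => (f x, d x)) (by fun_prop)))
    (.ex (.and (.and ?_ ?_) (.or (.and ?_ ?_) (.and ?_ ?_))))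
  · exact recEnum_codeCoprime.comp (g := fun x : α × PolyCode => (f x.1, d x.1)) (by fun_prop)
  · exact recEnum_codeDvd.comp (g := fun x : α × PolyCode =>
      (f x.1, codeSub (codeMul (d x.1) x.2) (n x.1))) (by fun_prop)
  · exact .eq (by fun_prop) (by fun_prop)
  · exact recEnum_codeMem.comp (g := fun x : α × PolyCode => (f x.1, a x.1, b x.1, x.2))
      (by fun_prop)
  · exact .eq (by fun_prop) (by fun_prop)
  · exact recEnum_codeNotMem.comp (g := fun x : α × PolyCode => (f x.1, a x.1, b x.1, x.2))
      (by fun_prop)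

end Enumeration

/-! ### Lists of codes for the elements found -/

section Lists

variable {f : PolyCode} {θ : Qbar}

/-- The list `L` of codes represents the elements with the property `P`. -/
def Represents (θ : Qbar) (L : List PolyCode) (P : Qbar → Prop) : Prop :=
  ∀ l, (∃ c ∈ L, l = evalCode θ c) ↔ P l

lemma Represents.append {L L' : List PolyCode} {P P' : Qbar → Prop} (h : Represents θ L P)
    (h' : Represents θ L' P') : Represents θ (L ++ L') fun l => P l ∨ P' l := by
  intro l
  change _ ↔ P l ∨ P' l
  rw [← h l, ← h' l]
  simp only [List.mem_append, or_and_right, exists_or]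

/-- The search may return any list with this property, so each such list has to be correct. -/
lemma QuotientList.represents (i : Qbar →+* PadicAlgCl 2) (hf : Irreducible (polyOfCode f))
    (hθ : aeval θ (polyOfCode f) = 0) {a b d n : PolyCode} {L : List PolyCode}
    (h : QuotientList f a b d n L) : Represents θ L fun l =>
      evalCode θ d ≠ 0 ∧ l = evalCode θ n / evalCode θ d ∧
        (l : ℂ) ∈ T₂ (evalCode θ a : ℂ) (evalCode θ b : ℂ) := by
  intro l
  rcases h with ⟨rfl, hd⟩ | ⟨c, ⟨hd, hc⟩, h⟩
  · rw [← evalCode_eq_zero_iff hf hθ] at hd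
    simp [hd]
  rw [← evalCode_ne_zero_iff hf hθ] at hd
  rw [← evalCode_eq_zero_iff hf hθ, evalCode_codeSub, evalCode_codeMul, sub_eq_zero] at hc
  have e : evalCode θ n / evalCode θ d = evalCode θ c := by
    rw [← hc, mul_div_cancel_left₀ _ hd]
  rw [e]
  rcases h with ⟨rfl, hm⟩ | ⟨rfl, hm⟩
  · rw [← evalCode_mem_T₂_iff hf hθ] at hm
    constructor
    · rintro ⟨c', hc', rfl⟩
      rw [List.mem_singleton] at hc'
      subst hc'
      exact ⟨hd, rfl, hm⟩
    · rintro ⟨-, rfl, -⟩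
      exact ⟨c, List.mem_singleton_self c, rfl⟩
  · rw [← evalCode_notMem_T₂_iff i hf hθ] at hm
    constructor
    · simp
    · rintro ⟨-, rfl, h⟩
      exact absurd h hm

lemma exists_quotientList (i : Qbar →+* PadicAlgCl 2) (hf : Irreducible (polyOfCode f))
    (hθ : aeval θ (polyOfCode f) = 0) (a b d n : PolyCode) :
    ∃ L, QuotientList f a b d n L := by
  by_cases hd : CodeDvd f d
  · exact ⟨[], .inl ⟨rfl, hd⟩⟩
  have hco : IsCoprime (polyOfCode f) (polyOfCode d) := hf.coprime_iff_not_dvd.2 hd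
  obtain ⟨u, w, huw⟩ := id hco
  -- By the Bézout identity w inverts the denominator modulo f, so w·n is the quotient as a
  -- polynomial in θ.
  obtain ⟨c, hc⟩ := polyOfCode_surjective (w * polyOfCode n)
  have hdvd : CodeDvd f (codeSub (codeMul d c) n) := by
    rw [CodeDvd, polyOfCode_codeSub, polyOfCode_codeMul, hc]
    refine ⟨-(u * polyOfCode n), ?_⟩
    linear_combination polyOfCode n * huw
  by_cases hm : (evalCode θ c : ℂ) ∈ T₂ (evalCode θ a : ℂ) (evalCode θ b : ℂ)
  · exact ⟨[c], .inr ⟨c, ⟨hco, hdvd⟩, .inl ⟨rfl, (evalCode_mem_T₂_iff hf hθ a b c).1 hm⟩⟩⟩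
  · exact ⟨[], .inr ⟨c, ⟨hco, hdvd⟩, .inr ⟨rfl, (evalCode_notMem_T₂_iff i hf hθ a b c).1 hm⟩⟩⟩

/-- The list `L` represents the elements of `S` of the number with code `s` that belong to
`T₂`. -/
def SList (f a b s : PolyCode) (L : List PolyCode) : Prop :=
  ∃ K : (List PolyCode × List PolyCode) × (List PolyCode × List PolyCode),
    L = (K.1.1 ++ K.1.2) ++ (K.2.1 ++ K.2.2) ∧
      QuotientList f a b [(1, 0)] s K.1.1 ∧
      QuotientList f a b [(1, 0)] (codeMul s s) K.1.2 ∧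
      QuotientList f a b [(1, 0)] (codeMul s (codeSub [(2, 0)] s)) K.2.1 ∧
      QuotientList f a b (codeSub (codeMul [(2, 0)] s) [(1, 0)]) (codeMul s s) K.2.2

lemma recEnum_sList {α : Type} [Primcodable α] {f a b s : α → PolyCode} {L : α → List PolyCode}
    (hf : Primrec f) (ha : Primrec a) (hb : Primrec b) (hs : Primrec s) (hL : Primrec L) :
    RecEnum fun x => SList (f x) (a x) (b x) (s x) (L x) := by
  refine .ex (.and (.eq (by fun_prop) (by fun_prop)) (.and ?_ (.and ?_ (.and ?_ ?_))))
  all_goals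
    exact recEnum_quotientList (by fun_prop) (by fun_prop) (by fun_prop) (by fun_prop)
      (by fun_prop) (by fun_prop)

lemma SList.represents (i : Qbar →+* PadicAlgCl 2) (hf : Irreducible (polyOfCode f))
    (hθ : aeval θ (polyOfCode f) = 0) {a b s : PolyCode} {L : List PolyCode}
    (h : SList f a b s L) : Represents θ L fun l =>
      l ∈ S (evalCode θ s) ∧ (l : ℂ) ∈ T₂ (evalCode θ a : ℂ) (evalCode θ b : ℂ) := by
  obtain ⟨K, rfl, h1, h2, h3, h4⟩ := h
  intro l
  refine (((h1.represents i hf hθ).append (h2.represents i hf hθ)).append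
    ((h3.represents i hf hθ).append (h4.represents i hf hθ)) l).trans ?_
  simp only [evalCode_const, evalCode_codeMul, evalCode_codeSub, S, Set.mem_ofPred_eq, Int.cast_one,
    div_one, ne_eq, one_ne_zero, not_false_eq_true, true_and, Int.cast_ofNat, ← pow_two]
  tauto

lemma exists_sList (i : Qbar →+* PadicAlgCl 2) (hf : Irreducible (polyOfCode f))
    (hθ : aeval θ (polyOfCode f) = 0) (a b s : PolyCode) : ∃ L, SList f a b s L := by
  obtain ⟨L1, h1⟩ := exists_quotientList i hf hθ a b [(1, 0)] s
  obtain ⟨L2, h2⟩ := exists_quotientList i hf hθ a b [(1, 0)] (codeMul s s)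
  obtain ⟨L3, h3⟩ := exists_quotientList i hf hθ a b [(1, 0)] (codeMul s (codeSub [(2, 0)] s))
  obtain ⟨L4, h4⟩ := exists_quotientList i hf hθ a b (codeSub (codeMul [(2, 0)] s) [(1, 0)])
    (codeMul s s)
  exact ⟨_, ((L1, L2), (L3, L4)), rfl, h1, h2, h3, h4⟩

end Lists

/-- The search looks for lists together with evidence for every candidate in S(α) and S(β). It uses
only the codes; θ and i enter the proof that such lists exist and are complete. -/
theorem exists_partrec_T₂ :
    ∃ F : PolyCode × PolyCode × PolyCode →. List PolyCode, Partrec F ∧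
      ∀ (f a b : PolyCode) (θ : Qbar),
        Irreducible (polyOfCode f) → aeval θ (polyOfCode f) = 0 →
        evalCode θ a ≠ 0 → evalCode θ a ≠ 1 → evalCode θ b ≠ 0 → evalCode θ b ≠ 1 →
        (∃ i : Qbar →+* PadicAlgCl 2, R i (evalCode θ a) ∩ R i (evalCode θ b) = ∅) →
        ∃ L ∈ F (f, a, b),
          T₂ (evalCode θ a : ℂ) (evalCode θ b : ℂ) =
            {l : ℂ | ∃ c ∈ L, l = (evalCode θ c : ℂ)} := by
  have h : RecEnum fun x : (PolyCode × PolyCode × PolyCode) × List PolyCode =>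
      ∃ K : List PolyCode × List PolyCode, x.2 = K.1 ++ K.2 ∧
        SList x.1.1 x.1.2.1 x.1.2.2 x.1.2.1 K.1 ∧ SList x.1.1 x.1.2.1 x.1.2.2 x.1.2.2 K.2 := by
    refine .ex (.and (.eq (by fun_prop) (by fun_prop)) (.and ?_ ?_))
    all_goals
      exact recEnum_sList (by fun_prop) (by fun_prop) (by fun_prop) (by fun_prop)
        (by fun_prop)
  obtain ⟨F, hF, hspec⟩ := h.exists_partrec
  refine ⟨F, hF, ?_⟩
  rintro f a b θ hf hθ ha0 ha1 hb0 hb1 ⟨i, hR⟩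
  obtain ⟨L₁, h₁⟩ := exists_sList i hf hθ a b a
  obtain ⟨L₂, h₂⟩ := exists_sList i hf hθ a b b
  -- The existence of some valid list makes the search terminate; the list found may be a different
  -- one, with its own evidence.
  obtain ⟨L, hL, ⟨K₁, K₂⟩, e, k₁, k₂⟩ := hspec (f, a, b) ⟨_, (L₁, L₂), rfl, h₁, h₂⟩
  refine ⟨L, hL, ?_⟩
  have hrep := (k₁.represents i hf hθ).append (k₂.represents i hf hθ)
  rw [← show L = K₁ ++ K₂ from e] at hrep
  ext l
  constructor
  · intro hl
    obtain ⟨l, hl', rfl⟩ := T₂_subset i ha0 ha1 hb0 hb1 hR hl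
    obtain ⟨c, hc, rfl⟩ := (hrep l).2
      ((union_subset_S_union_S i _ _ hl').imp (fun h => ⟨h, hl⟩) fun h => ⟨h, hl⟩)
    exact ⟨c, hc, rfl⟩
  · rintro ⟨c, hc, rfl⟩
    rcases (hrep _).1 ⟨c, hc, rfl⟩ with h | h
    · exact h.2
    · exact h.2

end SimTorsion

open SimTorsion in
theorem propositionP :
    (∀ (i : Qbar →+* PadicAlgCl 2) (α β : Qbar), α ≠ 0 → α ≠ 1 → β ≠ 0 → β ≠ 1 →
      -- the inclusions and the finiteness
      (R i α ∩ R i β = ∅ →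
        T₂ (α : ℂ) (β : ℂ) ⊆
            ((↑) : Qbar → ℂ) '' ((S α ∩ S β) ∪ (S α ∩ R i β) ∪ (R i α ∩ S β)) ∧
          (S α ∩ S β) ∪ (S α ∩ R i β) ∪ (R i α ∩ S β) ⊆ S α ∪ S β ∧
          (T₂ (α : ℂ) (β : ℂ)).Finite) ∧
      -- the five sufficient conditions
      (rho i α ≠ rho i β → R i α ∩ R i β = ∅) ∧
      (rho i α = rho i β →
        rho i α ∉ ({((0 : residueField₂) : OnePoint residueField₂),
          ((1 : residueField₂) : OnePoint residueField₂), OnePoint.infty} :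
            Set (OnePoint residueField₂)) →
        v i (α - β) ≤ ((1 / 2 : ℝ) : WithTop ℝ) → R i α ∩ R i β = ∅) ∧
      (rho i α = ((1 : residueField₂) : OnePoint residueField₂) →
        rho i β = ((1 : residueField₂) : OnePoint residueField₂) →
        0 < v i (α - 1) → v i (α - 1) ≤ 1 → v i (α - β) = v i (α - 1) →
        R i α ∩ R i β = ∅) ∧
      (rho i α = ((0 : residueField₂) : OnePoint residueField₂) →
        rho i β = ((0 : residueField₂) : OnePoint residueField₂) →
        v i α ≤ 1 → v i (α - β) = v i α → R i α ∩ R i β = ∅) ∧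
      (rho i α = OnePoint.infty → rho i β = OnePoint.infty →
        ((-1 : ℝ) : WithTop ℝ) ≤ v i α → v i (α - β) = v i β → R i α ∩ R i β = ∅)) ∧
    -- the effectivity: one algorithm computes all the sets `T(α, β)` in question
    (∃ F : PolyCode × PolyCode × PolyCode →. List PolyCode, Partrec F ∧
      ∀ (f a b : PolyCode) (θ : Qbar),
        Irreducible (polyOfCode f) → Polynomial.aeval θ (polyOfCode f) = 0 →
        evalCode θ a ≠ 0 → evalCode θ a ≠ 1 → evalCode θ b ≠ 0 → evalCode θ b ≠ 1 →
        (∃ i : Qbar →+* PadicAlgCl 2, R i (evalCode θ a) ∩ R i (evalCode θ b) = ∅) →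
        ∃ L ∈ F (f, a, b),
          T₂ (evalCode θ a : ℂ) (evalCode θ b : ℂ) =
            {l : ℂ | ∃ c ∈ L, l = (evalCode θ c : ℂ)}) := by
  refine ⟨fun i α β ha0 ha1 hb0 hb1 => ⟨fun h => ⟨T₂_subset i ha0 ha1 hb0 hb1 h,
    union_subset_S_union_S i α β, T₂_finite i ha0 ha1 hb0 hb1 h⟩, disjoint_of_rho_ne,
    fun h hn hv => disjoint_of_v_le_half h (fun hinf => hn (by simp [hinf])) hv,
    fun ha hb _ hv hab => disjoint_of_rho_eq_one ha hb hv hab,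
    fun ha hb hv hab => disjoint_of_rho_eq_zero ha hb hv hab,
    fun ha hb hv hab => disjoint_of_rho_eq_infty ha hb hv hab⟩, exists_partrec_T₂⟩
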